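/- Let $\Omega\subset\mathbb{R}^3$ be a bounded open set with smooth boundary $\Gamma=\partial\Omega$ and outward unit normal $\vec n$, and for small $\varepsilon>0$ let $$\omega_\varepsilon=\{x-\sigma\,\vec n(x):\ x\in\Gamma,\ \sigma\in[0,\varepsilon)\}.$$ Let $a\in C^1(\overline\Omega)$ satisfy $0<a_0\le a(x)\le a_1$ on $\overline\Omega$ for some constants $a_0,a_1$, and let $f,g:\mathbb{R}\to\mathbb{R}$ be $C^2$ functions such that, for $j=f$ and $j=g$, $$\limsup_{|s|\to\infty}\frac{j(s)}{s}\le 0\qquad\text{and}\qquad |j(s)|+|j'(s)|+|j''(s)|\le K\quad\text{for all } s\in\mathbb{R},$$ for some constant $K>0$. Write $\gamma:H^1(\Omega)\to L^2(\Gamma)$ for the trace operator and $\langle\Lambda u,\varphi\rangle=\int_\Omega a\,\nabla u\cdot\nabla\varphi\,dx+\int_\Omega u\varphi\,dx$ for $u,\varphi\in H^1(\Omega)$. Consider * the limit problem $-\mathrm{div}(a\nabla u)+u=f(u)$ in $\Omega$, $a\,\partial u/\partial\vec n=g(u)$ on $\Gamma$, whose solutions are the $u\in H^1(\Omega)$ with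 $$\langle\Lambda u,\varphi\rangle=\int_\Omega f(u)\varphi\,dx+\int_\Gamma g(\gamma u)\,\gamma\varphi\,dS\qquad\text{for all }\varphi\in H^1(\Omega);$$ * for $\varepsilon>0$, the concentrated problem $-\mathrm{div}(a\nabla u)+u=f(u)+\frac1\varepsilon\chi_{\omega_\varepsilon}g(u)$ in $\Omega$, $a\,\partial u/\partial\vec n=0$ on $\Gamma$, whose solutions are the $u\in H^1(\Omega)$ with $$\langle\Lambda u,\varphi\rangle=\int_\Omega f(u)\varphi\,dx+\frac1\varepsilon\int_{\Omega\cap\omega_\varepsilon} g(u)\varphi\,dx\qquad\text{for all }\varphi\in H^1(\Omega).$$ For a solution $u$ of the limit problem let $D\tilde F_0(u)$ be given by $\langle D\tilde F_0(u)w,\varphi\rangle=\int_\Omega f'(u)w\varphi\,dx+\int_\Gamma g'(\gamma u)\,\gamma w\,\gamma\varphi\,dS$. Suppose that every solution $u$ of the limit problem satisfies $0\notin\sigma(\Lambda-D\tilde F_0(u))$, that is, $\Lambda-D\tilde F_0(u)$ is a bijection of $H^1(\Omega)$ onto its dual space $H^1(\Omega)'$ with bounded inverse. Then the limit problem has a finite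 number $k$ of solutions $u_{0,1},\dots,u_{0,k}$ (pairwise distinct), and there is $\varepsilon_0>0$ such that for every $\varepsilon\in(0,\varepsilon_0]$ the concentrated problem has exactly $k$ solutions $u_{\varepsilon,1},\dots,u_{\varepsilon,k}$ (pairwise distinct), which can be numbered so that, for every $i=1,\dots,k$, $$u_{\varepsilon,i}\to u_{0,i}\quad\text{in } H^1(\Omega)\quad\text{as }\varepsilon\to0^+ .$$ -/

import Mathlib

open MeasureTheory Filter Topology Set
open scoped ContDiff Gradient

noncomputable section

namespace ConcentratedEquilibria

/-- Euclidean three-space. -/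
abbrev E3 : Type := EuclideanSpace ℝ (Fin 3)

/-! ### The domain, its boundary and the strip -/

/-- Near `x`, the set `Ω` is the sublevel set `{ρ < 0}` of the smooth function `ρ`, which has no
critical point at `x`. -/
structure IsLocalDefiningFunction (Ω : Set E3) (x : E3) (ρ : E3 → ℝ) : Prop where
  smooth : ContDiff ℝ ∞ ρ
  gradient_ne_zero : ∇ ρ x ≠ 0
  mem_iff : ∀ᶠ y in 𝓝 x, (y ∈ Ω ↔ ρ y < 0)

/-- `Ω` is open, bounded, with smooth boundary (and lies locally on one side of it). -/
structure IsSmoothBoundedOpen (Ω : Set E3) : Prop where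
  isOpen : IsOpen Ω
  isBounded : Bornology.IsBounded Ω
  smooth_boundary : ∀ x ∈ frontier Ω, ∃ ρ, IsLocalDefiningFunction Ω x ρ

/-- `n` is the outward unit normal vector of `Ω` at the boundary point `x`. -/
def IsOutwardNormal (Ω : Set E3) (x n : E3) : Prop :=
  ∃ ρ, IsLocalDefiningFunction Ω x ρ ∧ n = ‖∇ ρ x‖⁻¹ • ∇ ρ x

/-- The strip `ω_ε = {x - σ n(x) : x ∈ ∂Ω, σ ∈ [0, ε)}`. -/
def strip (Ω : Set E3) (ε : ℝ) : Set E3 :=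
  {y | ∃ x ∈ frontier Ω, ∃ n, IsOutwardNormal Ω x n ∧ ∃ σ ∈ Ico (0 : ℝ) ε, y = x - σ • n}

/-- The surface measure `dS` on `Γ = ∂Ω`: the two-dimensional Hausdorff measure, normalised to
agree with Lebesgue measure on planes. -/
def surfaceMeasure (Ω : Set E3) : Measure E3 :=
  (Measure.euclideanHausdorffMeasure 2).restrict (frontier Ω)

/-! ### The space `H¹(Ω)` and the trace -/

/-- The vector field `p` is the weak gradient of `u` in `Ω`. -/
def IsWeakGradient (Ω : Set E3) (u : E3 → ℝ) (p : E3 → E3) : Prop :=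
  ∀ φ : E3 → ℝ, ContDiff ℝ ∞ φ → HasCompactSupport φ → tsupport φ ⊆ Ω →
    ∫ x in Ω, u x • ∇ φ x = -∫ x in Ω, φ x • p x

theorem integrable_smul_of_compact {F : Type*} [NormedAddCommGroup F] [NormedSpace ℝ F]
    {Ω : Set E3} {v : E3 → F} (hv : MemLp v 2 (volume.restrict Ω)) {ψ : E3 → ℝ}
    (hψ : Continuous ψ) (hc : HasCompactSupport ψ) :
    Integrable (fun x => ψ x • v x) (volume.restrict Ω) := by
  have h : MemLp ψ 2 (volume.restrict Ω) := hψ.memLp_of_hasCompactSupport hc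
  exact memLp_one_iff_integrable.1 (hv.smul h)

theorem integrable_smul_of_compact' {F : Type*} [NormedAddCommGroup F] [NormedSpace ℝ F]
    {Ω : Set E3} {v : E3 → ℝ} (hv : MemLp v 2 (volume.restrict Ω)) {ψ : E3 → F}
    (hψ : Continuous ψ) (hc : HasCompactSupport ψ) :
    Integrable (fun x => v x • ψ x) (volume.restrict Ω) := by
  have h : MemLp ψ 2 (volume.restrict Ω) := hψ.memLp_of_hasCompactSupport hc
  exact memLp_one_iff_integrable.1 (h.smul hv)

theorem continuous_gradient {φ : E3 → ℝ} (hφ : ContDiff ℝ ∞ φ) : Continuous (∇ φ) :=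
  (InnerProductSpace.toDual ℝ E3).symm.continuous.comp (hφ.continuous_fderiv (by simp))

theorem hasCompactSupport_gradient {φ : E3 → ℝ} (hc : HasCompactSupport φ) :
    HasCompactSupport (∇ φ) :=
  (hc.fderiv (𝕜 := ℝ)).comp_left (g := (InnerProductSpace.toDual ℝ E3).symm) (map_zero _)

/-- The Sobolev space `H¹(Ω)`, as the space of pairs `(u, ∇u)` of a function `u ∈ L²(Ω)` and its
weak gradient `∇u ∈ L²(Ω)³`; the norm is `(‖u‖² + ‖∇u‖²)^{1/2}`. -/
def H1 (Ω : Set E3) :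
    Submodule ℝ (WithLp 2 (Lp ℝ 2 (volume.restrict Ω) × Lp E3 2 (volume.restrict Ω))) where
  carrier := {p | IsWeakGradient Ω p.fst p.snd}
  zero_mem' := by
    intro φ _ _ _
    have h1 : ∫ x in Ω, (0 : Lp ℝ 2 (volume.restrict Ω)) x • ∇ φ x = 0 := by
      apply integral_eq_zero_of_ae
      filter_upwards [Lp.coeFn_zero ℝ 2 (volume.restrict Ω)] with x hx
      rw [hx]
      simp
    have h2 : ∫ x in Ω, φ x • (0 : Lp E3 2 (volume.restrict Ω)) x = 0 := by
      apply integral_eq_zero_of_ae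
      filter_upwards [Lp.coeFn_zero E3 2 (volume.restrict Ω)] with x hx
      rw [hx]
      simp
    rw [WithLp.zero_fst, WithLp.zero_snd, h1, h2, neg_zero]
  add_mem' := by
    intro p q hp hq φ h1 h2 h3
    have e1 : ∫ x in Ω, (p.fst + q.fst) x • ∇ φ x
        = ∫ x in Ω, (p.fst x • ∇ φ x + q.fst x • ∇ φ x) := by
      apply integral_congr_ae
      filter_upwards [Lp.coeFn_add p.fst q.fst] with x hx
      rw [hx, Pi.add_apply, add_smul]
    have e2 : ∫ x in Ω, φ x • (p.snd + q.snd) x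
        = ∫ x in Ω, (φ x • p.snd x + φ x • q.snd x) := by
      apply integral_congr_ae
      filter_upwards [Lp.coeFn_add p.snd q.snd] with x hx
      rw [hx, Pi.add_apply, smul_add]
    have g1 := continuous_gradient h1
    have g2 := hasCompactSupport_gradient h2
    rw [WithLp.add_fst, WithLp.add_snd, e1, e2,
      integral_add (integrable_smul_of_compact' (Lp.memLp _) g1 g2)
        (integrable_smul_of_compact' (Lp.memLp _) g1 g2),
      integral_add (integrable_smul_of_compact (Lp.memLp _) h1.continuous h2)
        (integrable_smul_of_compact (Lp.memLp _) h1.continuous h2),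
      hp φ h1 h2 h3, hq φ h1 h2 h3, neg_add]
  smul_mem' := by
    intro c p hp φ h1 h2 h3
    have e1 : ∫ x in Ω, (c • p.fst) x • ∇ φ x = ∫ x in Ω, c • (p.fst x • ∇ φ x) := by
      apply integral_congr_ae
      filter_upwards [Lp.coeFn_smul c p.fst] with x hx
      rw [hx, Pi.smul_apply, smul_assoc]
    have e2 : ∫ x in Ω, φ x • (c • p.snd) x = ∫ x in Ω, c • (φ x • p.snd x) := by
      apply integral_congr_ae
      filter_upwards [Lp.coeFn_smul c p.snd] with x hx
      rw [hx, Pi.smul_apply, smul_comm c]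
    rw [WithLp.smul_fst, WithLp.smul_snd, e1, e2, integral_smul, integral_smul,
      hp φ h1 h2 h3, smul_neg]

variable {Ω : Set E3}

/-- The function underlying `u ∈ H¹(Ω)` (meaningful almost everywhere in `Ω`). -/
def fn (u : H1 Ω) : E3 → ℝ := u.1.fst

/-- The weak gradient of `u ∈ H¹(Ω)` (meaningful almost everywhere in `Ω`). -/
def grad (u : H1 Ω) : E3 → E3 := u.1.snd

/-- `T` is a bounded linear operator `H¹(Ω) → L²(Γ)` that sends the restriction to `Ω` of every
smooth function on `ℝ³` to its restriction to `Γ`. -/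
def IsTraceOperator (Ω : Set E3) (T : H1 Ω →L[ℝ] Lp ℝ 2 (surfaceMeasure Ω)) : Prop :=
  ∀ (u : H1 Ω) (φ : E3 → ℝ), ContDiff ℝ ∞ φ → fn u =ᵐ[volume.restrict Ω] φ →
    T u =ᵐ[surfaceMeasure Ω] φ

/-- The trace operator `γ : H¹(Ω) → L²(Γ)`. For a smooth bounded open set it is the one and only
operator with `IsTraceOperator`. -/
def trace (Ω : Set E3) : H1 Ω →L[ℝ] Lp ℝ 2 (surfaceMeasure Ω) :=
  Classical.epsilon (IsTraceOperator Ω)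

/-- The trace of `u ∈ H¹(Ω)` (meaningful almost everywhere on `Γ`). -/
def tr (u : H1 Ω) : E3 → ℝ := trace Ω u

/-! ### The elliptic problems -/

/-- `⟨Λ u, φ⟩ = ∫_Ω a ∇u · ∇φ + ∫_Ω u φ`, where `Λ u = - div (a ∇u) + u`. -/
def pairΛ (a : E3 → ℝ) (u φ : H1 Ω) : ℝ :=
  (∫ x in Ω, a x * inner ℝ (grad u x) (grad φ x)) + ∫ x in Ω, fn u x * fn φ x

/-- `⟨F₀(u), φ⟩ = ∫_Ω f(u) φ + ∫_Γ g(γ u) γ φ dS`. -/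
def pairF₀ (f g : ℝ → ℝ) (u φ : H1 Ω) : ℝ :=
  (∫ x in Ω, f (fn u x) * fn φ x) + ∫ x, g (tr u x) * tr φ x ∂(surfaceMeasure Ω)

/-- `⟨F_ε(u), φ⟩ = ∫_Ω f(u) φ + (1/ε) ∫_{ω_ε} g(u) φ`. The part of `ω_ε` that lies in `Ω` is
taken, since `u` and `φ` live there; for small `ε` the rest of `ω_ε` is the null set `Γ`. -/
def pairF (f g : ℝ → ℝ) (ε : ℝ) (u φ : H1 Ω) : ℝ :=
  (∫ x in Ω, f (fn u x) * fn φ x) + ε⁻¹ * ∫ x in Ω ∩ strip Ω ε, g (fn u x) * fn φ x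

/-- `⟨DF₀(u) w, φ⟩ = ∫_Ω f'(u) w φ + ∫_Γ g'(γ u) γ w γ φ dS`. -/
def pairDF₀ (f g : ℝ → ℝ) (u w φ : H1 Ω) : ℝ :=
  (∫ x in Ω, deriv f (fn u x) * fn w x * fn φ x) +
    ∫ x, deriv g (tr u x) * tr w x * tr φ x ∂(surfaceMeasure Ω)

/-- The set of (weak) solutions `u ∈ H¹(Ω)` of the limit problem
`- div (a ∇u) + u = f(u)` in `Ω`, `a ∂u/∂n = g(u)` on `Γ`, that is, of `Λ u - F₀(u) = 0`. -/
def limitSolutions (Ω : Set E3) (a : E3 → ℝ) (f g : ℝ → ℝ) : Set (H1 Ω) :=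
  {u | ∀ φ : H1 Ω, pairΛ a u φ - pairF₀ f g u φ = 0}

/-- The set of (weak) solutions `u ∈ H¹(Ω)` of the concentrated problem
`- div (a ∇u) + u = f(u) + (1/ε) χ_{ω_ε} g(u)` in `Ω`, `a ∂u/∂n = 0` on `Γ`, that is, of
`Λ u - F_ε(u) = 0`. -/
def concentratedSolutions (Ω : Set E3) (a : E3 → ℝ) (f g : ℝ → ℝ) (ε : ℝ) : Set (H1 Ω) :=
  {u | ∀ φ : H1 Ω, pairΛ a u φ - pairF f g ε u φ = 0}

/-- The resolvent set of `Λ - DF₀(u)`, regarded as an unbounded operator in the dual space of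
`H¹(Ω)` with domain `H¹(Ω)`: the numbers `μ` for which `Λ - DF₀(u) - μ` is a bijection of
`H¹(Ω)` onto its dual space, with a bounded inverse `R`. -/
def linearizationResolventSet (a : E3 → ℝ) (f g : ℝ → ℝ) (u : H1 Ω) : Set ℝ :=
  {μ | ∃ R : StrongDual ℝ (H1 Ω) →L[ℝ] H1 Ω, ∀ (ℓ : StrongDual ℝ (H1 Ω)) (w : H1 Ω),
    (∀ φ : H1 Ω,
      pairΛ a w φ - pairDF₀ f g u w φ - μ * ∫ x in Ω, fn w x * fn φ x = ℓ φ) ↔ w = R ℓ}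

/-- The spectrum `σ(Λ - DF₀(u))`. -/
def linearizationSpectrum (a : E3 → ℝ) (f g : ℝ → ℝ) (u : H1 Ω) : Set ℝ :=
  (linearizationResolventSet a f g u)ᶜ

/-! ### The standing assumptions on the data -/

/-- `a` is of class `C¹` on the closure of `Ω`, bounded above and below by positive constants. -/
structure IsAdmissibleCoefficient (Ω : Set E3) (a : E3 → ℝ) : Prop where
  contDiffOn : ContDiffOn ℝ 1 a (closure Ω)
  bounds : ∃ a₀ a₁ : ℝ, 0 < a₀ ∧ 0 < a₁ ∧ ∀ x ∈ closure Ω, a₀ ≤ a x ∧ a x ≤ a₁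

/-- `j` is of class `C²`, bounded with bounded derivatives up to order two, and dissipative:
`limsup_{|s| → ∞} j(s)/s ≤ 0` (the upper limit is taken in the extended reals). -/
structure IsAdmissibleNonlinearity (j : ℝ → ℝ) : Prop where
  contDiff : ContDiff ℝ 2 j
  dissipative : limsup (fun s : ℝ => ((j s / s : ℝ) : EReal)) (cocompact ℝ) ≤ 0
  bounded : ∃ K : ℝ, 0 < K ∧ ∀ s, |j s| + |deriv j s| + |deriv (deriv j) s| ≤ K

end ConcentratedEquilibria

end

/-!
# Equilibria of elliptic problems with reaction terms concentrating on the boundary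

Both problems are equations `A u = N u` in the Hilbert space `H¹(Ω)`, where `A` is the coercive
operator of the elliptic form and `N` is a sum of reaction terms `T† (g ∘ T u)`. For the reaction
`f` in the interior, `T` is the embedding `toL2` into `L²(Ω)`. For the reaction `g`, it is the trace
`H¹(Ω) → L²(∂Ω)` in the limit problem, and in the concentrated problem the restriction `stripTrace`
to the strip with the measure `ε⁻¹ χ_{ω_ε} dx`. So the limit `ε → 0` is a perturbation of the
operator `T` with values in a varying `L²`-space, and it is enough to know that these operators
converge to the trace in the sense of `IsTraceFamily`: they are uniformly bounded and compact, the
measures converge weakly, and smooth functions are mapped to their restrictions.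

*Geometry.* Inside `Ω` the strip is the set of points at distance less than `ε` from `∂Ω`
(`IsSmoothBoundedOpen.inter_strip`), and near a boundary point `Ω` is the part above a graph of
arbitrarily small slope (`IsGraphChart`). A small slope makes both the area of the graph and the
thickness of the strip comparable to the flat case up to a factor close to one, which yields the
weak convergence of the strip measures to the surface measure
(`IsSmoothBoundedOpen.tendsto_integral_strip`) without computing any Jacobian.

*Uniform bounds.* Integration along lines transversal to the boundary gives the collar estimate
`‖stripTrace Ω ε u‖² ≤ C ‖u‖_{L²} ‖u‖_{H¹}` with `C` independent of `ε`
(`IsSmoothBoundedOpen.exists_stripTrace_bound`). It holds for smooth functions, which are dense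
(`IsSmoothBoundedOpen.dense_smoothSubspace`), and as `ε → 0` it becomes the trace estimate, whence
the trace operator exists (`IsSmoothBoundedOpen.exists_isTraceOperator`). With Rellich's theorem
(`IsSmoothBoundedOpen.tendsto_toL2`) the factor `‖u‖_{L²}` makes the restrictions and the trace
compact, uniformly in `ε` (`IsSmoothBoundedOpen.isTraceFamily_stripTrace`).

*Reaction terms.* Consequently the maps `N` of the concentrated problems converge in norm along
weakly convergent sequences, and they are close to the linearization of the limit map near a given
`u₀`, uniformly in `ε` (`IsTraceFamily.isCompactFamily`). The second point is delicate, since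
superposition operators are not differentiable in `L²`. It holds here because the directions of
differentiation lie in a set that the operators `T` map to almost compact sets, whose elements are
bounded functions up to a small error (`IsRegular.norm_remainder_le`,
`IsTraceFamily.tendsto_remainder`).

*Counting solutions.* If `A - D N₀(u₀)` is invertible, the simplified Newton map is a contraction
near `u₀`, for the limit problem as well as for small `ε`. It provides exactly one solution in a
fixed ball about `u₀`, and this solution tends to `u₀`
(`IsCompactFamily.eventually_existsUnique`). Sequences of solutions are bounded, and by compactness
they subconverge to solutions of the limit problem (`IsCompactFamily.exists_subseq_tendsto`). Hence
the nondegenerate solutions of the limit problem are finite in number, and for small `ε` there are no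
solutions outside the balls about them (`IsCompactFamily.exists_solutions`).
-/

noncomputable section

open MeasureTheory Filter Topology Set
open scoped ContDiff Gradient

namespace ConcentratedEquilibria

/-! ### Flat charts at boundary points -/

/-- Near the boundary point `x₀` the set `Ω` is `{τ > 0}`, where `τ` is the height `y ↦ ⟪e, y⟫`
over the tangent plane up to an error of Lipschitz constant `η`; `e` is the inner unit normal. -/
structure IsFlatChart (Ω : Set E3) (η : ℝ) (x₀ e : E3) (R : ℝ) (τ : E3 → ℝ) : Prop where
  pos : 0 < R
  norm_e : ‖e‖ = 1
  mem_iff : ∀ y ∈ Metric.ball x₀ R, (y ∈ Ω ↔ 0 < τ y)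
  approx : ∀ y ∈ Metric.ball x₀ R, ∀ z ∈ Metric.ball x₀ R,
    |τ y - τ z - inner ℝ e (y - z)| ≤ η * ‖y - z‖
  zero : τ x₀ = 0

theorem inner_gradient {ρ : E3 → ℝ} {x v : E3} : inner ℝ (∇ ρ x) v = fderiv ℝ ρ x v := by
  simp [gradient]

/-- A local defining function vanishes at the boundary point, by continuity. -/
theorem IsLocalDefiningFunction.eq_zero {Ω : Set E3} (ho : IsOpen Ω) {x : E3}
    (hx : x ∈ frontier Ω) {ρ : E3 → ℝ} (h : IsLocalDefiningFunction Ω x ρ) : ρ x = 0 := by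
  have h1 : x ∉ Ω := by
    rw [ho.frontier_eq] at hx
    exact hx.2
  have h2 := h.mem_iff.self_of_nhds
  have h3 : 0 ≤ ρ x := not_lt.1 fun h' => h1 (h2.2 h')
  refine le_antisymm ?_ h3
  by_contra! hpos
  have h4 : ∀ᶠ y in 𝓝 x, 0 < ρ y := h.smooth.continuous.continuousAt.eventually (lt_mem_nhds hpos)
  have h5 : ∃ᶠ y in 𝓝 x, y ∈ Ω := mem_closure_iff_frequently.1 hx.1
  obtain ⟨y, hy, hy1, hy2⟩ := (h5.and_eventually (h4.and h.mem_iff)).exists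
  linarith [hy2.1 hy]

/-- Boundary points have flat charts with arbitrarily small error `η`: a defining function divided
by minus the norm of its gradient is strictly differentiable at the point. -/
theorem IsSmoothBoundedOpen.exists_flatChart {Ω : Set E3} (hΩ : IsSmoothBoundedOpen Ω) {x : E3}
    (hx : x ∈ frontier Ω) {η : ℝ} (hη : 0 < η) :
    ∃ (e : E3) (R : ℝ) (τ : E3 → ℝ), IsFlatChart Ω η x e R τ := by
  obtain ⟨ρ, hρ⟩ := hΩ.smooth_boundary x hx
  have hG : 0 < ‖∇ ρ x‖ := norm_pos_iff.2 hρ.gradient_ne_zero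
  have hs : HasStrictFDerivAt ρ (fderiv ℝ ρ x) x :=
    hρ.smooth.contDiffAt.hasStrictFDerivAt (by simp)
  have h1 := hs.isLittleO.def (mul_pos hη hG)
  have h2 : ∀ᶠ p : E3 × E3 in 𝓝 x ×ˢ 𝓝 x,
      ‖ρ p.1 - ρ p.2 - fderiv ℝ ρ x (p.1 - p.2)‖ ≤ η * ‖∇ ρ x‖ * ‖p.1 - p.2‖ := by
    rwa [← nhds_prod_eq]
  obtain ⟨s, hs1, hs2⟩ := eventually_prod_self_iff
    (r := fun y z => ‖ρ y - ρ z - fderiv ℝ ρ x (y - z)‖ ≤ η * ‖∇ ρ x‖ * ‖y - z‖).1 h2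
  obtain ⟨R, hR, hR2⟩ := Metric.mem_nhds_iff.1 (inter_mem hs1 hρ.mem_iff)
  refine ⟨-(‖∇ ρ x‖⁻¹ • ∇ ρ x), R, fun y => -(‖∇ ρ x‖⁻¹ * ρ y), hR, ?_, ?_, ?_, ?_⟩
  · rw [norm_neg, norm_smul, norm_inv, norm_norm, inv_mul_cancel₀ hG.ne']
  · intro y hy
    have hmem : y ∈ Ω ↔ ρ y < 0 := (hR2 hy).2
    rw [hmem, neg_pos, mul_neg_iff]
    constructor
    · intro h
      exact Or.inl ⟨by positivity, h⟩
    · rintro (h | h)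
      · exact h.2
      · exact absurd h.1 (not_lt.2 (by positivity))
  · intro y hy z hz
    have h3 := hs2 y (hR2 hy).1 z (hR2 hz).1
    simp only [Real.norm_eq_abs] at h3
    rw [inner_neg_left, inner_smul_left, inner_gradient]
    simp only [map_inv₀, conj_trivial]
    have : -(‖∇ ρ x‖⁻¹ * ρ y) - -(‖∇ ρ x‖⁻¹ * ρ z) - -(‖∇ ρ x‖⁻¹ * fderiv ℝ ρ x (y - z)) =
      -(‖∇ ρ x‖⁻¹ * (ρ y - ρ z - fderiv ℝ ρ x (y - z))) := by ring
    rw [this, abs_neg, abs_mul, abs_of_pos (inv_pos.2 hG), inv_mul_le_iff₀ hG]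
    linarith
  · simp [hρ.eq_zero hΩ.isOpen hx]

namespace IsFlatChart

variable {Ω : Set E3} {η R : ℝ} {x₀ e : E3} {τ : E3 → ℝ}

theorem le_sub (h : IsFlatChart Ω η x₀ e R τ) {y z : E3} (hy : y ∈ Metric.ball x₀ R)
    (hz : z ∈ Metric.ball x₀ R) : inner ℝ e (y - z) - η * ‖y - z‖ ≤ τ y - τ z := by
  linarith [(abs_le.1 (h.approx y hy z hz)).1]

theorem sub_le (h : IsFlatChart Ω η x₀ e R τ) {y z : E3} (hy : y ∈ Metric.ball x₀ R)
    (hz : z ∈ Metric.ball x₀ R) : τ y - τ z ≤ inner ℝ e (y - z) + η * ‖y - z‖ := by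
  linarith [(abs_le.1 (h.approx y hy z hz)).2]

theorem sub_le_norm (h : IsFlatChart Ω η x₀ e R τ) {y z : E3} (hy : y ∈ Metric.ball x₀ R)
    (hz : z ∈ Metric.ball x₀ R) : τ y - τ z ≤ (1 + η) * ‖y - z‖ := by
  have := h.sub_le hy hz
  have h2 := real_inner_le_norm e (y - z)
  rw [h.norm_e] at h2
  linarith

theorem continuousOn (h : IsFlatChart Ω η x₀ e R τ) : ContinuousOn τ (Metric.ball x₀ R) := by
  have : LipschitzOnWith (Real.toNNReal (1 + η)) τ (Metric.ball x₀ R) := by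
    apply LipschitzOnWith.of_dist_le_mul
    intro y hy z hz
    rw [Real.dist_eq, dist_eq_norm, abs_le]
    have h1 := h.sub_le_norm hy hz
    have h2 := h.sub_le_norm hz hy
    rw [norm_sub_rev z y] at h2
    have h3 : (1 + η) * ‖y - z‖ ≤ (Real.toNNReal (1 + η)) * ‖y - z‖ :=
      mul_le_mul_of_nonneg_right (Real.le_coe_toNNReal _) (norm_nonneg _)
    constructor <;> linarith
  exact this.continuousOn

/-- Along `e` the height function has slope at least `1 - η`. -/
theorem slope_le (h : IsFlatChart Ω η x₀ e R τ) {y : E3} {t : ℝ} (ht : 0 ≤ t)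
    (hy : y ∈ Metric.ball x₀ R) (hz : y + t • e ∈ Metric.ball x₀ R) :
    τ y + (1 - η) * t ≤ τ (y + t • e) := by
  have := h.le_sub hz hy
  rw [add_sub_cancel_left, inner_smul_right, real_inner_self_eq_norm_sq, norm_smul, h.norm_e,
    Real.norm_eq_abs, abs_of_nonneg ht] at this
  linarith

theorem mem_frontier_iff (h : IsFlatChart Ω η x₀ e R τ) (hη : η < 1) (ho : IsOpen Ω) {y : E3}
    (hy : y ∈ Metric.ball x₀ R) : y ∈ frontier Ω ↔ τ y = 0 := by
  have hb := Metric.isOpen_ball.mem_nhds hy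
  have hc := h.continuousOn.continuousAt hb
  rw [ho.frontier_eq]
  constructor
  · rintro ⟨h1, h2⟩
    rw [h.mem_iff y hy, not_lt] at h2
    refine le_antisymm h2 ?_
    by_contra! hneg
    obtain ⟨z, hz, hz1, hz2⟩ := ((mem_closure_iff_frequently.1 h1).and_eventually
      ((hc.eventually (gt_mem_nhds hneg)).and hb)).exists
    linarith [(h.mem_iff z hz2).1 hz]
  · intro h0
    refine ⟨?_, fun h1 => by linarith [(h.mem_iff y hy).1 h1]⟩
    have hlim : Tendsto (fun t : ℝ => y + t • e) (𝓝[>] 0) (𝓝 y) := by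
      have : Continuous (fun t : ℝ => y + t • e) := by fun_prop
      have h2 := this.tendsto 0
      simp only [zero_smul, add_zero] at h2
      exact h2.mono_left nhdsWithin_le_nhds
    refine mem_closure_of_tendsto hlim ?_
    filter_upwards [hlim hb, self_mem_nhdsWithin] with t ht ht0
    have := h.slope_le (le_of_lt ht0) hy ht
    rw [h.mem_iff _ ht]
    have : 0 < (1 - η) * t := mul_pos (by linarith) ht0
    linarith

end IsFlatChart

/-! ### The strip is a one-sided metric neighbourhood of the boundary -/

theorem IsSmoothBoundedOpen.isCompact_frontier {Ω : Set E3} (hΩ : IsSmoothBoundedOpen Ω) :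
    IsCompact (frontier Ω) :=
  Metric.isCompact_of_isClosed_isBounded isClosed_frontier
    (hΩ.isBounded.closure.subset frontier_subset_closure)

/-- If `Ω` contains a ball that touches `∂Ω` at `x`, then the outward normal at `x` points away
from the centre of the ball. -/
theorem IsLocalDefiningFunction.normal_eq_of_ball {Ω : Set E3} (ho : IsOpen Ω) {x y : E3}
    (hx : x ∈ frontier Ω) {ρ : E3 → ℝ} (h : IsLocalDefiningFunction Ω x ρ) (hxy : x ≠ y)
    (hb : Metric.ball y (dist y x) ⊆ Ω) :
    ‖∇ ρ x‖⁻¹ • ∇ ρ x = ‖x - y‖⁻¹ • (x - y) := by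
  have h0 := h.eq_zero ho hx
  have hG : 0 < ‖∇ ρ x‖ := norm_pos_iff.2 h.gradient_ne_zero
  have hd : 0 < ‖x - y‖ := norm_pos_iff.2 (sub_ne_zero.2 hxy)
  have hdiff : DifferentiableAt ℝ ρ x := h.smooth.differentiable (by simp) x
  -- directions that point into the ball lead into `Ω`, where `ρ` is negative
  have key : ∀ v : E3, inner ℝ v (x - y) < 0 → inner ℝ (∇ ρ x) v ≤ 0 := by
    intro v hv
    rw [inner_gradient]
    have hder : HasDerivAt (fun t : ℝ => ρ (x + t • v)) (fderiv ℝ ρ x v) 0 := by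
      have h1 : HasDerivAt (fun t : ℝ => x + t • v) v 0 := by
        simpa using ((hasDerivAt_id (0 : ℝ)).smul_const v).const_add x
      have h2 : HasFDerivAt ρ (fderiv ℝ ρ x) (x + (0 : ℝ) • v) := by
        simpa using hdiff.hasFDerivAt
      exact h2.comp_hasDerivAt 0 h1
    have hlim := (hasDerivWithinAt_iff_tendsto_slope.1
      (hder.hasDerivWithinAt (s := Ioi (0 : ℝ))))
    rw [sdiff_singleton_eq_self (by simp)] at hlim
    refine le_of_tendsto hlim ?_
    have hpos : 0 < ‖v‖ ^ 2 := by
      have : v ≠ 0 := by rintro rfl; simp at hv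
      positivity
    have hmem : Ioo (0 : ℝ) (-(2 * inner ℝ v (x - y)) / ‖v‖ ^ 2) ∈ 𝓝[>] (0 : ℝ) :=
      Ioo_mem_nhdsGT (div_pos (by linarith) hpos)
    have hcont : Tendsto (fun t : ℝ => x + t • v) (𝓝[>] 0) (𝓝 x) := by
      have : Continuous (fun t : ℝ => x + t • v) := by fun_prop
      have h2 := this.tendsto 0
      simp only [zero_smul, add_zero] at h2
      exact h2.mono_left nhdsWithin_le_nhds
    filter_upwards [hmem, hcont.eventually h.mem_iff] with t ht hmt
    have hin : x + t • v ∈ Ω := by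
      apply hb
      rw [Metric.mem_ball, dist_comm y x, dist_eq_norm, dist_eq_norm]
      apply lt_of_pow_lt_pow_left₀ 2 hd.le
      have e1 : x + t • v - y = (x - y) + t • v := by abel
      rw [e1, norm_add_sq_real, inner_smul_right, norm_smul, Real.norm_eq_abs,
        abs_of_pos ht.1, real_inner_comm v (x - y)]
      have h3 := (lt_div_iff₀ hpos).1 ht.2
      nlinarith [ht.1]
    have := hmt.1 hin
    rw [slope_def_field]
    simp only [zero_smul, add_zero, sub_zero, h0]
    exact (div_neg_of_neg_of_pos this ht.1).le
  set w := ‖x - y‖⁻¹ • (x - y) with hw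
  set n := ‖∇ ρ x‖⁻¹ • ∇ ρ x with hn
  have hw1 : ‖w‖ = 1 := by
    rw [hw, norm_smul, norm_inv, norm_norm, inv_mul_cancel₀ hd.ne']
  have hn1 : ‖n‖ = 1 := by
    rw [hn, norm_smul, norm_inv, norm_norm, inv_mul_cancel₀ hG.ne']
  have key2 : ∀ v : E3, inner ℝ v w < 0 → inner ℝ n v ≤ 0 := by
    intro v hv
    have h1 : inner ℝ v (x - y) < 0 := by
      rw [hw, inner_smul_right] at hv
      by_contra! hc
      have : 0 ≤ ‖x - y‖⁻¹ * inner ℝ v (x - y) := by positivity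
      linarith
    have := key v h1
    rw [hn, inner_smul_left]
    simp only [map_inv₀, conj_trivial]
    exact mul_nonpos_of_nonneg_of_nonpos (by positivity) this
  clear_value w n
  have hc1 : inner ℝ n w ≤ 1 := by
    have := real_inner_le_norm n w
    rwa [hw1, hn1, one_mul] at this
  -- testing with `v = n - (⟪n, w⟫ + δ) w` and letting `δ → 0` forces `⟪n, w⟫ = 1`
  have key3 : ∀ δ : ℝ, 0 < δ → 1 - inner ℝ n w * (inner ℝ n w + δ) ≤ 0 := by
    intro δ hδ
    have := key2 (n - (inner ℝ n w + δ) • w) (by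
      rw [inner_sub_left, real_inner_smul_left _ w, real_inner_self_eq_norm_sq w, hw1]
      linarith)
    rw [inner_sub_right, inner_smul_right n w, real_inner_self_eq_norm_sq n, hn1] at this
    linarith
  have hc2 : inner ℝ n w = 1 := by
    set c : ℝ := inner ℝ n w with hc
    have hcm : -1 ≤ c := by
      have := abs_real_inner_le_norm n w
      rw [hw1, hn1, one_mul] at this
      exact (abs_le.1 this).1
    by_contra hne
    have hlt : c < 1 := lt_of_le_of_ne hc1 hne
    have hcpos : 0 ≤ c := by
      by_contra! hneg
      nlinarith [key3 1 one_pos]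
    nlinarith [key3 ((1 - c) / 2) (by linarith)]
  exact (inner_eq_one_iff_of_norm_eq_one hn1 hw1).1 hc2

/-- A ball that is centred in `Ω` and does not meet `∂Ω` lies in `Ω`, since it is connected. -/
theorem ball_subset_of_forall_frontier {Ω : Set E3} (ho : IsOpen Ω) {y : E3} (hy : y ∈ Ω) {r : ℝ}
    (h : ∀ p ∈ frontier Ω, r ≤ dist p y) : Metric.ball y r ⊆ Ω := by
  rcases le_or_gt r 0 with hr | hr
  · simp [Metric.ball_eq_empty.2 hr]
  have hpre : IsPreconnected (Metric.ball y r) := (convex_ball y _).isPreconnected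
  refine hpre.subset_left_of_subset_union ho isClosed_closure.isOpen_compl
    (disjoint_compl_right_iff_subset.2 subset_closure) (fun p hp => ?_)
    ⟨y, Metric.mem_ball_self hr, hy⟩
  by_contra hcon
  rw [mem_union, mem_compl_iff, not_or, not_not] at hcon
  have hp2 : p ∈ frontier Ω := by
    rw [ho.frontier_eq]
    exact ⟨hcon.2, hcon.1⟩
  exact absurd (Metric.mem_ball.1 hp) (not_lt.2 (h p hp2))

/-- Inside `Ω`, the strip consists of the points at distance less than `ε` from `∂Ω`: if `x` is a
boundary point nearest to `y ∈ Ω`, the ball about `y` through `x` touches `∂Ω` at `x`, so that `y`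
lies on the inner normal at `x`. No tubular neighbourhood theorem is needed, and `ε` is arbitrary.
-/
theorem IsSmoothBoundedOpen.inter_strip {Ω : Set E3} (hΩ : IsSmoothBoundedOpen Ω) (ε : ℝ) :
    Ω ∩ strip Ω ε = Ω ∩ Metric.thickening ε (frontier Ω) := by
  ext y
  simp only [mem_inter_iff, and_congr_right_iff]
  intro hy
  rw [Metric.mem_thickening_iff]
  constructor
  · rintro ⟨x, hx, n, ⟨ρ, hρ, rfl⟩, σ, hσ, rfl⟩
    refine ⟨x, hx, ?_⟩
    have hG : 0 < ‖∇ ρ x‖ := norm_pos_iff.2 hρ.gradient_ne_zero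
    rw [dist_eq_norm, sub_sub_cancel_left, norm_neg, norm_smul, norm_smul, norm_inv, norm_norm,
      inv_mul_cancel₀ hG.ne', mul_one, Real.norm_eq_abs, abs_of_nonneg hσ.1]
    exact hσ.2
  · rintro ⟨z, hz, hzd⟩
    obtain ⟨x, hx, hxd⟩ := hΩ.isCompact_frontier.exists_infDist_eq_dist ⟨z, hz⟩ y
    have hxy : x ≠ y := by
      rintro rfl
      rw [hΩ.isOpen.frontier_eq] at hx
      exact hx.2 hy
    have hd : 0 < dist y x := dist_pos.2 hxy.symm
    have hball : Metric.ball y (dist y x) ⊆ Ω := by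
      refine ball_subset_of_forall_frontier hΩ.isOpen hy fun p hp => ?_
      have := Metric.infDist_le_dist_of_mem (x := y) hp
      rwa [hxd, dist_comm y p] at this
    obtain ⟨ρ, hρ⟩ := hΩ.smooth_boundary x hx
    refine ⟨x, hx, _, ⟨ρ, hρ, rfl⟩, dist y x, ⟨hd.le, ?_⟩, ?_⟩
    · have := Metric.infDist_le_dist_of_mem (x := y) hz
      linarith
    · rw [hρ.normal_eq_of_ball hΩ.isOpen hx hxy hball, dist_comm, dist_eq_norm, smul_smul,
        mul_inv_cancel₀ (norm_pos_iff.2 (sub_ne_zero.2 hxy)).ne', one_smul, sub_sub_cancel]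

/-! ### The Hilbert space `H¹(Ω)` -/

variable {Ω : Set E3}

/-- The embedding `H¹(Ω) → L²(Ω)`. -/
def toL2 (Ω : Set E3) : H1 Ω →L[ℝ] Lp ℝ 2 (volume.restrict Ω) :=
  (WithLp.fstL 2 ℝ (Lp ℝ 2 (volume.restrict Ω)) (Lp E3 2 (volume.restrict Ω))).comp (H1 Ω).subtypeL

/-- The gradient `H¹(Ω) → L²(Ω)³`. -/
def gradL2 (Ω : Set E3) : H1 Ω →L[ℝ] Lp E3 2 (volume.restrict Ω) :=
  (WithLp.sndL 2 ℝ (Lp ℝ 2 (volume.restrict Ω)) (Lp E3 2 (volume.restrict Ω))).comp (H1 Ω).subtypeL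

theorem memLp_fn (u : H1 Ω) : MemLp (fn u) 2 (volume.restrict Ω) := Lp.memLp _

theorem memLp_grad (u : H1 Ω) : MemLp (grad u) 2 (volume.restrict Ω) := Lp.memLp _

theorem norm_sq_eq (u : H1 Ω) : ‖u‖ ^ 2 = ‖toL2 Ω u‖ ^ 2 + ‖gradL2 Ω u‖ ^ 2 :=
  WithLp.prod_norm_sq_eq_of_L2 u.1

theorem norm_toL2_le (u : H1 Ω) : ‖toL2 Ω u‖ ≤ ‖u‖ := by
  apply le_of_sq_le_sq _ (norm_nonneg u)
  rw [norm_sq_eq]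
  nlinarith [sq_nonneg ‖gradL2 Ω u‖]

theorem norm_gradL2_le (u : H1 Ω) : ‖gradL2 Ω u‖ ≤ ‖u‖ := by
  apply le_of_sq_le_sq _ (norm_nonneg u)
  rw [norm_sq_eq]
  nlinarith [sq_nonneg ‖toL2 Ω u‖]

instance : SecondCountableTopology (H1 Ω) := by
  have : Fact ((2 : ENNReal) ≠ ⊤) := ⟨by simp⟩
  have h1 : SecondCountableTopology (Lp ℝ 2 (volume.restrict Ω)) := inferInstance
  have h2 : SecondCountableTopology (Lp E3 2 (volume.restrict Ω)) := inferInstance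
  have h3 : SecondCountableTopology
      (WithLp 2 (Lp ℝ 2 (volume.restrict Ω) × Lp E3 2 (volume.restrict Ω))) :=
    (WithLp.homeomorphProd 2 _ _).secondCountableTopology
  exact TopologicalSpace.Subtype.secondCountableTopology _

theorem fderiv_eq_inner_gradient {φ : E3 → ℝ} (x c : E3) :
    fderiv ℝ φ x c = inner ℝ c (∇ φ x) := by
  rw [real_inner_comm, inner_gradient]

/-- The definition of the weak gradient, tested with the directional derivatives. -/
theorem isWeakGradient_iff {u : E3 → ℝ} {p : E3 → E3} (hu : MemLp u 2 (volume.restrict Ω))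
    (hp : MemLp p 2 (volume.restrict Ω)) :
    IsWeakGradient Ω u p ↔ ∀ φ : E3 → ℝ, ContDiff ℝ ∞ φ → HasCompactSupport φ → tsupport φ ⊆ Ω →
      ∀ c : E3, ∫ x in Ω, u x * fderiv ℝ φ x c = -∫ x in Ω, φ x * inner ℝ c (p x) := by
  refine forall_congr' fun φ => forall_congr' fun h1 => forall_congr' fun h2 =>
    forall_congr' fun _ => ?_
  have e1 : ∀ c : E3, ∫ x in Ω, u x * fderiv ℝ φ x c = inner ℝ c (∫ x in Ω, u x • ∇ φ x) := by
    intro c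
    rw [← integral_inner (integrable_smul_of_compact' hu (continuous_gradient h1)
      (hasCompactSupport_gradient h2))]
    simp only [inner_smul_right, fderiv_eq_inner_gradient]
  have e2 : ∀ c : E3, -∫ x in Ω, φ x * inner ℝ c (p x) = inner ℝ c (-∫ x in Ω, φ x • p x) := by
    intro c
    rw [inner_neg_right, ← integral_inner (integrable_smul_of_compact hp h1.continuous h2)]
    simp only [inner_smul_right]
  constructor
  · intro h c
    rw [e1, e2, h]
  · intro h
    refine ext_inner_left ℝ fun c => ?_
    rw [← e1, ← e2, h]

theorem memLp_fderiv {φ : E3 → ℝ} (h1 : ContDiff ℝ ∞ φ) (h2 : HasCompactSupport φ) (c : E3)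
    (μ : Measure E3) [IsFiniteMeasureOnCompacts μ] : MemLp (fun x => fderiv ℝ φ x c) 2 μ := by
  have hc : Continuous (fun x => fderiv ℝ φ x c) :=
    (h1.continuous_fderiv (by simp)).clm_apply continuous_const
  exact hc.memLp_of_hasCompactSupport ((h2.fderiv (𝕜 := ℝ)).comp_left
    (g := fun L : E3 →L[ℝ] ℝ => L c) (by simp))

theorem inner_toLp {μ : Measure E3} {ψ : E3 → ℝ} (h : MemLp ψ 2 μ) (v : Lp ℝ 2 μ) :
    inner ℝ (h.toLp ψ) v = ∫ x, v x * ψ x ∂μ := by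
  rw [L2.inner_def]
  apply integral_congr_ae
  filter_upwards [h.coeFn_toLp] with x hx
  rw [hx]
  rfl

theorem inner_toLp_vector {μ : Measure E3} {ψ : E3 → E3} (h : MemLp ψ 2 μ) (v : Lp E3 2 μ) :
    inner ℝ (h.toLp ψ) v = ∫ x, inner ℝ (ψ x) (v x) ∂μ := by
  rw [L2.inner_def]
  apply integral_congr_ae
  filter_upwards [h.coeFn_toLp] with x hx
  rw [hx]

theorem isClosed_H1 : IsClosed (H1 Ω : Set (WithLp 2 (Lp ℝ 2 (volume.restrict Ω) ×
    Lp E3 2 (volume.restrict Ω)))) := by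
  have h : (H1 Ω : Set (WithLp 2 (Lp ℝ 2 (volume.restrict Ω) × Lp E3 2 (volume.restrict Ω)))) =
      {q | ∀ φ : E3 → ℝ, ContDiff ℝ ∞ φ → HasCompactSupport φ → tsupport φ ⊆ Ω →
      ∀ c : E3, ∫ x in Ω, q.fst x * fderiv ℝ φ x c = -∫ x in Ω, φ x * inner ℝ c (q.snd x)} := by
    ext q
    exact isWeakGradient_iff (Lp.memLp _) (Lp.memLp _)
  rw [h]
  simp only [ofPred_forall]
  refine isClosed_iInter fun φ => isClosed_iInter fun h1 => isClosed_iInter fun h2 =>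
    isClosed_iInter fun _ => isClosed_iInter fun c => ?_
  have m2 : MemLp (fun x => φ x • c) 2 (volume.restrict Ω) :=
    (h1.continuous.smul continuous_const).memLp_of_hasCompactSupport h2.smul_right
  have e1 := fun q : WithLp 2 (Lp ℝ 2 (volume.restrict Ω) × Lp E3 2 (volume.restrict Ω)) =>
    inner_toLp (memLp_fderiv h1 h2 c (volume.restrict Ω)) q.fst
  have e2 := fun q : WithLp 2 (Lp ℝ 2 (volume.restrict Ω) × Lp E3 2 (volume.restrict Ω)) =>
    inner_toLp_vector m2 q.snd
  simp only [real_inner_smul_left] at e2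
  simp only [← e1, ← e2]
  apply isClosed_eq
  · exact continuous_const.inner (WithLp.continuous_fst 2 _ _)
  · exact (continuous_const.inner (WithLp.continuous_snd 2 _ _)).neg

instance : CompleteSpace (H1 Ω) := isClosed_H1.completeSpace_coe

/-- The element of `H¹(Ω)` with a given function and a given weak gradient. -/
def mkH1 (u : E3 → ℝ) (p : E3 → E3) (hu : MemLp u 2 (volume.restrict Ω))
    (hp : MemLp p 2 (volume.restrict Ω)) (h : IsWeakGradient Ω u p) : H1 Ω :=
  ⟨WithLp.toLp 2 (hu.toLp u, hp.toLp p), by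
    intro φ h1 h2 h3
    have e1 : ∫ x in Ω, (hu.toLp u) x • ∇ φ x = ∫ x in Ω, u x • ∇ φ x := by
      apply integral_congr_ae
      filter_upwards [hu.coeFn_toLp] with x hx
      rw [hx]
    have e2 : ∫ x in Ω, φ x • (hp.toLp p) x = ∫ x in Ω, φ x • p x := by
      apply integral_congr_ae
      filter_upwards [hp.coeFn_toLp] with x hx
      rw [hx]
    exact e1.trans ((h φ h1 h2 h3).trans (congrArg Neg.neg e2.symm))⟩

/-- Functions agreeing almost everywhere in `Ω` have the same weak gradient. -/
theorem H1_ext (ho : IsOpen Ω) {u v : H1 Ω} (h : toL2 Ω u = toL2 Ω v) : u = v := by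
  suffices hz : ∀ w : H1 Ω, toL2 Ω w = 0 → w = 0 by
    exact sub_eq_zero.1 (hz (u - v) (by rw [map_sub, h, sub_self]))
  intro w hw
  have hg : gradL2 Ω w = 0 := by
    have hloc : LocallyIntegrableOn (grad w) Ω := by
      have : MemLp (grad w) 2 (volume.restrict Ω) := Lp.memLp _
      have h1 := this.locallyIntegrable (by simp)
      intro x hx
      obtain ⟨s, hs, hs2⟩ := h1 x
      refine ⟨s ∩ Ω, inter_mem (nhdsWithin_le_nhds hs) self_mem_nhdsWithin, ?_⟩
      rwa [IntegrableOn, Measure.restrict_restrict' ho.measurableSet] at hs2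
    have h2 := ho.ae_eq_zero_of_integral_contDiff_smul_eq_zero hloc (fun φ h1 h2 h3 => by
      have h4 := w.2 φ h1 h2 h3
      have h5 : ∫ x in Ω, w.1.fst x • ∇ φ x = 0 := by
        apply integral_eq_zero_of_ae
        have : w.1.fst = 0 := hw
        filter_upwards [Lp.coeFn_zero ℝ 2 (volume.restrict Ω)] with x hx
        rw [this, hx]
        simp
      rw [h5, eq_comm, neg_eq_zero] at h4
      rw [← h4]
      symm
      apply setIntegral_eq_integral_of_forall_compl_eq_zero
      intro x hx
      rw [image_eq_zero_of_notMem_tsupport (fun h => hx (h3 h)), zero_smul])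
    apply Lp.ext
    refine EventuallyEq.trans ?_ (Lp.coeFn_zero _ _ _).symm
    exact (ae_restrict_iff' ho.measurableSet).2 h2
  have := norm_sq_eq w
  rw [hw, hg] at this
  simpa using this

/-! ### Smooth functions and multiplication by smooth functions -/

theorem gradient_mul {χ φ : E3 → ℝ} (hχ : ContDiff ℝ ∞ χ) (hφ : ContDiff ℝ ∞ φ) (x c : E3) :
    fderiv ℝ (fun y => χ y * φ y) x c = χ x * fderiv ℝ φ x c + φ x * fderiv ℝ χ x c := by
  rw [fderiv_fun_mul (hχ.differentiable (by simp) x) (hφ.differentiable (by simp) x)]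
  simp

theorem memLp_gradient {φ : E3 → ℝ} (h1 : ContDiff ℝ ∞ φ) (h2 : HasCompactSupport φ)
    (μ : Measure E3) [IsFiniteMeasureOnCompacts μ] : MemLp (∇ φ) 2 μ :=
  (continuous_gradient h1).memLp_of_hasCompactSupport (hasCompactSupport_gradient h2)

theorem isWeakGradient_gradient {φ : E3 → ℝ} (h1 : ContDiff ℝ ∞ φ) (h2 : HasCompactSupport φ) :
    IsWeakGradient Ω φ (∇ φ) := by
  rw [isWeakGradient_iff (h1.continuous.memLp_of_hasCompactSupport h2) (memLp_gradient h1 h2 _)]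
  intro ψ h3 h4 h5 c
  have c1 : Continuous (fun x => fderiv ℝ φ x c) :=
    (h1.continuous_fderiv (by simp)).clm_apply continuous_const
  have c2 : Continuous (fun x => fderiv ℝ ψ x c) :=
    (h3.continuous_fderiv (by simp)).clm_apply continuous_const
  have key := integral_mul_fderiv_eq_neg_fderiv_mul_of_integrable (μ := (volume : Measure E3))
    (f := φ) (g := ψ) (v := c)
    ((c1.mul h3.continuous).integrable_of_hasCompactSupport h4.mul_left)
    ((h1.continuous.mul c2).integrable_of_hasCompactSupport h2.mul_right)
    ((h1.continuous.mul h3.continuous).integrable_of_hasCompactSupport h4.mul_left)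
    (fun x _ => h1.differentiable (by simp) x) (fun x _ => h3.differentiable (by simp) x)
  rw [setIntegral_eq_integral_of_forall_compl_eq_zero, key,
    setIntegral_eq_integral_of_forall_compl_eq_zero]
  · simp only [← fderiv_eq_inner_gradient, mul_comm]
  · intro x hx
    rw [image_eq_zero_of_notMem_tsupport (fun h => hx (h5 h)), zero_mul]
  · intro x hx
    have : x ∉ tsupport (fderiv ℝ ψ) := fun h => hx (h5 (tsupport_fderiv_subset ℝ h))
    rw [image_eq_zero_of_notMem_tsupport this]
    simp

/-- The restriction to `Ω` of a smooth function with compact support. -/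
def ofSmooth (Ω : Set E3) (φ : E3 → ℝ) (h1 : ContDiff ℝ ∞ φ) (h2 : HasCompactSupport φ) : H1 Ω :=
  mkH1 φ (∇ φ) (h1.continuous.memLp_of_hasCompactSupport h2) (memLp_gradient h1 h2 _)
    (isWeakGradient_gradient h1 h2)

theorem fn_ofSmooth {φ : E3 → ℝ} (h1 : ContDiff ℝ ∞ φ) (h2 : HasCompactSupport φ) :
    fn (ofSmooth Ω φ h1 h2) =ᵐ[volume.restrict Ω] φ :=
  (h1.continuous.memLp_of_hasCompactSupport h2).coeFn_toLp

theorem grad_ofSmooth {φ : E3 → ℝ} (h1 : ContDiff ℝ ∞ φ) (h2 : HasCompactSupport φ) :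
    grad (ofSmooth Ω φ h1 h2) =ᵐ[volume.restrict Ω] ∇ φ :=
  (memLp_gradient h1 h2 _).coeFn_toLp

theorem eq_ofSmooth (ho : IsOpen Ω) {u : H1 Ω} {φ : E3 → ℝ} (h1 : ContDiff ℝ ∞ φ)
    (h2 : HasCompactSupport φ) (h : fn u =ᵐ[volume.restrict Ω] φ) : u = ofSmooth Ω φ h1 h2 := by
  apply H1_ext ho
  apply Lp.ext
  exact h.trans (fn_ofSmooth h1 h2).symm

theorem memLp_smul_compact {F : Type*} [NormedAddCommGroup F] [NormedSpace ℝ F] {μ : Measure E3}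
    {v : E3 → F} (hv : MemLp v 2 μ) {ψ : E3 → ℝ} (hψ : Continuous ψ) (hc : HasCompactSupport ψ) :
    MemLp (fun x => ψ x • v x) 2 μ := by
  obtain ⟨C, hC⟩ := hψ.bounded_above_of_compact_support hc
  refine hv.of_le_mul (c := C) (hψ.aestronglyMeasurable.smul hv.1) (ae_of_all _ fun x => ?_)
  rw [norm_smul]
  exact mul_le_mul_of_nonneg_right (hC x) (norm_nonneg _)

theorem memLp_smul_compact' {F : Type*} [NormedAddCommGroup F] [NormedSpace ℝ F] {μ : Measure E3}
    {v : E3 → ℝ} (hv : MemLp v 2 μ) {ψ : E3 → F} (hψ : Continuous ψ) (hc : HasCompactSupport ψ) :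
    MemLp (fun x => v x • ψ x) 2 μ := by
  obtain ⟨C, hC⟩ := hψ.bounded_above_of_compact_support hc
  refine hv.of_le_mul (c := C) (hv.1.smul hψ.aestronglyMeasurable) (ae_of_all _ fun x => ?_)
  rw [norm_smul, mul_comm]
  exact mul_le_mul_of_nonneg_right (hC x) (norm_nonneg _)

theorem memLp_cutoff_gradient {χ : E3 → ℝ} (h1 : ContDiff ℝ ∞ χ) (h2 : HasCompactSupport χ)
    (u : H1 Ω) : MemLp (fun x => χ x • grad u x + fn u x • ∇ χ x) 2 (volume.restrict Ω) :=
  (memLp_smul_compact (memLp_grad u) h1.continuous h2).add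
    (memLp_smul_compact' (memLp_fn u) (continuous_gradient h1) (hasCompactSupport_gradient h2))

/-- The Leibniz rule for the product of `u ∈ H¹(Ω)` with a smooth function. -/
theorem isWeakGradient_cutoff {χ : E3 → ℝ} (h1 : ContDiff ℝ ∞ χ) (h2 : HasCompactSupport χ)
    (u : H1 Ω) :
    IsWeakGradient Ω (fun x => χ x • fn u x) (fun x => χ x • grad u x + fn u x • ∇ χ x) := by
  have hu : MemLp (fn u) 2 (volume.restrict Ω):= memLp_fn u
  have hp : MemLp (grad u) 2 (volume.restrict Ω) := memLp_grad u
  rw [isWeakGradient_iff (memLp_smul_compact hu h1.continuous h2) (memLp_cutoff_gradient h1 h2 u)]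
  intro φ h3 h4 h5 c
  have key := (isWeakGradient_iff hu hp).1 u.2 (fun x => χ x * φ x) (h1.mul h3) h2.mul_right
    (closure_minimal ((Function.support_mul_subset_right χ φ).trans (subset_tsupport φ |>.trans
      (subset_refl _))) (isClosed_tsupport φ) |>.trans h5) c
  have i1 : Integrable (fun x => fn u x * (χ x * fderiv ℝ φ x c)) (volume.restrict Ω) := by
    refine integrable_smul_of_compact' hu (h1.continuous.mul
      ((h3.continuous_fderiv (by simp)).clm_apply continuous_const)) h2.mul_right
  have i2 : Integrable (fun x => fn u x * (φ x * fderiv ℝ χ x c)) (volume.restrict Ω) := by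
    refine integrable_smul_of_compact' hu (h3.continuous.mul
      ((h1.continuous_fderiv (by simp)).clm_apply continuous_const)) h4.mul_right
  have i3 : Integrable (fun x => (χ x * φ x) * inner ℝ c (grad u x)) (volume.restrict Ω) := by
    refine integrable_smul_of_compact (F := ℝ) (hp.const_inner c) (h1.continuous.mul h3.continuous)
      h2.mul_right
  simp only [gradient_mul h1 h3, mul_add] at key
  rw [integral_add i1 i2] at key
  have e1 : ∫ x in Ω, χ x • fn u x * fderiv ℝ φ x c =
      ∫ x in Ω, fn u x * (χ x * fderiv ℝ φ x c) := by
    congr 1; ext x; rw [smul_eq_mul]; ring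
  have e2 : ∫ x in Ω, φ x * inner ℝ c (χ x • grad u x + fn u x • ∇ χ x) =
      ∫ x in Ω, ((χ x * φ x) * inner ℝ c (grad u x) + fn u x * (φ x * fderiv ℝ χ x c)) := by
    congr 1; ext x
    rw [inner_add_right, inner_smul_right, inner_smul_right, fderiv_eq_inner_gradient]; ring
  rw [e1, e2, integral_add i3 i2]
  linarith

/-- The product `χ u ∈ H¹(Ω)` of `u ∈ H¹(Ω)` with a smooth function `χ` of compact support. -/
def cutoff {χ : E3 → ℝ} (h1 : ContDiff ℝ ∞ χ) (h2 : HasCompactSupport χ) (u : H1 Ω) : H1 Ω :=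
  mkH1 (fun x => χ x • fn u x) (fun x => χ x • grad u x + fn u x • ∇ χ x)
    (memLp_smul_compact (memLp_fn u) h1.continuous h2) (memLp_cutoff_gradient h1 h2 u)
    (isWeakGradient_cutoff h1 h2 u)

theorem fn_cutoff {χ : E3 → ℝ} (h1 : ContDiff ℝ ∞ χ) (h2 : HasCompactSupport χ) (u : H1 Ω) :
    fn (cutoff h1 h2 u) =ᵐ[volume.restrict Ω] fun x => χ x • fn u x :=
  (memLp_smul_compact (memLp_fn u) h1.continuous h2).coeFn_toLp

theorem grad_cutoff {χ : E3 → ℝ} (h1 : ContDiff ℝ ∞ χ) (h2 : HasCompactSupport χ) (u : H1 Ω) :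
    grad (cutoff h1 h2 u) =ᵐ[volume.restrict Ω] fun x => χ x • grad u x + fn u x • ∇ χ x :=
  (memLp_cutoff_gradient h1 h2 u).coeFn_toLp

/-! ### The collar estimate for smooth functions -/

/-- The value at an end point of an interval of length `δ` is bounded by an integral: the
fundamental theorem of calculus for `(t / δ - 1) h(t) ^ 2`. -/
theorem ofReal_lintegral_bound {h h' : ℝ → ℝ} {δ c : ℝ} (hδ : 0 < δ)
    (hd : ∀ t, HasDerivAt h (h' t) t) (hc' : Continuous h')
    (hc1 : δ⁻¹ ≤ c) (hc2 : 2 ≤ c) :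
    ENNReal.ofReal (h 0 ^ 2) ≤
      ∫⁻ t in Ioo 0 δ, ENNReal.ofReal (c * (h t ^ 2 + |h t| * |h' t|)) := by
  have hc : Continuous h := continuous_iff_continuousAt.2 fun t => (hd t).continuousAt
  have hder : ∀ t, HasDerivAt (fun s => (δ⁻¹ * s - 1) * h s ^ 2)
      (δ⁻¹ * h t ^ 2 + (δ⁻¹ * t - 1) * (2 * h t * h' t)) t := by
    intro t
    have h1 : HasDerivAt (fun s : ℝ => δ⁻¹ * s - 1) δ⁻¹ t := by
      simpa using ((hasDerivAt_id t).const_mul δ⁻¹).sub_const 1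
    have h2 : HasDerivAt (fun s : ℝ => h s ^ 2) (2 * h t * h' t) t := by
      simpa using (hd t).fun_pow 2
    exact h1.mul h2
  have hcont : Continuous fun t => δ⁻¹ * h t ^ 2 + (δ⁻¹ * t - 1) * (2 * h t * h' t) := by fun_prop
  have ftc := intervalIntegral.integral_eq_sub_of_hasDerivAt (a := 0) (b := δ)
    (fun t _ => hder t) (hcont.intervalIntegrable _ _)
  have e1 : (δ⁻¹ * δ - 1) * h δ ^ 2 - (δ⁻¹ * 0 - 1) * h 0 ^ 2 = h 0 ^ 2 := by
    rw [inv_mul_cancel₀ hδ.ne']; ring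
  rw [e1] at ftc
  have hcont2 : Continuous fun t => c * (h t ^ 2 + |h t| * |h' t|) := by fun_prop
  have hle : h 0 ^ 2 ≤ ∫ t in (0 : ℝ)..δ, c * (h t ^ 2 + |h t| * |h' t|) := by
    rw [← ftc]
    apply intervalIntegral.integral_mono_on hδ.le (hcont.intervalIntegrable _ _)
      (hcont2.intervalIntegrable _ _)
    intro t ht
    have h3 : |δ⁻¹ * t - 1| ≤ 1 := by
      have : δ⁻¹ * t ≤ 1 := by rw [inv_mul_le_iff₀ hδ]; linarith [ht.2]
      have : 0 ≤ δ⁻¹ * t := mul_nonneg (by positivity) ht.1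
      rw [abs_le]; constructor <;> linarith
    have h4 : (δ⁻¹ * t - 1) * (2 * h t * h' t) ≤ 1 * (2 * (|h t| * |h' t|)) := by
      refine (le_abs_self _).trans ?_
      rw [abs_mul, abs_mul, abs_mul, abs_two, mul_assoc]
      exact mul_le_mul_of_nonneg_right h3 (by positivity)
    have h5 : δ⁻¹ * h t ^ 2 ≤ c * h t ^ 2 := mul_le_mul_of_nonneg_right hc1 (sq_nonneg _)
    have h6 : 2 * (|h t| * |h' t|) ≤ c * (|h t| * |h' t|) :=
      mul_le_mul_of_nonneg_right hc2 (by positivity)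
    linarith
  refine (ENNReal.ofReal_le_ofReal hle).trans ?_
  have hcpos : 0 ≤ c := by linarith
  rw [intervalIntegral.integral_of_le hδ.le, ofReal_integral_eq_lintegral_ofReal
    ((hcont2.intervalIntegrable 0 δ).1) (ae_of_all _ fun t => by positivity),
    ← restrict_Ioo_eq_restrict_Ioc]

/-- The density `φ ^ 2 + |φ| ‖∇φ‖` on the right-hand side of the collar estimate. -/
def collarDensity (φ : E3 → ℝ) (x : E3) : ENNReal := ENNReal.ofReal (φ x ^ 2 + |φ x| * ‖∇ φ x‖)

theorem measurable_collarDensity {φ : E3 → ℝ} (hφ : ContDiff ℝ ∞ φ) :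
    Measurable (collarDensity φ) := by
  have h1 := hφ.continuous
  have h2 := continuous_gradient hφ
  exact ENNReal.measurable_ofReal.comp (by fun_prop : Continuous
    fun x => φ x ^ 2 + |φ x| * ‖∇ φ x‖).measurable

/-- The square of a smooth function at `x` is bounded by the integral of the collar density over a
segment that starts at `x`. -/
theorem ofReal_sq_le_line {φ : E3 → ℝ} (hφ : ContDiff ℝ ∞ φ) {e : E3} (he : ‖e‖ = 1) {δ c : ℝ}
    (hδ : 0 < δ) (hc1 : δ⁻¹ ≤ c) (hc2 : 2 ≤ c) (x : E3) :
    ENNReal.ofReal (φ x ^ 2) ≤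
      ∫⁻ t in Ioo 0 δ, ENNReal.ofReal c * collarDensity φ (x + t • e) := by
  have hd : ∀ t : ℝ, HasDerivAt (fun s : ℝ => φ (x + s • e)) (fderiv ℝ φ (x + t • e) e) t := by
    intro t
    have h1 : HasDerivAt (fun s : ℝ => x + s • e) e t := by
      simpa using ((hasDerivAt_id t).smul_const e).const_add x
    exact (hφ.differentiable (by simp) (x + t • e)).hasFDerivAt.comp_hasDerivAt t h1
  have hcont : Continuous fun t : ℝ => fderiv ℝ φ (x + t • e) e :=
    ((hφ.continuous_fderiv (by simp)).comp
      (by fun_prop : Continuous fun t : ℝ => x + t • e)).clm_apply continuous_const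
  have h := ofReal_lintegral_bound hδ hd hcont hc1 hc2
  simp only [zero_smul, add_zero] at h
  refine h.trans (lintegral_mono fun t => ?_)
  rw [collarDensity, ← ENNReal.ofReal_mul (by linarith)]
  apply ENNReal.ofReal_le_ofReal
  have h2 : |fderiv ℝ φ (x + t • e) e| ≤ ‖∇ φ (x + t • e)‖ := by
    rw [fderiv_eq_inner_gradient]
    have := abs_real_inner_le_norm e (∇ φ (x + t • e))
    rwa [he, one_mul] at this
  have : 0 ≤ c := by linarith
  gcongr

/-- The collar estimate in a flat chart. The values on `A` are estimated along segments in the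
direction of the inner normal `e`; by Fubini, each point of `Ω` is used for a parameter set of
length at most `4 ε`, since `0 < τ ≤ 2 ε` on `A` and `τ` has slope at least `3 / 4` along `e`. -/
theorem IsFlatChart.lintegral_le {Ω : Set E3} {R : ℝ} {x₀ e : E3} {τ : E3 → ℝ}
    (h : IsFlatChart Ω (1 / 4) x₀ e R τ) {c : ℝ} (hc1 : (R / 2)⁻¹ ≤ c) (hc2 : 2 ≤ c)
    {ε : ℝ} {A : Set E3} (hA : MeasurableSet A) (hAs : A ⊆ Ω ∩ Metric.ball x₀ (R / 2))
    (hAτ : ∀ x ∈ A, τ x ≤ 2 * ε) {φ : E3 → ℝ} (hφ : ContDiff ℝ ∞ φ) :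
    ∫⁻ x in A, ENNReal.ofReal (φ x ^ 2) ≤
      ENNReal.ofReal (4 * c * ε) * ∫⁻ x in Ω, collarDensity φ x := by
  have hR := h.pos
  have hm := measurable_collarDensity hφ
  by_cases hε : ε < 0
  · have : A = ∅ := by
      rw [eq_empty_iff_forall_notMem]
      intro x hx
      have h1 := (h.mem_iff x (Metric.ball_subset_ball (by linarith) (hAs hx).2)).1 (hAs hx).1
      linarith [hAτ x hx]
    simp [this]
  push Not at hε
  have hin : ∀ x ∈ A, ∀ t ∈ Ioo (0 : ℝ) (R / 2), x + t • e ∈ Metric.ball x₀ R := by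
    intro x hx t ht
    have h1 := Metric.mem_ball.1 (hAs hx).2
    rw [Metric.mem_ball]
    calc dist (x + t • e) x₀ ≤ dist (x + t • e) x + dist x x₀ := dist_triangle _ _ _
      _ < R / 2 + R / 2 := by
        rw [dist_eq_norm (x + t • e) x, add_sub_cancel_left, norm_smul, h.norm_e, mul_one,
          Real.norm_eq_abs, abs_of_pos ht.1]
        linarith [ht.2]
      _ = R := by ring
  have hball : ∀ x ∈ A, x ∈ Metric.ball x₀ R := fun x hx =>
    Metric.ball_subset_ball (by linarith) (hAs hx).2
  have hmeas2 : Measurable fun p : E3 × ℝ => p.1 - p.2 • e := by fun_prop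
  have hmeas3 : Measurable fun p : E3 × ℝ => p.1 + p.2 • e := by fun_prop
  set G : E3 × ℝ → ENNReal := fun p =>
    A.indicator (fun _ => ENNReal.ofReal c * collarDensity φ (p.1 + p.2 • e)) p.1 with hG
  have hGm : Measurable G := by
    have : G = (Prod.fst ⁻¹' A).indicator
        fun p => ENNReal.ofReal c * collarDensity φ (p.1 + p.2 • e) := by
      ext p
      rfl
    rw [this]
    exact ((hm.comp hmeas3).const_mul _).indicator (measurable_fst hA)
  -- the length, in the direction of `e`, of the part of `A` behind the point `y`
  have hlen : ∀ y : E3, ∫⁻ t in Ioo 0 (R / 2), A.indicator (fun _ => (1 : ENNReal)) (y - t • e) ≤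
      Ω.indicator (fun _ => ENNReal.ofReal (4 * ε)) y := by
    intro y
    set S : Set ℝ := Ioo 0 (R / 2) ∩ {t | y - t • e ∈ A} with hS
    have hSm : MeasurableSet {t : ℝ | y - t • e ∈ A} :=
      (by fun_prop : Measurable fun t : ℝ => y - t • e) hA
    have e1 : ∫⁻ t in Ioo 0 (R / 2), A.indicator (fun _ => (1 : ENNReal)) (y - t • e) =
        volume S := by
      have : (fun t : ℝ => A.indicator (fun _ => (1 : ENNReal)) (y - t • e)) =
          {t : ℝ | y - t • e ∈ A}.indicator 1 := by
        ext t; simp [indicator]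
      rw [this, lintegral_indicator_one hSm, Measure.restrict_apply hSm, hS, inter_comm]
    rw [e1]
    by_cases hy : y ∈ Ω
    · rw [indicator_of_mem hy]
      refine (Real.volume_le_diam S).trans ?_
      apply Metric.ediam_le
      intro t ht s hs
      have key : ∀ t ∈ S, ∀ s ∈ S, t ≤ s → s - t ≤ 4 * ε := by
        intro t ht s hs hts
        have e2 : y - t • e = (y - s • e) + (s - t) • e := by module
        have h1 := h.slope_le (y := y - s • e) (t := s - t) (by linarith) (hball _ hs.2)
          (by rw [← e2]; exact hball _ ht.2)
        rw [← e2] at h1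
        have h2 := hAτ _ ht.2
        have h3 := (h.mem_iff _ (hball _ hs.2)).1 (hAs hs.2).1
        linarith
      rw [edist_dist, Real.dist_eq]
      apply ENNReal.ofReal_le_ofReal
      rcases le_total t s with hts | hts
      · rw [abs_sub_comm, abs_of_nonneg (by linarith)]; exact key t ht s hs hts
      · rw [abs_of_nonneg (by linarith)]; exact key s hs t ht hts
    · rw [indicator_of_notMem hy]
      have : S = ∅ := by
        rw [eq_empty_iff_forall_notMem]
        rintro t ⟨ht1, ht2⟩
        have ht2' : y - t • e ∈ A := ht2
        have h1 := hin _ ht2' t ht1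
        have h2 := h.slope_le ht1.1.le (hball _ ht2') h1
        rw [sub_add_cancel] at h1 h2
        have h3 := (h.mem_iff _ (hball _ ht2')).1 (hAs ht2').1
        apply hy
        rw [h.mem_iff y h1]
        have := ht1.1
        linarith
      simp [this]
  calc ∫⁻ x in A, ENNReal.ofReal (φ x ^ 2)
      ≤ ∫⁻ x in A, ∫⁻ t in Ioo 0 (R / 2), ENNReal.ofReal c * collarDensity φ (x + t • e) :=
        lintegral_mono fun x => ofReal_sq_le_line hφ h.norm_e (by linarith) hc1 hc2 x
    _ = ∫⁻ x, ∫⁻ t in Ioo 0 (R / 2), G (x, t) := by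
        rw [← lintegral_indicator hA]
        congr 1; ext x
        by_cases hx : x ∈ A
        · simp [hG, hx]
        · simp [hG, hx]
    _ = ∫⁻ t in Ioo 0 (R / 2), ∫⁻ x, G (x, t) := lintegral_lintegral_swap hGm.aemeasurable
    _ = ∫⁻ t in Ioo 0 (R / 2), ∫⁻ y, ENNReal.ofReal c * collarDensity φ y *
          A.indicator (fun _ => (1 : ENNReal)) (y - t • e) := by
        congr 1; ext t
        rw [← lintegral_sub_right_eq_self _ (t • e)]
        congr 1; ext y
        simp only [hG, indicator, sub_add_cancel]
        split_ifs <;> simp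
    _ = ∫⁻ y, ∫⁻ t in Ioo 0 (R / 2), ENNReal.ofReal c * collarDensity φ y *
          A.indicator (fun _ => (1 : ENNReal)) (y - t • e) := by
        symm
        apply lintegral_lintegral_swap
        apply Measurable.aemeasurable
        refine ((hm.comp measurable_fst).const_mul _).mul ?_
        exact (measurable_const.indicator hA).comp hmeas2
    _ ≤ ∫⁻ y, ENNReal.ofReal c * collarDensity φ y *
          Ω.indicator (fun _ => ENNReal.ofReal (4 * ε)) y := by
        refine lintegral_mono fun y => ?_
        rw [lintegral_const_mul']
        · exact mul_le_mul_right (hlen y) _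
        · exact ENNReal.mul_ne_top ENNReal.ofReal_ne_top ENNReal.ofReal_ne_top
    _ ≤ ∫⁻ y, Ω.indicator (fun y => ENNReal.ofReal (4 * c * ε) * collarDensity φ y) y := by
        refine lintegral_mono fun y => ?_
        by_cases hy : y ∈ Ω
        · simp only [indicator_of_mem hy]
          rw [mul_right_comm, ← ENNReal.ofReal_mul (by linarith)]
          apply le_of_eq; congr 2; ring
        · simp [indicator_of_notMem hy]
    _ ≤ ∫⁻ y in Ω, ENNReal.ofReal (4 * c * ε) * collarDensity φ y := lintegral_indicator_le _ _
    _ = _ := lintegral_const_mul _ hm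

/-- The collar estimate: the integral of `φ ^ 2` over the strip is at most `C ε` times the integral
of `φ ^ 2 + |φ| ‖∇φ‖` over `Ω`. The factor `|φ| ‖∇φ‖` in place of `‖∇φ‖ ^ 2` is what makes
restriction to the strips a compact operation, uniformly in `ε`. -/
theorem IsSmoothBoundedOpen.exists_collar {Ω : Set E3} (hΩ : IsSmoothBoundedOpen Ω) :
    ∃ C ε₀ : ℝ, 0 < C ∧ 0 < ε₀ ∧ ∀ ε ∈ Ioc 0 ε₀, ∀ φ : E3 → ℝ, ContDiff ℝ ∞ φ →
      ∫⁻ x in Ω ∩ Metric.thickening ε (frontier Ω), ENNReal.ofReal (φ x ^ 2) ≤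
        ENNReal.ofReal (C * ε) * ∫⁻ x in Ω, collarDensity φ x := by
  have key : ∃ C ε₀ : ℝ, 0 < C ∧ 0 < ε₀ ∧ ∃ U : Set E3, IsOpen U ∧ frontier Ω ⊆ U ∧
      ∀ ε ∈ Ioc 0 ε₀, ∀ φ : E3 → ℝ, ContDiff ℝ ∞ φ →
      ∫⁻ x in Ω ∩ Metric.thickening ε (frontier Ω) ∩ U, ENNReal.ofReal (φ x ^ 2) ≤
        ENNReal.ofReal (C * ε) * ∫⁻ x in Ω, collarDensity φ x := by
    refine hΩ.isCompact_frontier.induction_on (p := fun s => ∃ C ε₀ : ℝ, 0 < C ∧ 0 < ε₀ ∧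
      ∃ U : Set E3, IsOpen U ∧ s ⊆ U ∧ ∀ ε ∈ Ioc 0 ε₀, ∀ φ : E3 → ℝ, ContDiff ℝ ∞ φ →
      ∫⁻ x in Ω ∩ Metric.thickening ε (frontier Ω) ∩ U, ENNReal.ofReal (φ x ^ 2) ≤
        ENNReal.ofReal (C * ε) * ∫⁻ x in Ω, collarDensity φ x) ?_ ?_ ?_ ?_
    · exact ⟨1, 1, one_pos, one_pos, ∅, isOpen_empty, subset_rfl, fun ε _ φ _ => by simp⟩
    · rintro s t hst ⟨C, ε₀, hC, hε, U, hU, htU, h⟩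
      exact ⟨C, ε₀, hC, hε, U, hU, hst.trans htU, h⟩
    · rintro s t ⟨C, ε₀, hC, hε, U, hU, htU, h⟩ ⟨C', ε₀', hC', hε', U', hU', htU', h'⟩
      refine ⟨C + C', min ε₀ ε₀', by positivity, by positivity, U ∪ U', hU.union hU',
        union_subset_union htU htU', fun ε he φ hφ => ?_⟩
      have hεpos := he.1
      rw [inter_union_distrib_left]
      refine (lintegral_union_le _ _ _).trans ?_
      refine (add_le_add (h ε ⟨he.1, he.2.trans (min_le_left _ _)⟩ φ hφ)
        (h' ε ⟨he.1, he.2.trans (min_le_right _ _)⟩ φ hφ)).trans ?_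
      rw [← add_mul, ← ENNReal.ofReal_add (by positivity) (by positivity), add_mul]
    · intro x hx
      obtain ⟨e, R, τ, hch⟩ := hΩ.exists_flatChart hx (η := 1 / 4) (by norm_num)
      have hR := hch.pos
      set c := max (R / 2)⁻¹ 2 with hc
      have hcpos : 0 < c := lt_of_lt_of_le two_pos (le_max_right _ _)
      refine ⟨Metric.ball x (R / 2),
        mem_nhdsWithin_of_mem_nhds (Metric.ball_mem_nhds x (by linarith)), 4 * c, R / 2, by positivity, by linarith, Metric.ball x (R / 2), Metric.isOpen_ball,
        subset_rfl, fun ε he φ hφ => ?_⟩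
      refine hch.lintegral_le (le_max_left _ _) (le_max_right _ _) (ε := ε) ?_ ?_ ?_ hφ
      · exact ((hΩ.isOpen.inter Metric.isOpen_thickening).inter Metric.isOpen_ball).measurableSet
      · exact inter_subset_inter_left _ inter_subset_left
      · rintro y ⟨⟨hy1, hy2⟩, hy3⟩
        obtain ⟨z, hz, hyz⟩ := Metric.mem_thickening_iff.1 hy2
        have hyb : y ∈ Metric.ball x R := Metric.ball_subset_ball (by linarith) hy3
        have hzb : z ∈ Metric.ball x R := by
          rw [Metric.mem_ball] at hy3 ⊢
          have := dist_triangle z y x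
          rw [dist_comm z y] at this
          linarith [he.2]
        -- `τ` vanishes at the boundary point `z` and is `5 / 4`-Lipschitz, so `τ y ≤ 2 ε`
        have h1 := hch.sub_le_norm hyb hzb
        rw [(hch.mem_frontier_iff (by norm_num) hΩ.isOpen hzb).1 hz, ← dist_eq_norm] at h1
        linarith [he.1]
  obtain ⟨C, ε₀, hC, hε, U, hU, hsub, h⟩ := key
  obtain ⟨δ, hδ, hδU⟩ := hΩ.isCompact_frontier.exists_thickening_subset_open hU hsub
  refine ⟨C, min ε₀ δ, hC, by positivity, fun ε he φ hφ => ?_⟩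
  have h1 := h ε ⟨he.1, he.2.trans (min_le_left _ _)⟩ φ hφ
  rwa [inter_eq_left.2 (inter_subset_right.trans
    ((Metric.thickening_mono (he.2.trans (min_le_right _ _)) _).trans hδU))] at h1

/-! ### Approximate identities in `L²` -/

section Mollification

variable {F : Type*} [NormedAddCommGroup F]

/-- Translation is continuous in `L²`. -/
theorem tendsto_translate {V : E3 → F} (hV : MemLp V 2 volume) :
    Tendsto (fun y => eLpNorm (fun x => V (x - y) - V x) 2 volume) (𝓝 0) (𝓝 0) := by
  have hmp : ∀ y : E3, MeasurePreserving (fun x : E3 => x - y) volume volume := fun y =>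
    measurePreserving_sub_right volume y
  set g : E3 → C(E3, E3) := fun y => ⟨fun x => x - y, by fun_prop⟩ with hg
  have hgc : Continuous g := ContinuousMap.continuous_of_continuous_uncurry g (by
    change Continuous fun p : E3 × E3 => p.2 - p.1
    fun_prop)
  have h := Filter.Tendsto.compMeasurePreservingLp (p := 2) (f := fun _ : E3 => hV.toLp V)
    (l := 𝓝 0) tendsto_const_nhds (hgc.tendsto 0) (fun y => hmp y) (hmp 0) (by simp)
  rw [tendsto_iff_edist_tendsto_0] at h
  refine h.congr fun y => ?_
  rw [Lp.edist_def]
  apply eLpNorm_congr_ae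
  have e1 : ∀ y : E3, ∀ᵐ x : E3,
      (Lp.compMeasurePreserving (g y) (hmp y) (hV.toLp V)) x = V (x - y) := by
    intro y
    filter_upwards [Lp.coeFn_compMeasurePreserving (hV.toLp V) (hmp y),
      (hmp y).quasiMeasurePreserving.ae_eq_comp hV.coeFn_toLp] with x h1 h2
    exact h1.trans h2
  filter_upwards [e1 y, e1 0] with x h1 h2
  rw [Pi.sub_apply]
  erw [h1, h2]
  rw [sub_zero]

variable [NormedSpace ℝ F] [CompleteSpace F]

/-- Jensen's inequality for the average of `V` with weight `k`. -/
theorem enorm_sq_convolution_le {V : E3 → F} {k : E3 → ℝ} (hk : Continuous k)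
    (hk0 : ∀ y, 0 ≤ k y) (hk1 : ∫ y, k y = 1) (w : F) (hi : Integrable (fun y => k y • V y))
    (hm : AEMeasurable fun y => ‖V y - w‖ₑ) :
    ‖(∫ y, k y • V y) - w‖ₑ ^ 2 ≤ ∫⁻ y, ENNReal.ofReal (k y) * ‖V y - w‖ₑ ^ 2 := by
  have hki : Integrable k := by
    by_contra h
    rw [integral_undef h] at hk1
    exact zero_ne_one hk1
  have hk2 : ∫⁻ y, ENNReal.ofReal (k y) = 1 := by
    rw [← ofReal_integral_eq_lintegral_ofReal hki (ae_of_all _ hk0), hk1, ENNReal.ofReal_one]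
  have e1 : (∫ y, k y • V y) - w = ∫ y, k y • (V y - w) := by
    simp only [smul_sub]
    rw [integral_sub hi (hki.smul_const w), integral_smul_const, hk1, one_smul]
  have hkm : AEMeasurable fun y => ENNReal.ofReal (k y) := hk.measurable.ennreal_ofReal.aemeasurable
  rw [e1]
  have h1 : ‖∫ y, k y • (V y - w)‖ₑ ≤ ∫⁻ y, ENNReal.ofReal (k y) ^ (1 / 2 : ℝ) *
      (ENNReal.ofReal (k y) ^ (1 / 2 : ℝ) * ‖V y - w‖ₑ) := by
    refine (enorm_integral_le_lintegral_enorm _).trans (lintegral_mono fun y => ?_)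
    rw [enorm_smul, Real.enorm_eq_ofReal (hk0 y), ← mul_assoc,
      ← ENNReal.rpow_add_of_nonneg _ _ (by norm_num) (by norm_num)]
    norm_num
  have h2 := ENNReal.lintegral_mul_le_Lp_mul_Lq volume (Real.HolderConjugate.two_two)
    (hkm.pow_const (1 / 2 : ℝ)) ((hkm.pow_const (1 / 2 : ℝ)).mul hm)
  simp only [Pi.mul_apply] at h2
  have h3 := h1.trans h2
  have e2 : ∀ a : ENNReal, (a ^ (1 / 2 : ℝ)) ^ (2 : ℝ) = a := fun a => by
    rw [← ENNReal.rpow_mul]; norm_num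
  simp only [e2, ENNReal.mul_rpow_of_nonneg _ _ (zero_le_two : (0 : ℝ) ≤ 2), hk2,
    ENNReal.one_rpow, one_mul] at h3
  calc ‖∫ y, k y • (V y - w)‖ₑ ^ 2 ≤ ((∫⁻ y, ENNReal.ofReal (k y) * ‖V y - w‖ₑ ^ (2 : ℝ)) ^
        (1 / 2 : ℝ)) ^ 2 := by gcongr
    _ = ∫⁻ y, ENNReal.ofReal (k y) * ‖V y - w‖ₑ ^ (2 : ℝ) := by
        rw [← ENNReal.rpow_natCast, Nat.cast_ofNat, e2]
    _ = _ := by simp only [ENNReal.rpow_two]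

/-- Mollification with any kernel supported in a small ball about the origin is close to the
identity in `L²`. The kernel need not be centred, so that it may look into `Ω` only. -/
theorem exists_radius_mollify [MeasurableSpace F] [BorelSpace F] [SecondCountableTopology F]
    {V : E3 → F} (hV : MemLp V 2 volume)
    (hVm : Measurable V) {η : ENNReal} (hη : 0 < η) :
    ∃ r : ℝ, 0 < r ∧ ∀ k : E3 → ℝ, Continuous k → HasCompactSupport k → (∀ y, 0 ≤ k y) →
      ∫ y, k y = 1 → (∀ y, r ≤ ‖y‖ → k y = 0) →
      ∫⁻ x, ‖(∫ y, k y • V (x - y)) - V x‖ₑ ^ 2 ≤ η := by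
  have h0 : Tendsto (fun y => eLpNorm (fun x => V (x - y) - V x) 2 volume ^ 2) (𝓝 0) (𝓝 0) := by
    simpa using ENNReal.Tendsto.pow (n := 2) (tendsto_translate hV)
  obtain ⟨r, hr, hr2⟩ := Metric.eventually_nhds_iff.1 (h0.eventually (ge_mem_nhds hη))
  refine ⟨r, hr, fun k hk hkc hk0 hk1 hkr => ?_⟩
  have hki : Integrable k := hk.integrable_of_hasCompactSupport hkc
  have hk2 : ∫⁻ y, ENNReal.ofReal (k y) = 1 := by
    rw [← ofReal_integral_eq_lintegral_ofReal hki (ae_of_all _ hk0), hk1, ENNReal.ofReal_one]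
  have hm : Measurable fun p : E3 × E3 => V (p.1 - p.2) - V p.1 :=
    (hVm.comp (by fun_prop)).sub (hVm.comp measurable_fst)
  have hmF : Measurable fun p : E3 × E3 => ENNReal.ofReal (k p.2) * ‖V (p.1 - p.2) - V p.1‖ₑ ^ 2 :=
    ((hk.measurable.comp measurable_snd).ennreal_ofReal).mul (hm.enorm.pow_const 2)
  have e2 : ∀ y, eLpNorm (fun x => V (x - y) - V x) 2 volume ^ 2 =
      ∫⁻ x, ‖V (x - y) - V x‖ₑ ^ 2 := by
    intro y
    rw [eLpNorm_eq_lintegral_rpow_enorm_toReal (by norm_num) (by norm_num), ← ENNReal.rpow_natCast,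
      ← ENNReal.rpow_mul]
    norm_num
  calc ∫⁻ x, ‖(∫ y, k y • V (x - y)) - V x‖ₑ ^ 2
      ≤ ∫⁻ x, ∫⁻ y, ENNReal.ofReal (k y) * ‖V (x - y) - V x‖ₑ ^ 2 := by
        refine lintegral_mono fun x => ?_
        have hVx : MemLp (fun y => V (x - y)) 2 volume :=
          hV.comp_measurePreserving (Measure.measurePreserving_sub_left volume x)
        have hmx : Measurable fun y => V (x - y) := hVm.comp (by fun_prop)
        refine enorm_sq_convolution_le hk hk0 hk1 (V x) ?_ ?_
        · exact memLp_one_iff_integrable.1 (hVx.smul (p := 2) (q := 2)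
            (hk.memLp_of_hasCompactSupport hkc))
        · exact (hmx.sub_const _).enorm.aemeasurable
    _ = ∫⁻ y, ∫⁻ x, ENNReal.ofReal (k y) * ‖V (x - y) - V x‖ₑ ^ 2 :=
        lintegral_lintegral_swap hmF.aemeasurable
    _ ≤ ∫⁻ y, ENNReal.ofReal (k y) * η := by
        refine lintegral_mono fun y => ?_
        rw [lintegral_const_mul' _ _ ENNReal.ofReal_ne_top, ← e2]
        by_cases hy : ‖y‖ < r
        · gcongr
          exact hr2 (by rwa [dist_zero_right])
        · rw [hkr y (not_lt.1 hy)]; simp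
    _ = η := by rw [lintegral_mul_const _ hk.measurable.ennreal_ofReal, hk2, one_mul]

end Mollification

/-! ### Density of smooth functions in `H¹(Ω)` -/

/-- The subspace of `H¹(Ω)` of restrictions of smooth functions with compact support. -/
def smoothSubspace (Ω : Set E3) : Submodule ℝ (H1 Ω) where
  carrier := {u | ∃ φ : E3 → ℝ, ContDiff ℝ ∞ φ ∧ HasCompactSupport φ ∧
    fn u =ᵐ[volume.restrict Ω] φ}
  zero_mem' := ⟨0, contDiff_const, HasCompactSupport.zero, Lp.coeFn_zero _ _ _⟩
  add_mem' := by
    rintro u v ⟨φ, h1, h2, h3⟩ ⟨ψ, h4, h5, h6⟩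
    exact ⟨φ + ψ, h1.add h4, h2.add h5, (Lp.coeFn_add (toL2 Ω u) (toL2 Ω v)).trans (h3.add h6)⟩
  smul_mem' := by
    rintro c u ⟨φ, h1, h2, h3⟩
    exact ⟨c • φ, h1.const_smul c, h2.smul_left (f := fun _ => c),
      (Lp.coeFn_smul c (toL2 Ω u)).trans (h3.const_smul c)⟩

theorem mem_smoothSubspace {Ω : Set E3} {u : H1 Ω} : u ∈ smoothSubspace Ω ↔
    ∃ φ : E3 → ℝ, ContDiff ℝ ∞ φ ∧ HasCompactSupport φ ∧ fn u =ᵐ[volume.restrict Ω] φ := Iff.rfl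

theorem ofSmooth_mem {Ω : Set E3} {φ : E3 → ℝ} (h1 : ContDiff ℝ ∞ φ) (h2 : HasCompactSupport φ) :
    ofSmooth Ω φ h1 h2 ∈ smoothSubspace Ω := by
  rw [mem_smoothSubspace]
  exact ⟨φ, h1, h2, fn_ofSmooth h1 h2⟩

/-- A set `S` can be pushed a little into `Ω`: there are arbitrarily small translations `b`, and
radii `s`, such that for `x ∈ Ω` the closed ball of radius `s` about `x + b` lies in `Ω` whenever
it meets `S`. -/
def HasInwardShift (Ω S : Set E3) : Prop :=
  ∀ r : ℝ, 0 < r → ∃ (b : E3) (s : ℝ), 0 < s ∧ ‖b‖ + s < r ∧ ∀ x ∈ Ω,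
    (Metric.closedBall (x + b) s ∩ S).Nonempty → Metric.closedBall (x + b) s ⊆ Ω

/-- In the interior no translation is needed. -/
theorem hasInwardShift_of_subset {Ω S : Set E3} (ho : IsOpen Ω) (hS : IsCompact S) (h : S ⊆ Ω) :
    HasInwardShift Ω S := by
  intro r hr
  obtain ⟨δ, hδ, hδ2⟩ := hS.exists_cthickening_subset_open ho h
  refine ⟨0, min (r / 2) (δ / 2), by positivity, ?_, ?_⟩
  · rw [norm_zero, zero_add]
    exact (min_le_left _ _).trans_lt (by linarith)
  · rintro x hx ⟨z, hz1, hz2⟩ y hy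
    apply hδ2
    refine Metric.mem_cthickening_of_dist_le y z δ S hz2 ?_
    rw [Metric.mem_closedBall] at hz1 hy
    have := dist_triangle_right y z (x + 0)
    have := min_le_right (r / 2) (δ / 2)
    linarith

/-- In a flat chart, the shift is a small multiple of the inner normal. -/
theorem IsFlatChart.hasInwardShift {Ω : Set E3} {x₀ e : E3} {R : ℝ} {τ : E3 → ℝ}
    (h : IsFlatChart Ω (1 / 4) x₀ e R τ) {S : Set E3} (hS : S ⊆ Metric.ball x₀ (R / 2)) :
    HasInwardShift Ω S := by
  intro r hr
  have hR := h.pos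
  obtain ⟨t, ht, ht1, ht2⟩ : ∃ t : ℝ, 0 < t ∧ 2 * t < r ∧ 8 * t < R :=
    ⟨min (r / 4) (R / 16), by positivity, by linarith [min_le_left (r / 4) (R / 16)],
      by linarith [min_le_right (r / 4) (R / 16)]⟩
  have hte : ‖t • e‖ = t := by rw [norm_smul, h.norm_e, mul_one, Real.norm_eq_abs, abs_of_pos ht]
  refine ⟨t • e, t / 4, by positivity, by rw [hte]; linarith, ?_⟩
  rintro x hx ⟨z, hz1, hz2⟩ y hy
  have hz3 := Metric.mem_ball.1 (hS hz2)
  rw [Metric.mem_closedBall] at hz1 hy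
  have hxt : dist x (x + t • e) = t := by rw [dist_eq_norm, sub_add_cancel_left, norm_neg, hte]
  have hxb : x ∈ Metric.ball x₀ R := by
    rw [Metric.mem_ball]
    have h1 := dist_triangle x (x + t • e) z
    have h2 := dist_triangle x z x₀
    rw [dist_comm (x + t • e) z] at h1
    linarith
  have hyb : y ∈ Metric.ball x₀ R := by
    rw [Metric.mem_ball]
    have h1 := dist_triangle_right y z (x + t • e)
    have h2 := dist_triangle y z x₀
    linarith
  rw [h.mem_iff y hyb]
  have h0 := (h.mem_iff x hxb).1 hx
  have h1 := h.le_sub hyb hxb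
  have e1 : y - x = t • e + (y - (x + t • e)) := by abel
  rw [dist_eq_norm] at hy
  have h2 : ‖y - x‖ ≤ t + t / 4 := by
    rw [e1]
    refine (norm_add_le _ _).trans ?_
    rw [hte]
    linarith
  have h3 : t - t / 4 ≤ inner ℝ e (y - x) := by
    rw [e1, inner_add_right, inner_smul_right, real_inner_self_eq_norm_sq, h.norm_e]
    have := (abs_le.1 (abs_real_inner_le_norm e (y - (x + t • e)))).1
    rw [h.norm_e] at this
    linarith
  linarith

variable {Ω : Set E3}

theorem enorm_sq_Lp {α F : Type*} [MeasurableSpace α] [NormedAddCommGroup F] {μ : Measure α}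
    (v : Lp F 2 μ) : ‖v‖ₑ ^ 2 = ∫⁻ x, ‖v x‖ₑ ^ 2 ∂μ := by
  rw [Lp.enorm_def, eLpNorm_eq_lintegral_rpow_enorm_toReal (by norm_num) (by norm_num),
    ← ENNReal.rpow_natCast, ← ENNReal.rpow_mul]
  norm_num

/-- Mollification commutes with the weak gradient at the points whose relevant neighbourhood lies
in `Ω` or misses the support `S`. -/
theorem gradient_convolution {Ω S : Set E3} (ho : IsOpen Ω) {V : E3 → ℝ} {P : E3 → E3}
    (hV2 : MemLp V 2 volume) (hP2 : MemLp P 2 volume) (hVP : IsWeakGradient Ω V P)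
    (hVΩ : ∀ x ∉ Ω, V x = 0) (hPΩ : ∀ x ∉ Ω, P x = 0)
    (hV0 : ∀ᵐ x : E3, x ∉ S → V x = 0) (hP0 : ∀ᵐ x : E3, x ∉ S → P x = 0)
    {k : E3 → ℝ} (hkc : ContDiff ℝ ∞ k) (hks : HasCompactSupport k) {b : E3} {s : ℝ}
    (hts : tsupport k ⊆ Metric.closedBall (-b) s) {x : E3}
    (hshift : (Metric.closedBall (x + b) s ∩ S).Nonempty → Metric.closedBall (x + b) s ⊆ Ω) :
    ∇ (convolution V k (ContinuousLinearMap.mul ℝ ℝ) volume) x = ∫ y, k y • P (x - y) := by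
  have hΩm := ho.measurableSet
  have hVl : LocallyIntegrable V volume := hV2.locallyIntegrable (by simp)
  have hWd : ∀ c, fderiv ℝ (convolution V k (ContinuousLinearMap.mul ℝ ℝ) volume) x c =
      ∫ z, V z * fderiv ℝ k (x - z) c := by
    intro c
    have h1 := hks.hasFDerivAt_convolution_right (ContinuousLinearMap.mul ℝ ℝ) hVl
      (hkc.of_le (by simp)) x
    rw [h1.fderiv, convolution_precompR_apply _ hVl (hks.fderiv ℝ)
      (hkc.continuous_fderiv (by simp))]
    rfl
  have hPx : MemLp (fun y => P (x - y)) 2 volume :=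
    hP2.comp_measurePreserving (Measure.measurePreserving_sub_left volume x)
  have hkP : Integrable fun y => k y • P (x - y) := memLp_one_iff_integrable.1
    (hPx.smul (p := 2) (q := 2) (hkc.continuous.memLp_of_hasCompactSupport hks))
  refine ext_inner_left ℝ fun c => ?_
  rw [← fderiv_eq_inner_gradient, hWd, ← integral_inner hkP,
    ← integral_sub_left_eq_self (fun y => inner ℝ c (k y • P (x - y))) volume x]
  simp only [sub_sub_cancel, inner_smul_right]
  have hkz : ∀ z, z ∉ Metric.closedBall (x + b) s → k (x - z) = 0 ∧ fderiv ℝ k (x - z) = 0 := by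
    intro z hz
    have : x - z ∉ tsupport k := by
      intro h
      have := hts h
      rw [Metric.mem_closedBall, dist_eq_norm] at this
      rw [Metric.mem_closedBall, dist_eq_norm, norm_sub_rev] at hz
      rw [show x - z - -b = x + b - z by abel] at this
      exact hz this
    exact ⟨image_eq_zero_of_notMem_tsupport this, image_eq_zero_of_notMem_tsupport
      fun h => this (tsupport_fderiv_subset ℝ h)⟩
  by_cases hne : (Metric.closedBall (x + b) s ∩ S).Nonempty
  · have hsub := hshift hne
    have hψ : ContDiff ℝ ∞ fun z => k (x - z) := hkc.comp (contDiff_const.sub contDiff_id)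
    have hψt : tsupport (fun z => k (x - z)) ⊆ Metric.closedBall (x + b) s := by
      refine closure_minimal (fun z hz => ?_) Metric.isClosed_closedBall
      by_contra h
      exact hz (hkz z h).1
    have hψs : HasCompactSupport fun z => k (x - z) :=
      (isCompact_closedBall _ _).of_isClosed_subset (isClosed_tsupport _) hψt
    have hder : ∀ z, fderiv ℝ (fun z => k (x - z)) z c = -fderiv ℝ k (x - z) c := by
      intro z
      have h1 : HasFDerivAt (fun z : E3 => x - z) (-ContinuousLinearMap.id ℝ E3) z := by
        simpa using (hasFDerivAt_id z).const_sub x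
      have h2 := ((hkc.differentiable (by simp) (x - z)).hasFDerivAt).comp z h1
      have h3 : HasFDerivAt (fun z => k (x - z)) _ z := h2
      rw [h3.fderiv]
      simp
    have key := (isWeakGradient_iff (hV2.restrict Ω) (hP2.restrict Ω)).1 hVP (fun z => k (x - z))
      hψ hψs (hψt.trans hsub) c
    simp only [hder, mul_neg] at key
    rw [setIntegral_eq_integral_of_forall_compl_eq_zero,
      setIntegral_eq_integral_of_forall_compl_eq_zero, integral_neg, neg_inj] at key
    · exact key
    · intro z hz
      rw [hPΩ z hz]; simp
    · intro z hz
      rw [hVΩ z hz]; simp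
  · have hout : ∀ z ∈ Metric.closedBall (x + b) s, z ∉ S := fun z hz hzS => hne ⟨z, hz, hzS⟩
    rw [integral_eq_zero_of_ae, integral_eq_zero_of_ae]
    · filter_upwards [hP0] with z hz
      by_cases hzb : z ∈ Metric.closedBall (x + b) s
      · rw [hz (hout z hzb)]; simp
      · rw [(hkz z hzb).1]; simp
    · filter_upwards [hV0] with z hz
      by_cases hzb : z ∈ Metric.closedBall (x + b) s
      · rw [hz (hout z hzb)]; simp
      · rw [(hkz z hzb).2]; simp

theorem enorm_sq_of_norm_sq {A B C : Type*} [SeminormedAddCommGroup A] [SeminormedAddCommGroup B]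
    [SeminormedAddCommGroup C] {x : A} {y : B} {z : C} (h : ‖x‖ ^ 2 = ‖y‖ ^ 2 + ‖z‖ ^ 2) :
    ‖x‖ₑ ^ 2 = ‖y‖ₑ ^ 2 + ‖z‖ₑ ^ 2 := by
  rw [← ofReal_norm, ← ofReal_norm, ← ofReal_norm, ← ENNReal.ofReal_pow (norm_nonneg _), h,
    ENNReal.ofReal_add (by positivity) (by positivity),
    ENNReal.ofReal_pow (norm_nonneg _), ENNReal.ofReal_pow (norm_nonneg _)]

theorem fn_add (u v : H1 Ω) : fn (u + v) =ᵐ[volume.restrict Ω] fun x => fn u x + fn v x :=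
  Lp.coeFn_add (toL2 Ω u) (toL2 Ω v)

theorem fn_sub (u v : H1 Ω) : fn (u - v) =ᵐ[volume.restrict Ω] fun x => fn u x - fn v x :=
  Lp.coeFn_sub (toL2 Ω u) (toL2 Ω v)

theorem fn_smul (c : ℝ) (u : H1 Ω) : fn (c • u) =ᵐ[volume.restrict Ω] fun x => c * fn u x :=
  Lp.coeFn_smul c (toL2 Ω u)

theorem grad_sub (u v : H1 Ω) :
    grad (u - v) =ᵐ[volume.restrict Ω] fun x => grad u x - grad v x :=
  Lp.coeFn_sub (gradL2 Ω u) (gradL2 Ω v)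

theorem enorm_sq_H1 (u : H1 Ω) :
    ‖u‖ₑ ^ 2 = (∫⁻ x in Ω, ‖fn u x‖ₑ ^ 2) + ∫⁻ x in Ω, ‖grad u x‖ₑ ^ 2 :=
  (enorm_sq_of_norm_sq (norm_sq_eq u)).trans
    (congrArg₂ (· + ·) (enorm_sq_Lp (toL2 Ω u)) (enorm_sq_Lp (gradL2 Ω u)))

theorem mem_topologicalClosure_of_close {H : Type*} [SeminormedAddCommGroup H] [NormedSpace ℝ H]
    {S : Submodule ℝ H} {u : H} (h : ∀ η : ENNReal, 0 < η → ∃ w ∈ S, ‖w - u‖ₑ ^ 2 ≤ η + η) :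
    u ∈ S.topologicalClosure := by
  rw [← SetLike.mem_coe, Submodule.topologicalClosure_coe, EMetric.mem_closure_iff]
  intro η hη
  obtain ⟨η', hη', hηη⟩ : ∃ η' : ENNReal, 0 < η' ∧ η' + η' < η ^ 2 := by
    obtain ⟨q, hq1, hq2⟩ := ENNReal.lt_iff_exists_nnreal_btwn.1 (ENNReal.pow_pos hη 2)
    refine ⟨q / 2, ENNReal.div_pos hq1.ne' (by simp), ?_⟩
    rwa [ENNReal.add_halves]
  obtain ⟨w, hw, hwu⟩ := h η' hη'
  refine ⟨w, hw, ?_⟩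
  rw [edist_comm, edist_eq_enorm_sub]
  exact lt_of_pow_lt_pow_left' 2 (hwu.trans_lt hηη)

theorem dense_of_forall_mem {H : Type*} [SeminormedAddCommGroup H] [NormedSpace ℝ H]
    {S : Submodule ℝ H} (h : ∀ u, u ∈ S.topologicalClosure) : Dense (S : Set H) := by
  rw [Submodule.dense_iff_topologicalClosure_eq_top, eq_top_iff]
  exact fun u _ => h u

theorem enorm_sq_ofSmooth_sub {Ω : Set E3} {W : E3 → ℝ} (h1 : ContDiff ℝ ∞ W)
    (h2 : HasCompactSupport W) (u : H1 Ω) :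
    ‖ofSmooth Ω W h1 h2 - u‖ₑ ^ 2 =
      (∫⁻ x in Ω, ‖W x - fn u x‖ₑ ^ 2) + ∫⁻ x in Ω, ‖∇ W x - grad u x‖ₑ ^ 2 := by
  refine (enorm_sq_H1 _).trans (congrArg₂ (· + ·) ?_ ?_)
  · apply lintegral_congr_ae
    filter_upwards [fn_sub (ofSmooth Ω W h1 h2) u, fn_ofSmooth (Ω := Ω) h1 h2] with x h3 h4
    rw [h3, h4]
  · apply lintegral_congr_ae
    filter_upwards [grad_sub (ofSmooth Ω W h1 h2) u, grad_ofSmooth (Ω := Ω) h1 h2] with x h3 h4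
    rw [h3, h4]

/-- A function of class `H¹` that lives on a set with an inward shift is approximated by
mollification with a kernel that looks in the direction of the shift. So no extension of the
function across the boundary is needed: its weak gradient is used in `Ω` only. -/
theorem exists_smooth_close {Ω : Set E3} (ho : IsOpen Ω) (hb : Bornology.IsBounded Ω)
    {S : Set E3} (hS : HasInwardShift Ω S) {V : E3 → ℝ} {P : E3 → E3} (hVm : Measurable V)
    (hPm : Measurable P)
    (hV2 : MemLp V 2 volume) (hP2 : MemLp P 2 volume) (hVP : IsWeakGradient Ω V P)
    (hVΩ : ∀ x ∉ Ω, V x = 0) (hPΩ : ∀ x ∉ Ω, P x = 0)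
    (hV0 : ∀ᵐ x : E3, x ∉ S → V x = 0) (hP0 : ∀ᵐ x : E3, x ∉ S → P x = 0)
    {η : ENNReal} (hη : 0 < η) :
    ∃ W : E3 → ℝ, ContDiff ℝ ∞ W ∧ HasCompactSupport W ∧
      ∫⁻ x in Ω, ‖W x - V x‖ₑ ^ 2 ≤ η ∧ ∫⁻ x in Ω, ‖∇ W x - P x‖ₑ ^ 2 ≤ η := by
  have hVl : LocallyIntegrable V volume := hV2.locallyIntegrable (by simp)
  have hVc : HasCompactSupport V := by
    obtain ⟨ρ, hρ⟩ := hb.subset_closedBall (0 : E3)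
    exact HasCompactSupport.intro (isCompact_closedBall (0 : E3) ρ) fun x hx =>
      hVΩ x fun h => hx (hρ h)
  obtain ⟨r₁, hr₁, hm1⟩ := exists_radius_mollify hV2 hVm hη
  obtain ⟨r₂, hr₂, hm2⟩ := exists_radius_mollify hP2 hPm hη
  obtain ⟨b, s, hs, hbs, hshift⟩ := hS (min r₁ r₂) (by positivity)
  -- the kernel is centred at `-b`, so that the mollified function at `x` only sees `x + b`
  obtain ⟨k, hkc, hks, hk0, hk1, hts⟩ : ∃ k : E3 → ℝ, ContDiff ℝ ∞ k ∧ HasCompactSupport k ∧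
      (∀ y, 0 ≤ k y) ∧ ∫ y, k y = 1 ∧ tsupport k = Metric.closedBall (-b) s := by
    let β : ContDiffBump (-b : E3) := ⟨s / 2, s, by linarith, by linarith⟩
    exact ⟨β.normed volume, β.contDiff_normed, β.hasCompactSupport_normed,
      fun y => β.nonneg_normed y, β.integral_normed, β.tsupport_normed_eq⟩
  have hkr : ∀ y, min r₁ r₂ ≤ ‖y‖ → k y = 0 := by
    intro y hy
    apply image_eq_zero_of_notMem_tsupport
    rw [hts, Metric.mem_closedBall, dist_eq_norm, sub_neg_eq_add]
    intro h
    have : ‖y‖ ≤ ‖y + b‖ + ‖b‖ := by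
      simpa using norm_sub_le (y + b) b
    linarith
  have k1 := hm1 k hkc.continuous hks hk0 hk1 fun y hy => hkr y ((min_le_left _ _).trans hy)
  have k2 := hm2 k hkc.continuous hks hk0 hk1 fun y hy => hkr y ((min_le_right _ _).trans hy)
  refine ⟨convolution V k (ContinuousLinearMap.mul ℝ ℝ) volume,
    hks.contDiff_convolution_right (n := ⊤) _ hVl hkc, HasCompactSupport.convolution _ hVc hks,
    ?_, ?_⟩
  · refine (setLIntegral_le_lintegral Ω _).trans (le_trans (le_of_eq ?_) k1)
    congr 1
    ext x
    rw [convolution_eq_swap]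
    simp [mul_comm]
  · refine le_trans (le_of_eq ?_) ((setLIntegral_le_lintegral Ω _).trans k2)
    refine setLIntegral_congr_fun ho.measurableSet fun x hx => ?_
    rw [gradient_convolution ho hV2 hP2 hVP hVΩ hPΩ hV0 hP0 hkc hks hts.subset (hshift x hx)]

theorem ae_indicator_eq_zero {F : Type*} [NormedAddCommGroup F] {Ω S : Set E3}
    (hΩm : MeasurableSet Ω) {v : E3 → F} (hv : ∀ᵐ x ∂volume.restrict Ω, x ∉ S → v x = 0) :
    ∀ᵐ x : E3, x ∉ S → Ω.indicator v x = 0 := by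
  filter_upwards [(ae_restrict_iff' hΩm).1 hv] with x hx hxS
  by_cases hxΩ : x ∈ Ω
  · rw [indicator_of_mem hxΩ, hx hxΩ hxS]
  · rw [indicator_of_notMem hxΩ]

theorem IsWeakGradient.indicator {Ω : Set E3} (hΩm : MeasurableSet Ω) {v : E3 → ℝ} {p : E3 → E3}
    (h : IsWeakGradient Ω v p) : IsWeakGradient Ω (Ω.indicator v) (Ω.indicator p) := by
  intro φ h1 h2 h3
  rw [setIntegral_congr_fun (g := fun x => v x • ∇ φ x) hΩm (fun z hz => by
        simp only [indicator_of_mem hz]),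
      setIntegral_congr_fun (f := fun x => φ x • Ω.indicator p x)
        (g := fun x => φ x • p x) hΩm (fun z hz => by
        simp only [indicator_of_mem hz])]
  exact h φ h1 h2 h3

theorem exists_ofSmooth_close {Ω : Set E3} (ho : IsOpen Ω) (hb : Bornology.IsBounded Ω)
    {S : Set E3} (hS : HasInwardShift Ω S) (u : H1 Ω)
    (hu : ∀ᵐ x ∂volume.restrict Ω, x ∉ S → fn u x = 0)
    (hp : ∀ᵐ x ∂volume.restrict Ω, x ∉ S → grad u x = 0) {η : ENNReal} (hη : 0 < η) :
    ∃ w ∈ smoothSubspace Ω, ‖w - u‖ₑ ^ 2 ≤ η + η := by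
  have hΩm := ho.measurableSet
  have m1 : Measurable (Ω.indicator (fn u)) :=
    (Lp.stronglyMeasurable (toL2 Ω u)).measurable.indicator hΩm
  have m2 : Measurable (Ω.indicator (grad u)) :=
    (Lp.stronglyMeasurable (gradL2 Ω u)).measurable.indicator hΩm
  have m3 := (memLp_indicator_iff_restrict hΩm).2 (memLp_fn u)
  have m4 := (memLp_indicator_iff_restrict hΩm).2 (memLp_grad u)
  have hVP : IsWeakGradient Ω (Ω.indicator (fn u)) (Ω.indicator (grad u)) :=
    IsWeakGradient.indicator hΩm u.2
  obtain ⟨W, h1, h2, h3, h4⟩ := exists_smooth_close ho hb hS m1 m2 m3 m4 hVP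
    (fun x hx => indicator_of_notMem hx _) (fun x hx => indicator_of_notMem hx _)
    (ae_indicator_eq_zero hΩm hu) (ae_indicator_eq_zero hΩm hp) hη
  refine ⟨ofSmooth Ω W h1 h2, ofSmooth_mem h1 h2,
    (enorm_sq_ofSmooth_sub h1 h2 u).le.trans (add_le_add ?_ ?_)⟩
  · refine le_trans (le_of_eq ?_) h3
    refine setLIntegral_congr_fun hΩm fun x hx => ?_
    simp only [indicator_of_mem hx]
  · refine le_trans (le_of_eq ?_) h4
    refine setLIntegral_congr_fun hΩm fun x hx => ?_
    simp only [indicator_of_mem hx]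

theorem mem_closure_smoothSubspace {Ω : Set E3} (ho : IsOpen Ω) (hb : Bornology.IsBounded Ω)
    {S : Set E3} (hS : HasInwardShift Ω S) (u : H1 Ω)
    (hu : ∀ᵐ x ∂volume.restrict Ω, x ∉ S → fn u x = 0)
    (hp : ∀ᵐ x ∂volume.restrict Ω, x ∉ S → grad u x = 0) :
    u ∈ (smoothSubspace Ω).topologicalClosure :=
  mem_topologicalClosure_of_close fun _ hη => exists_ofSmooth_close ho hb hS u hu hp hη

/-- Smooth partitions of unity on compact sets. -/
theorem exists_smooth_partition {K : Set E3} (hK : IsCompact K) {p : Set E3 → Prop}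
    (hp : ∀ x ∈ K, ∃ U : Set E3, IsOpen U ∧ x ∈ U ∧ p U) :
    ∃ (t : Finset K) (χ : K → E3 → ℝ), (∀ i, ContDiff ℝ ∞ (χ i) ∧ HasCompactSupport (χ i) ∧
      (∀ x, 0 ≤ χ i x) ∧ ∃ U, p U ∧ tsupport (χ i) ⊆ U) ∧ ∀ x ∈ K, ∑ i ∈ t, χ i x = 1 := by
  choose! U hUo hUx hUp using hp
  obtain ⟨f, hf⟩ := SmoothPartitionOfUnity.exists_isSubordinate (modelWithCornersSelf ℝ E3)
    hK.isClosed (fun x : K => U x ∩ Metric.ball (x : E3) 1)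
    (fun x => (hUo x x.2).inter Metric.isOpen_ball)
    (fun x hx => mem_iUnion.2 ⟨⟨x, hx⟩, hUx x hx, Metric.mem_ball_self one_pos⟩)
  have hfin := f.locallyFinite.finite_nonempty_inter_compact hK
  refine ⟨hfin.toFinset, fun i => f i, fun i => ⟨(f i).contMDiff.contDiff, ?_, f.nonneg i, U i,
    hUp i i.2, (hf i).trans inter_subset_left⟩, fun x hx => ?_⟩
  · exact Metric.isCompact_of_isClosed_isBounded (isClosed_tsupport _)
      (Metric.isBounded_ball.subset ((hf i).trans inter_subset_right))
  · rw [← f.sum_eq_one hx]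
    symm
    apply finsum_eq_sum_of_support_subset
    intro i hi
    rw [Finite.coe_toFinset]
    exact ⟨x, hi, hx⟩

theorem IsSmoothBoundedOpen.isCompact_closure {Ω : Set E3} (hΩ : IsSmoothBoundedOpen Ω) :
    IsCompact (closure Ω) := hΩ.isBounded.isCompact_closure

theorem fn_finsetSum {ι : Type*} (t : Finset ι) (v : ι → H1 Ω) :
    fn (∑ i ∈ t, v i) =ᵐ[volume.restrict Ω] fun x => ∑ i ∈ t, fn (v i) x := by
  have h : toL2 Ω (∑ i ∈ t, v i) = ∑ i ∈ t, toL2 Ω (v i) := map_sum (toL2 Ω) v t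
  have h2 := Lp.coeFn_fun_finsetSum t fun i => toL2 Ω (v i)
  rw [← h] at h2
  exact h2

theorem eq_sum_cutoff {Ω : Set E3} (ho : IsOpen Ω) {ι : Type*} (t : Finset ι)
    {χ : ι → E3 → ℝ} (h1 : ∀ i, ContDiff ℝ ∞ (χ i)) (h2 : ∀ i, HasCompactSupport (χ i))
    (hsum : ∀ x ∈ Ω, ∑ i ∈ t, χ i x = 1) (u : H1 Ω) : u = ∑ i ∈ t, cutoff (h1 i) (h2 i) u := by
  apply H1_ext ho
  apply Lp.ext
  have h3 : ∀ᵐ x ∂volume.restrict Ω, ∀ i ∈ t, fn (cutoff (h1 i) (h2 i) u) x = χ i x • fn u x := by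
    rw [Finset.eventually_all]
    exact fun i _ => fn_cutoff (h1 i) (h2 i) u
  filter_upwards [h3, fn_finsetSum t fun i => cutoff (h1 i) (h2 i) u,
    ae_restrict_mem ho.measurableSet] with x h4 h5 h6
  have h7 : fn u x = ∑ i ∈ t, fn (cutoff (h1 i) (h2 i) u) x := by
    rw [Finset.sum_congr rfl h4, ← Finset.sum_smul, hsum x h6, one_smul]
  exact h7.trans h5.symm

/-- A cut-off function whose support has an inward shift reduces density to `exists_smooth_close`.
-/
theorem cutoff_mem_closure {Ω : Set E3} (ho : IsOpen Ω) (hb : Bornology.IsBounded Ω) {χ : E3 → ℝ}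
    (h1 : ContDiff ℝ ∞ χ) (h2 : HasCompactSupport χ) (hS : HasInwardShift Ω (tsupport χ))
    (u : H1 Ω) : cutoff h1 h2 u ∈ (smoothSubspace Ω).topologicalClosure := by
  refine mem_closure_smoothSubspace ho hb hS _ ?_ ?_
  · filter_upwards [fn_cutoff h1 h2 u] with x hx hxS
    rw [hx, image_eq_zero_of_notMem_tsupport hxS, zero_smul]
  · filter_upwards [grad_cutoff h1 h2 u] with x hx hxS
    have : ∇ χ x = 0 := by
      rw [gradient, image_eq_zero_of_notMem_tsupport fun h => hxS (tsupport_fderiv_subset ℝ h),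
        map_zero]
    rw [hx, image_eq_zero_of_notMem_tsupport hxS, this]
    simp

/-- Every point of the closure has a neighbourhood whose compact subsets have an inward shift. -/
theorem IsSmoothBoundedOpen.exists_hasInwardShift {Ω : Set E3} (hΩ : IsSmoothBoundedOpen Ω)
    {x : E3} (hx : x ∈ closure Ω) :
    ∃ U : Set E3, IsOpen U ∧ x ∈ U ∧ ∀ S, IsCompact S → S ⊆ U → HasInwardShift Ω S := by
  by_cases hxΩ : x ∈ Ω
  · exact ⟨Ω, hΩ.isOpen, hxΩ, fun S hS hSU => hasInwardShift_of_subset hΩ.isOpen hS hSU⟩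
  · have hxf : x ∈ frontier Ω := by rw [hΩ.isOpen.frontier_eq]; exact ⟨hx, hxΩ⟩
    obtain ⟨e, R, τ, h⟩ := hΩ.exists_flatChart hxf (η := 1 / 4) (by norm_num)
    exact ⟨Metric.ball x (R / 2), Metric.isOpen_ball,
      Metric.mem_ball_self (by linarith [h.pos]), fun S _ hSU => h.hasInwardShift hSU⟩

/-- Smooth functions are dense in `H¹(Ω)`: a partition of unity reduces this to functions supported
where `Ω` has an inward shift. -/
theorem IsSmoothBoundedOpen.dense_smoothSubspace {Ω : Set E3} (hΩ : IsSmoothBoundedOpen Ω) :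
    Dense (smoothSubspace Ω : Set (H1 Ω)) := by
  obtain ⟨t, χ, hχ, hsum⟩ := exists_smooth_partition hΩ.isCompact_closure
    (p := fun U => ∀ S, IsCompact S → S ⊆ U → HasInwardShift Ω S)
    (fun x hx => hΩ.exists_hasInwardShift hx)
  refine dense_of_forall_mem fun u => ?_
  have hS : ∀ i, HasInwardShift Ω (tsupport (χ i)) := fun i =>
    let ⟨U, hU, hsub⟩ := (hχ i).2.2.2
    hU _ (hχ i).2.1 hsub
  rw [eq_sum_cutoff hΩ.isOpen t (fun i => (hχ i).1) (fun i => (hχ i).2.1)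
    (fun x hx => hsum x (subset_closure hx)) u]
  exact Submodule.sum_mem _ fun i _ =>
    cutoff_mem_closure hΩ.isOpen hΩ.isBounded (hχ i).1 (hχ i).2.1 (hS i) u

/-! ### The collar estimate in `H¹(Ω)` -/

/-- The Cauchy–Schwarz inequality. -/
theorem lintegral_enorm_mul_le {α F G : Type*} [MeasurableSpace α] [NormedAddCommGroup F]
    [NormedAddCommGroup G] {μ : Measure α} (v : Lp F 2 μ) (w : Lp G 2 μ) :
    ∫⁻ x, ‖v x‖ₑ * ‖w x‖ₑ ∂μ ≤ ‖v‖ₑ * ‖w‖ₑ := by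
  have h := ENNReal.lintegral_mul_le_Lp_mul_Lq μ Real.HolderConjugate.two_two
    (Lp.aestronglyMeasurable v).enorm (Lp.aestronglyMeasurable w).enorm
  refine h.trans (le_of_eq ?_)
  rw [Lp.enorm_def, Lp.enorm_def,
    eLpNorm_eq_lintegral_rpow_enorm_toReal (by norm_num) (by norm_num),
    eLpNorm_eq_lintegral_rpow_enorm_toReal (by norm_num) (by norm_num)]
  norm_num

section RestrictLp

variable {α : Type*} [MeasurableSpace α] {μ ν : Measure α} {c : ENNReal}

/-- Restriction `L²(μ) → L²(ν)` for a measure `ν` dominated by a multiple of `μ`. -/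
def restrictLp (hc : c ≠ ⊤) (h : ν ≤ c • μ) : Lp ℝ 2 μ →L[ℝ] Lp ℝ 2 ν :=
  LinearMap.mkContinuous
    { toFun := fun v => ((Lp.memLp v).of_measure_le_smul hc h).toLp v
      map_add' := fun v w => by
        rw [← MemLp.toLp_add]
        exact MemLp.toLp_congr _ _
          ((Measure.absolutelyContinuous_of_le_smul h).ae_le (Lp.coeFn_add v w))
      map_smul' := fun r v => by
        rw [RingHom.id_apply, ← MemLp.toLp_const_smul]
        exact MemLp.toLp_congr _ _
          ((Measure.absolutelyContinuous_of_le_smul h).ae_le (Lp.coeFn_smul r v)) }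
    (c ^ (1 / 2 : ℝ)).toReal fun v => by
      rw [LinearMap.coe_mk, AddHom.coe_mk, Lp.norm_toLp, Lp.norm_def, ← ENNReal.toReal_mul]
      refine ENNReal.toReal_mono (ENNReal.mul_ne_top
        (ENNReal.rpow_ne_top_of_nonneg (by norm_num) hc) (Lp.eLpNorm_ne_top v)) ?_
      refine (eLpNorm_mono_measure _ h).trans ?_
      refine (eLpNorm_smul_measure_of_ne_top (by norm_num) v c).le.trans ?_
      norm_num

theorem coeFn_restrictLp (hc : c ≠ ⊤) (h : ν ≤ c • μ) (v : Lp ℝ 2 μ) :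
    restrictLp hc h v =ᵐ[ν] v :=
  ((Lp.memLp v).of_measure_le_smul hc h).coeFn_toLp

end RestrictLp

variable {Ω : Set E3}

/-- The measure `ε⁻¹ χ_{ω_ε} dx` on the part of the strip in `Ω`. It is zero for `ε ≤ 0`, where
`ENNReal.ofReal ε⁻¹` vanishes. -/
def stripMeasure (Ω : Set E3) (ε : ℝ) : Measure E3 :=
  ENNReal.ofReal ε⁻¹ • volume.restrict (Ω ∩ strip Ω ε)

theorem stripMeasure_le (Ω : Set E3) (ε : ℝ) :
    stripMeasure Ω ε ≤ ENNReal.ofReal ε⁻¹ • volume.restrict Ω :=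
  smul_mono_right _ (Measure.restrict_mono inter_subset_left le_rfl)

/-- The restriction of `u ∈ H¹(Ω)` to the strip, in `L²` of the normalized measure. -/
def stripTrace (Ω : Set E3) (ε : ℝ) : H1 Ω →L[ℝ] Lp ℝ 2 (stripMeasure Ω ε) :=
  (restrictLp ENNReal.ofReal_ne_top (stripMeasure_le Ω ε)).comp (toL2 Ω)

theorem coeFn_stripTrace (ε : ℝ) (u : H1 Ω) : stripTrace Ω ε u =ᵐ[stripMeasure Ω ε] fn u :=
  coeFn_restrictLp ENNReal.ofReal_ne_top (stripMeasure_le Ω ε) (toL2 Ω u)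

theorem stripMeasure_absolutelyContinuous (Ω : Set E3) (ε : ℝ) :
    stripMeasure Ω ε ≪ volume.restrict Ω :=
  Measure.absolutelyContinuous_of_le_smul (stripMeasure_le Ω ε)

/-- The collar density is integrable with a bound that is of first order in the `L²`-norm of the
function. -/
theorem lintegral_collarDensity_le {μ : Measure E3} {φ : E3 → ℝ} {v : Lp ℝ 2 μ} {w : Lp E3 2 μ}
    (h1 : v =ᵐ[μ] φ) (h2 : w =ᵐ[μ] ∇ φ) {N : ℝ} (hv : ‖v‖ ≤ N) (hw : ‖w‖ ≤ N) :
    ∫⁻ x, collarDensity φ x ∂μ ≤ ENNReal.ofReal (2 * (‖v‖ * N)) := by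
  have e1 : ∫⁻ x, collarDensity φ x ∂μ = ∫⁻ x, (‖v x‖ₑ * ‖v x‖ₑ + ‖v x‖ₑ * ‖w x‖ₑ) ∂μ := by
    apply lintegral_congr_ae
    filter_upwards [h1, h2] with x h3 h4
    rw [collarDensity, h3, h4, ENNReal.ofReal_add (by positivity) (by positivity),
      ENNReal.ofReal_mul (abs_nonneg _), ← Real.norm_eq_abs, ofReal_norm, ofReal_norm,
      ← sq_abs, pow_two, ENNReal.ofReal_mul (abs_nonneg _), ← Real.norm_eq_abs, ofReal_norm]
  have hm : AEMeasurable (fun x => ‖v x‖ₑ * ‖v x‖ₑ) μ :=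
    (Lp.aestronglyMeasurable v).enorm.mul (Lp.aestronglyMeasurable v).enorm
  rw [e1, lintegral_add_left' hm]
  refine (add_le_add (lintegral_enorm_mul_le v v) (lintegral_enorm_mul_le v w)).trans ?_
  rw [← ofReal_norm v, ← ofReal_norm w, ← ENNReal.ofReal_mul (norm_nonneg _),
    ← ENNReal.ofReal_mul (norm_nonneg _), ← ENNReal.ofReal_add (by positivity) (by positivity)]
  apply ENNReal.ofReal_le_ofReal
  have h3 := mul_le_mul_of_nonneg_left hv (norm_nonneg v)
  have h4 := mul_le_mul_of_nonneg_left hw (norm_nonneg v)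
  linarith

theorem enorm_sq_of_ae {μ : Measure E3} {v : Lp ℝ 2 μ} {φ : E3 → ℝ} (h : v =ᵐ[μ] φ) :
    ‖v‖ₑ ^ 2 = ∫⁻ x, ENNReal.ofReal (φ x ^ 2) ∂μ := by
  rw [enorm_sq_Lp]
  apply lintegral_congr_ae
  filter_upwards [h] with x hx
  rw [hx, ← ofReal_norm, ← ENNReal.ofReal_pow (norm_nonneg _), Real.norm_eq_abs, sq_abs]

theorem le_of_dense_of_continuous {H : Type*} [TopologicalSpace H] {S : Set H} (hS : Dense S)
    {f g : H → ℝ} (hf : Continuous f) (hg : Continuous g) (h : ∀ u ∈ S, f u ≤ g u) (u : H) :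
    f u ≤ g u := by
  have : closure S ⊆ {u | f u ≤ g u} := closure_minimal h (isClosed_le hf hg)
  exact this (hS u)

theorem sq_le_of_enorm_sq_le {F : Type*} [SeminormedAddCommGroup F] {v : F} {c : ℝ} (hc : 0 ≤ c)
    (h : ‖v‖ₑ ^ 2 ≤ ENNReal.ofReal c) : ‖v‖ ^ 2 ≤ c := by
  rwa [← ofReal_norm, ← ENNReal.ofReal_pow (norm_nonneg _), ENNReal.ofReal_le_ofReal_iff hc] at h

theorem IsSmoothBoundedOpen.norm_sq_strip_le {Ω : Set E3} (hΩ : IsSmoothBoundedOpen Ω) {C ε : ℝ}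
    (hC : 0 < C) (hε : 0 < ε) {φ : E3 → ℝ} {μ : Measure E3} (hμ : μ = volume.restrict Ω)
    {v : Lp ℝ 2 μ} {w : Lp E3 2 μ} (h1 : v =ᵐ[μ] φ) (h2 : w =ᵐ[μ] ∇ φ) {N : ℝ} (hv : ‖v‖ ≤ N)
    (hw : ‖w‖ ≤ N) {z : Lp ℝ 2 (stripMeasure Ω ε)} (hz : z =ᵐ[stripMeasure Ω ε] φ)
    (h : ∫⁻ x in Ω ∩ Metric.thickening ε (frontier Ω), ENNReal.ofReal (φ x ^ 2) ≤
        ENNReal.ofReal (C * ε) * ∫⁻ x in Ω, collarDensity φ x) :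
    ‖z‖ ^ 2 ≤ 2 * C * (‖v‖ * N) := by
  have hN : 0 ≤ N := (norm_nonneg v).trans hv
  refine sq_le_of_enorm_sq_le (by positivity) ?_
  rw [enorm_sq_of_ae hz, stripMeasure, lintegral_smul_measure, hΩ.inter_strip, smul_eq_mul]
  calc ENNReal.ofReal ε⁻¹ * ∫⁻ x in Ω ∩ Metric.thickening ε (frontier Ω), ENNReal.ofReal (φ x ^ 2)
      ≤ ENNReal.ofReal ε⁻¹ * (ENNReal.ofReal (C * ε) * ENNReal.ofReal (2 * (‖v‖ * N))) := by
        refine mul_le_mul_right (h.trans (mul_le_mul_right ?_ _)) _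
        rw [← hμ]
        exact lintegral_collarDensity_le h1 h2 hv hw
    _ = ENNReal.ofReal (2 * C * (‖v‖ * N)) := by
        rw [← ENNReal.ofReal_mul (by positivity), ← ENNReal.ofReal_mul (by positivity)]
        congr 1
        field_simp

theorem grad_ae_eq_of_mem_smooth (ho : IsOpen Ω) {u : H1 Ω} {φ : E3 → ℝ} (h1 : ContDiff ℝ ∞ φ)
    (h2 : HasCompactSupport φ) (h : fn u =ᵐ[volume.restrict Ω] φ) :
    grad u =ᵐ[volume.restrict Ω] ∇ φ :=
  (eq_ofSmooth ho h1 h2 h) ▸ grad_ofSmooth h1 h2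

/-- An inequality between continuous functions on `H¹(Ω)` has to be checked on smooth functions
only. -/
theorem IsSmoothBoundedOpen.le_of_smooth (hΩ : IsSmoothBoundedOpen Ω) {f g : H1 Ω → ℝ}
    (hf : Continuous f) (hg : Continuous g)
    (h : ∀ (u : H1 Ω) (φ : E3 → ℝ), ContDiff ℝ ∞ φ → HasCompactSupport φ →
      fn u =ᵐ[volume.restrict Ω] φ → grad u =ᵐ[volume.restrict Ω] ∇ φ → f u ≤ g u) (u : H1 Ω) :
    f u ≤ g u :=
  le_of_dense_of_continuous hΩ.dense_smoothSubspace hf hg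
    (fun v hv => (mem_smoothSubspace.1 hv).elim fun φ hφ =>
      h v φ hφ.1 hφ.2.1 hφ.2.2 (grad_ae_eq_of_mem_smooth hΩ.isOpen hφ.1 hφ.2.1 hφ.2.2)) u

/-- The collar estimate: restriction to the strips is bounded uniformly in `ε`, and small in terms
of the `L²`-norm on bounded sets of `H¹(Ω)`. -/
theorem IsSmoothBoundedOpen.exists_stripTrace_bound (hΩ : IsSmoothBoundedOpen Ω) :
    ∃ C ε₀ : ℝ, 0 < C ∧ 0 < ε₀ ∧ ∀ ε ∈ Ioc 0 ε₀, ∀ u : H1 Ω,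
      ‖stripTrace Ω ε u‖ ^ 2 ≤ C * (‖toL2 Ω u‖ * ‖u‖) := by
  obtain ⟨C, ε₀, hC, hε₀, h⟩ := hΩ.exists_collar
  refine ⟨2 * C, ε₀, by positivity, hε₀, fun ε hε u => ?_⟩
  have hf : Continuous fun u : H1 Ω => ‖stripTrace Ω ε u‖ ^ 2 :=
    (stripTrace Ω ε).continuous.norm.pow 2
  have hg : Continuous fun u : H1 Ω => 2 * C * (‖toL2 Ω u‖ * ‖u‖) :=
    continuous_const.mul ((toL2 Ω).continuous.norm.mul continuous_norm)
  refine hΩ.le_of_smooth hf hg (fun v φ h1 h2 h3 h4 => ?_) u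
  exact hΩ.norm_sq_strip_le (v := toL2 Ω v) (w := gradL2 Ω v) (z := stripTrace Ω ε v) (N := ‖v‖)
    hC hε.1 rfl h3 h4 (norm_toL2_le v) (norm_gradL2_le v)
    ((coeFn_stripTrace ε v).trans ((stripMeasure_absolutelyContinuous Ω ε).ae_le h3)) (h ε hε φ h1)

/-! ### Compactness of the embedding of `H¹(Ω)` into `L²(Ω)` -/

/-- Jensen's inequality for the square. -/
theorem sq_lintegral_le {α : Type*} [MeasurableSpace α] {μ : Measure α} [IsProbabilityMeasure μ]
    {F : Type*} [NormedAddCommGroup F] {f : α → F} (hf : AEStronglyMeasurable f μ) :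
    (∫⁻ x, ‖f x‖ₑ ∂μ) ^ 2 ≤ ∫⁻ x, ‖f x‖ₑ ^ 2 ∂μ := by
  have h := eLpNorm_le_eLpNorm_of_exponent_le (p := 1) (q := 2) (by norm_num) hf
  rw [eLpNorm_one_eq_lintegral_enorm,
    eLpNorm_eq_lintegral_rpow_enorm_toReal (by norm_num) (by norm_num)] at h
  calc (∫⁻ x, ‖f x‖ₑ ∂μ) ^ 2 ≤ ((∫⁻ x, ‖f x‖ₑ ^ (2 : ENNReal).toReal ∂μ) ^
        (1 / (2 : ENNReal).toReal)) ^ 2 := by gcongr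
    _ = ∫⁻ x, ‖f x‖ₑ ^ 2 ∂μ := by
        rw [← ENNReal.rpow_natCast, ← ENNReal.rpow_mul]
        norm_num

/-- A difference quotient is the mean of the directional derivative along the segment. -/
theorem enorm_sq_sub_translate_le {φ : E3 → ℝ} (h1 : ContDiff ℝ ∞ φ) (x y : E3) :
    ‖φ (x - y) - φ x‖ₑ ^ 2 ≤
      ‖y‖ₑ ^ 2 * ∫⁻ t in Ioc (0 : ℝ) 1, ‖∇ φ (x - t • y)‖ₑ ^ 2 := by
  have hpath : Continuous fun t : ℝ => x - t • y := by fun_prop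
  have hd : ∀ t : ℝ,
      HasDerivAt (fun t : ℝ => φ (x - t • y)) (inner ℝ (-y) (∇ φ (x - t • y))) t := by
    intro t
    rw [← fderiv_eq_inner_gradient]
    have h2 : HasDerivAt (fun t : ℝ => x - t • y) (-y) t := by
      simpa using ((hasDerivAt_id t).smul_const y).const_sub x
    exact ((h1.differentiable (by simp) _).hasFDerivAt).comp_hasDerivAt t h2
  have hc : Continuous fun t : ℝ => inner ℝ (-y) (∇ φ (x - t • y)) :=
    continuous_const.inner ((continuous_gradient h1).comp hpath)
  have h3 := intervalIntegral.integral_eq_sub_of_hasDerivAt (a := 0) (b := 1)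
    (fun t _ => hd t) (hc.intervalIntegrable 0 1)
  rw [one_smul, zero_smul, sub_zero, intervalIntegral.integral_of_le zero_le_one] at h3
  have : IsProbabilityMeasure (volume.restrict (Ioc (0 : ℝ) 1)) := ⟨by simp⟩
  rw [← h3]
  have hm : AEMeasurable (fun t : ℝ => ‖∇ φ (x - t • y)‖ₑ) (volume.restrict (Ioc (0 : ℝ) 1)) :=
    ((continuous_gradient h1).comp hpath).enorm.aemeasurable
  calc ‖∫ t in Ioc (0 : ℝ) 1, inner ℝ (-y) (∇ φ (x - t • y))‖ₑ ^ 2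
      ≤ (∫⁻ t in Ioc (0 : ℝ) 1, ‖y‖ₑ * ‖∇ φ (x - t • y)‖ₑ) ^ 2 := by
        gcongr
        refine (enorm_integral_le_lintegral_enorm _).trans (lintegral_mono fun t => ?_)
        rw [← enorm_neg y, ← ofReal_norm, ← ofReal_norm, ← ofReal_norm,
          ← ENNReal.ofReal_mul (norm_nonneg _)]
        exact ENNReal.ofReal_le_ofReal (norm_inner_le_norm _ _)
    _ = ‖y‖ₑ ^ 2 * (∫⁻ t in Ioc (0 : ℝ) 1, ‖∇ φ (x - t • y)‖ₑ) ^ 2 := by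
        rw [lintegral_const_mul'' _ hm, mul_pow]
    _ ≤ _ := mul_le_mul_right
        (sq_lintegral_le ((continuous_gradient h1).comp hpath).aestronglyMeasurable) _

/-- Translations by vectors shorter than the distance from `A` to the boundary change a function on
`A` by at most `‖y‖ ‖∇φ‖` in `L²`. -/
theorem lintegral_enorm_sq_translate_le {Ω A : Set E3} (ho : IsOpen Ω) (hA : MeasurableSet A)
    {δ : ℝ} (h : ∀ x ∈ A, Metric.ball x δ ⊆ Ω) {φ : E3 → ℝ} (h1 : ContDiff ℝ ∞ φ) {y : E3}
    (hy : ‖y‖ < δ) :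
    ∫⁻ x in A, ‖φ (x - y) - φ x‖ₑ ^ 2 ≤ ‖y‖ₑ ^ 2 * ∫⁻ x in Ω, ‖∇ φ x‖ₑ ^ 2 := by
  have hg := continuous_gradient h1
  have hm : Measurable fun p : E3 × ℝ => ‖∇ φ (p.1 - p.2 • y)‖ₑ ^ 2 := by
    have : Continuous fun p : E3 × ℝ => ∇ φ (p.1 - p.2 • y) := hg.comp (by fun_prop)
    exact this.enorm.measurable.pow_const 2
  have hmt : Measurable fun x => ∫⁻ t in Ioc (0 : ℝ) 1, ‖∇ φ (x - t • y)‖ₑ ^ 2 :=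
    hm.lintegral_prod_right'
  calc ∫⁻ x in A, ‖φ (x - y) - φ x‖ₑ ^ 2
      ≤ ∫⁻ x in A, ‖y‖ₑ ^ 2 * ∫⁻ t in Ioc (0 : ℝ) 1, ‖∇ φ (x - t • y)‖ₑ ^ 2 :=
        lintegral_mono fun x => enorm_sq_sub_translate_le h1 x y
    _ = ‖y‖ₑ ^ 2 * ∫⁻ t in Ioc (0 : ℝ) 1, ∫⁻ x in A, ‖∇ φ (x - t • y)‖ₑ ^ 2 := by
        rw [lintegral_const_mul _ hmt, lintegral_lintegral_swap hm.aemeasurable]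
    _ ≤ ‖y‖ₑ ^ 2 * ∫⁻ _ in Ioc (0 : ℝ) 1, ∫⁻ x in Ω, ‖∇ φ x‖ₑ ^ 2 := by
        refine mul_le_mul_right (setLIntegral_mono' measurableSet_Ioc fun t ht => ?_) _
        rw [← lintegral_indicator hA, ← lintegral_indicator ho.measurableSet,
          ← lintegral_sub_right_eq_self (Ω.indicator fun x => ‖∇ φ x‖ₑ ^ 2) (t • y)]
        refine lintegral_mono fun x => ?_
        by_cases hx : x ∈ A
        · rw [indicator_of_mem hx, indicator_of_mem]
          refine h x hx ?_
          rw [Metric.mem_ball, dist_eq_norm, sub_sub_cancel_left, norm_neg, norm_smul,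
            Real.norm_eq_abs, abs_of_pos ht.1]
          nlinarith [norm_nonneg y, ht.2]
        · rw [indicator_of_notMem hx]
          exact zero_le
    _ = _ := by simp

/-- Mollification at scale `δ` changes a function by at most `δ ‖∇φ‖` in `L²`, away from the
boundary. -/
theorem lintegral_mollify_sub_le {Ω A : Set E3} (ho : IsOpen Ω) (hA : MeasurableSet A)
    {δ : ℝ} (h : ∀ x ∈ A, Metric.ball x δ ⊆ Ω) {φ : E3 → ℝ} (h1 : ContDiff ℝ ∞ φ)
    {k : E3 → ℝ} (hk : Continuous k) (hkc : HasCompactSupport k) (hk0 : ∀ y, 0 ≤ k y)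
    (hk1 : ∫ y, k y = 1) (hks : ∀ y, δ ≤ ‖y‖ → k y = 0) :
    ∫⁻ x in A, ‖(∫ y, k y • φ (x - y)) - φ x‖ₑ ^ 2 ≤
      ENNReal.ofReal δ ^ 2 * ∫⁻ x in Ω, ‖∇ φ x‖ₑ ^ 2 := by
  have hki : Integrable k := hk.integrable_of_hasCompactSupport hkc
  have hk2 : ∫⁻ y, ENNReal.ofReal (k y) = 1 := by
    rw [← ofReal_integral_eq_lintegral_ofReal hki (ae_of_all _ hk0), hk1, ENNReal.ofReal_one]
  have hc : ∀ x, Continuous fun y => φ (x - y) := fun x => h1.continuous.comp (by fun_prop)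
  have hm : Measurable fun p : E3 × E3 =>
      ENNReal.ofReal (k p.2) * ‖φ (p.1 - p.2) - φ p.1‖ₑ ^ 2 := by
    have : Continuous fun p : E3 × E3 => φ (p.1 - p.2) - φ p.1 :=
      (h1.continuous.comp (by fun_prop)).sub (h1.continuous.comp continuous_fst)
    exact ((hk.measurable.comp measurable_snd).ennreal_ofReal).mul
      (this.enorm.measurable.pow_const 2)
  calc ∫⁻ x in A, ‖(∫ y, k y • φ (x - y)) - φ x‖ₑ ^ 2
      ≤ ∫⁻ x in A, ∫⁻ y, ENNReal.ofReal (k y) * ‖φ (x - y) - φ x‖ₑ ^ 2 := by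
        refine lintegral_mono fun x => ?_
        exact enorm_sq_convolution_le hk hk0 hk1 (φ x)
          ((hk.smul (hc x)).integrable_of_hasCompactSupport hkc.smul_right)
          ((hc x).sub continuous_const).enorm.aemeasurable
    _ = ∫⁻ y, ENNReal.ofReal (k y) * ∫⁻ x in A, ‖φ (x - y) - φ x‖ₑ ^ 2 := by
        rw [lintegral_lintegral_swap hm.aemeasurable]
        refine lintegral_congr fun y => lintegral_const_mul' _ _ ENNReal.ofReal_ne_top
    _ ≤ ∫⁻ y, ENNReal.ofReal (k y) * (ENNReal.ofReal δ ^ 2 * ∫⁻ x in Ω, ‖∇ φ x‖ₑ ^ 2) := by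
        refine lintegral_mono fun y => ?_
        rcases le_or_gt δ ‖y‖ with hy | hy
        · simp [hks y hy]
        · refine mul_le_mul_right ((lintegral_enorm_sq_translate_le ho hA h h1 hy).trans
            (mul_le_mul_left ?_ _)) _
          rw [← ofReal_norm]
          gcongr
    _ = _ := by
        rw [lintegral_mul_const _ hk.measurable.ennreal_ofReal, hk2, one_mul]

theorem enorm_sq_le_two_mul (a b : ℝ) : ‖a‖ₑ ^ 2 ≤ 2 * ‖b - a‖ₑ ^ 2 + 2 * ‖b‖ₑ ^ 2 := by
  have h2 : (2 : ENNReal) = ENNReal.ofReal 2 := by simp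
  rw [← ofReal_norm, ← ofReal_norm, ← ofReal_norm, ← ENNReal.ofReal_pow (norm_nonneg _),
    ← ENNReal.ofReal_pow (norm_nonneg _), ← ENNReal.ofReal_pow (norm_nonneg _), h2,
    ← ENNReal.ofReal_mul zero_le_two, ← ENNReal.ofReal_mul zero_le_two,
    ← ENNReal.ofReal_add (by positivity) (by positivity)]
  apply ENNReal.ofReal_le_ofReal
  simp only [Real.norm_eq_abs, sq_abs]
  nlinarith [sq_nonneg (2 * b - a)]

section Mollifier

variable {Ω : Set E3} {k : E3 → ℝ}

theorem memLp_reflect (hk : Continuous k) (hkc : HasCompactSupport k) (x : E3) :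
    MemLp (fun z => k (x - z)) 2 (volume.restrict Ω) :=
  ((hk.memLp_of_hasCompactSupport hkc).comp_measurePreserving
    (Measure.measurePreserving_sub_left volume x)).restrict Ω

/-- At points whose `δ`-ball lies in `Ω`, mollification is testing with a translated kernel; this
is how weak convergence enters. -/
theorem mollify_eq_inner (hk : Continuous k) (hkc : HasCompactSupport k) {δ : ℝ}
    (hks : ∀ y, δ ≤ ‖y‖ → k y = 0) {x : E3} (hx : Metric.ball x δ ⊆ Ω)
    {φ : E3 → ℝ} {v : Lp ℝ 2 (volume.restrict Ω)} (hv : v =ᵐ[volume.restrict Ω] φ) :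
    ∫ y, k y • φ (x - y) = inner ℝ ((memLp_reflect (Ω := Ω) hk hkc x).toLp) v := by
  have e1 := integral_sub_left_eq_self (μ := volume) (fun z => k (x - z) * φ z) x
  simp only [sub_sub_cancel] at e1
  rw [inner_toLp]
  simp only [smul_eq_mul]
  rw [e1, ← setIntegral_eq_integral_of_forall_compl_eq_zero (s := Ω)]
  · apply integral_congr_ae
    filter_upwards [hv] with z hz
    rw [hz, mul_comm]
  · intro z hz
    rw [hks, zero_mul]
    by_contra h
    refine hz (hx ?_)
    rw [Metric.mem_ball, dist_comm, dist_eq_norm]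
    exact not_le.1 h

theorem norm_toLp_reflect_le (hk : Continuous k) (hkc : HasCompactSupport k) (x : E3) :
    ‖(memLp_reflect (Ω := Ω) hk hkc x).toLp‖ ≤ (eLpNorm k 2 volume).toReal := by
  rw [Lp.norm_toLp]
  refine ENNReal.toReal_mono (hk.memLp_of_hasCompactSupport hkc).2.ne ?_
  refine (eLpNorm_mono_measure _ Measure.restrict_le_self).trans (le_of_eq ?_)
  exact eLpNorm_comp_measurePreserving hk.aestronglyMeasurable
    (Measure.measurePreserving_sub_left volume x)

/-- The mollified functions of a weakly null sequence tend to zero in `L²`, away from the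
boundary. -/
theorem tendsto_lintegral_mollify {A : Set E3} (hA : MeasurableSet A) (hfin : volume A ≠ ⊤)
    (hk : Continuous k) (hkc : HasCompactSupport k) {δ : ℝ}
    (hks : ∀ y, δ ≤ ‖y‖ → k y = 0) (h : ∀ x ∈ A, Metric.ball x δ ⊆ Ω)
    {φ : ℕ → E3 → ℝ} (hφ : ∀ n, ContDiff ℝ ∞ (φ n)) {v : ℕ → Lp ℝ 2 (volume.restrict Ω)}
    (hv : ∀ n, v n =ᵐ[volume.restrict Ω] φ n) {M : ℝ} (hM : ∀ n, ‖v n‖ ≤ M)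
    (hw : ∀ ℓ : StrongDual ℝ (Lp ℝ 2 (volume.restrict Ω)), Tendsto (fun n => ℓ (v n)) atTop (𝓝 0)) :
    Tendsto (fun n => ∫⁻ x in A, ‖∫ y, k y • φ n (x - y)‖ₑ ^ 2) atTop (𝓝 0) := by
  set N := (eLpNorm k 2 volume).toReal with hN
  have hm : ∀ n, Measurable fun x => ‖∫ y, k y • φ n (x - y)‖ₑ ^ 2 := by
    intro n
    have : Continuous fun p : E3 × E3 => k p.2 • φ n (p.1 - p.2) :=
      (hk.comp continuous_snd).smul ((hφ n).continuous.comp (by fun_prop))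
    exact (this.stronglyMeasurable.integral_prod_right').measurable.enorm.pow_const 2
  have h0 : Tendsto (fun n => ∫⁻ x in A, ‖∫ y, k y • φ n (x - y)‖ₑ ^ 2) atTop
      (𝓝 (∫⁻ _ in A, 0)) := by
    refine tendsto_lintegral_of_dominated_convergence (fun _ => ENNReal.ofReal (N * M) ^ 2) hm
      (fun n => ?_) ?_ ?_
    · filter_upwards [ae_restrict_mem hA] with x hx
      rw [mollify_eq_inner hk hkc hks (h x hx) (hv n), ← ofReal_norm]
      gcongr
      refine (norm_inner_le_norm _ _).trans (mul_le_mul (norm_toLp_reflect_le hk hkc x) (hM n)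
        (norm_nonneg _) ENNReal.toReal_nonneg)
    · rw [setLIntegral_const]
      exact ENNReal.mul_ne_top (ENNReal.pow_ne_top ENNReal.ofReal_ne_top) hfin
    · filter_upwards [ae_restrict_mem hA] with x hx
      have h1 := hw (innerSL ℝ ((memLp_reflect (Ω := Ω) hk hkc x).toLp))
      have h2 : Tendsto (fun n => ∫ y, k y • φ n (x - y)) atTop (𝓝 0) :=
        h1.congr fun n => (mollify_eq_inner hk hkc hks (h x hx) (hv n)).symm
      have h3 := (ENNReal.Tendsto.pow (n := 2) h2.enorm)
      simpa using h3
  simpa using h0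

end Mollifier

/-- Rellich's theorem for a sequence of smooth functions. The collar estimate bounds the mass near
the boundary, and away from it the functions are close to their mollifications, which tend to zero.
-/
theorem IsSmoothBoundedOpen.tendsto_enorm_sq {Ω : Set E3} (hΩ : IsSmoothBoundedOpen Ω)
    {φ : ℕ → E3 → ℝ} (hφ : ∀ n, ContDiff ℝ ∞ (φ n)) {v : ℕ → Lp ℝ 2 (volume.restrict Ω)}
    (hv : ∀ n, v n =ᵐ[volume.restrict Ω] φ n) {M C ε₀ : ℝ} (hM : ∀ n, ‖v n‖ ≤ M) (hε₀ : 0 < ε₀)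
    (hgrad : ∀ n, ∫⁻ x in Ω, ‖∇ (φ n) x‖ₑ ^ 2 ≤ ENNReal.ofReal C)
    (hcol : ∀ ε ∈ Ioc 0 ε₀, ∀ n, ∫⁻ x in Ω ∩ Metric.thickening ε (frontier Ω), ‖φ n x‖ₑ ^ 2 ≤
      ENNReal.ofReal (C * ε))
    (hw : ∀ ℓ : StrongDual ℝ (Lp ℝ 2 (volume.restrict Ω)), Tendsto (fun n => ℓ (v n)) atTop (𝓝 0)) :
    Tendsto (fun n => ‖v n‖ₑ ^ 2) atTop (𝓝 0) := by
  have key : ∀ ε ∈ Ioc 0 ε₀, ∀ᶠ n in atTop, ‖v n‖ₑ ^ 2 ≤ ENNReal.ofReal (C * ε) +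
      (2 * (ENNReal.ofReal ε ^ 2 * ENNReal.ofReal C) + 2 * ENNReal.ofReal ε) := by
    intro ε hε
    -- the mollification at scale `ε` is compared with `φ n` on `A` only, where it stays in `Ω`
    set A := Ω \ Metric.thickening ε (frontier Ω) with hAdef
    have hA : MeasurableSet A := hΩ.isOpen.measurableSet.diff Metric.isOpen_thickening.measurableSet
    have hAb : ∀ x ∈ A, Metric.ball x ε ⊆ Ω := fun x hx =>
      ball_subset_of_forall_frontier hΩ.isOpen hx.1 fun p hp => by
        by_contra h
        refine hx.2 (Metric.mem_thickening_iff.2 ⟨p, hp, ?_⟩)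
        rw [dist_comm]
        exact not_le.1 h
    have hfin : volume A ≠ ⊤ :=
      ((measure_mono sdiff_subset).trans_lt hΩ.isBounded.measure_lt_top).ne
    let β : ContDiffBump (0 : E3) := ⟨ε / 2, ε, by linarith [hε.1], by linarith [hε.1]⟩
    have hkc : Continuous (β.normed volume) := (β.contDiff_normed (n := 0)).continuous
    have hks : ∀ y, ε ≤ ‖y‖ → β.normed volume y = 0 := by
      intro y hy
      by_contra h
      have h1 : y ∈ Function.support (β.normed volume) := h
      rw [β.support_normed_eq, mem_ball_zero_iff] at h1
      exact absurd h1 (not_lt.2 hy)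
    have h1 := tendsto_lintegral_mollify hA hfin hkc β.hasCompactSupport_normed hks hAb hφ hv hM hw
    filter_upwards [h1.eventually (ge_mem_nhds (ENNReal.ofReal_pos.2 hε.1))] with n hn
    have h2 := lintegral_mollify_sub_le hΩ.isOpen hA hAb (hφ n) hkc β.hasCompactSupport_normed
      (fun y => β.nonneg_normed y) β.integral_normed hks
    have e1 : ‖v n‖ₑ ^ 2 = ∫⁻ x in Ω, ‖φ n x‖ₑ ^ 2 := by
      rw [enorm_sq_Lp]
      apply lintegral_congr_ae
      filter_upwards [hv n] with x hx
      rw [hx]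
    have hm : Measurable fun x => ‖(∫ y, β.normed volume y • φ n (x - y)) - φ n x‖ₑ ^ 2 := by
      have : Continuous fun p : E3 × E3 => β.normed volume p.2 • φ n (p.1 - p.2) :=
        (hkc.comp continuous_snd).smul ((hφ n).continuous.comp (by fun_prop))
      exact ((this.stronglyMeasurable.integral_prod_right').measurable.sub
        (hφ n).continuous.measurable).enorm.pow_const 2
    rw [e1, ← lintegral_inter_add_sdiff _ Ω Metric.isOpen_thickening.measurableSet
      (B := Metric.thickening ε (frontier Ω))]
    refine add_le_add (hcol ε hε n) ?_
    calc ∫⁻ x in A, ‖φ n x‖ₑ ^ 2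
        ≤ ∫⁻ x in A, (2 * ‖(∫ y, β.normed volume y • φ n (x - y)) - φ n x‖ₑ ^ 2 +
            2 * ‖∫ y, β.normed volume y • φ n (x - y)‖ₑ ^ 2) :=
          lintegral_mono fun x => enorm_sq_le_two_mul _ _
      _ = 2 * (∫⁻ x in A, ‖(∫ y, β.normed volume y • φ n (x - y)) - φ n x‖ₑ ^ 2) +
            2 * ∫⁻ x in A, ‖∫ y, β.normed volume y • φ n (x - y)‖ₑ ^ 2 := by
          rw [lintegral_add_left (hm.const_mul 2), lintegral_const_mul' _ _ (by simp),
            lintegral_const_mul' _ _ (by simp)]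
      _ ≤ _ := add_le_add (mul_le_mul_right (h2.trans (mul_le_mul_right (hgrad n) _)) _)
          (mul_le_mul_right hn _)
  have hlim : Tendsto (fun ε : ℝ => ENNReal.ofReal (C * ε) +
      (2 * (ENNReal.ofReal ε ^ 2 * ENNReal.ofReal C) + 2 * ENNReal.ofReal ε)) (𝓝[>] 0) (𝓝 0) := by
    have h1 : Tendsto (fun ε : ℝ => ENNReal.ofReal (C * ε)) (𝓝[>] 0) (𝓝 0) := by
      have : Continuous fun ε : ℝ => ENNReal.ofReal (C * ε) :=
        ENNReal.continuous_ofReal.comp (continuous_const.mul continuous_id)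
      simpa using (this.tendsto 0).mono_left nhdsWithin_le_nhds
    have h2 : Tendsto (fun ε : ℝ => ENNReal.ofReal ε) (𝓝[>] 0) (𝓝 0) := by
      simpa using (ENNReal.continuous_ofReal.tendsto 0).mono_left nhdsWithin_le_nhds
    have h3 := ENNReal.Tendsto.pow (n := 2) h2
    have h4 := ENNReal.Tendsto.const_mul (a := 2) (ENNReal.Tendsto.mul_const (b := ENNReal.ofReal C)
      h3 (Or.inr ENNReal.ofReal_ne_top)) (Or.inr (by simp))
    have h5 := ENNReal.Tendsto.const_mul (a := 2) h2 (Or.inr (by simp))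
    simpa using h1.add (h4.add h5)
  rw [ENNReal.tendsto_nhds_zero]
  intro η hη
  obtain ⟨ε, h1, h2⟩ := ((hlim.eventually (ge_mem_nhds hη)).and
    (Ioc_mem_nhdsGT hε₀)).exists
  exact (key ε h2).mono fun n hn => hn.trans h1

section Weak

variable {H G : Type*} [NormedAddCommGroup H] [NormedSpace ℝ H] [NormedAddCommGroup G]
  [NormedSpace ℝ G]

/-- The sequence `w` converges weakly to zero. -/
def WeaklyNull (w : ℕ → H) : Prop :=
  ∀ ℓ : StrongDual ℝ H, Tendsto (fun n => ℓ (w n)) atTop (𝓝 0)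

theorem WeaklyNull.map {w : ℕ → H} (hw : WeaklyNull w) (T : H →L[ℝ] G) :
    WeaklyNull fun n => T (w n) := fun ℓ => hw (ℓ.comp T)

theorem WeaklyNull.of_sub {w d : ℕ → H} (hw : WeaklyNull w)
    (h : Tendsto (fun n => d n - w n) atTop (𝓝 0)) : WeaklyNull d := by
  intro ℓ
  have h1 := ((ℓ.continuous.tendsto 0).comp h).add (hw ℓ)
  rw [map_zero, zero_add] at h1
  refine h1.congr fun n => ?_
  rw [Function.comp_apply, map_sub, sub_add_cancel]

theorem exists_approx {H : Type*} [NormedAddCommGroup H] {S : Set H} (hS : Dense S) (w : ℕ → H) :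
    ∃ d : ℕ → H, (∀ n, d n ∈ S) ∧ Tendsto (fun n => d n - w n) atTop (𝓝 0) := by
  choose d h1 h2 using fun n : ℕ =>
    hS.exists_dist_lt (w n) (Nat.one_div_pos_of_nat (α := ℝ) (n := n))
  refine ⟨d, h1, squeeze_zero_norm (fun n => ?_) tendsto_one_div_add_atTop_nhds_zero_nat⟩
  rw [← dist_eq_norm, dist_comm]
  exact (h2 n).le

/-- For continuous linear maps, convergence along bounded weakly null sequences has to be checked
on a dense set only. -/
theorem tendsto_map_of_dense {S : Set H} (hS : Dense S) (T : H →L[ℝ] G)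
    (h : ∀ d : ℕ → H, (∀ n, d n ∈ S) → WeaklyNull d → (∃ M, ∀ n, ‖d n‖ ≤ M) →
      Tendsto (fun n => T (d n)) atTop (𝓝 0)) {w : ℕ → H} (hw : WeaklyNull w) {M : ℝ}
    (hM : ∀ n, ‖w n‖ ≤ M) : Tendsto (fun n => T (w n)) atTop (𝓝 0) := by
  obtain ⟨d, h1, h2⟩ := exists_approx hS w
  obtain ⟨B, hB⟩ := (h2.norm.bddAbove_range)
  have h3 := h d h1 (hw.of_sub h2) ⟨B + M, fun n => by
    have h4 : ‖d n - w n‖ ≤ B := hB ⟨n, rfl⟩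
    calc ‖d n‖ = ‖(d n - w n) + w n‖ := by rw [sub_add_cancel]
      _ ≤ B + M := (norm_add_le _ _).trans (add_le_add h4 (hM n))⟩
  have h4 := h3.sub ((T.continuous.tendsto 0).comp h2)
  rw [map_zero, sub_zero] at h4
  refine h4.congr fun n => ?_
  rw [Function.comp_apply, ← map_sub, sub_sub_cancel]

end Weak

theorem exists_smooth_seq {Ω : Set E3} (ho : IsOpen Ω) {d : ℕ → H1 Ω}
    (hd : ∀ n, d n ∈ smoothSubspace Ω) : ∃ φ : ℕ → E3 → ℝ, ∀ n, ContDiff ℝ ∞ (φ n) ∧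
      fn (d n) =ᵐ[volume.restrict Ω] φ n ∧ grad (d n) =ᵐ[volume.restrict Ω] ∇ (φ n) := by
  have h : ∀ n, ∃ φ : E3 → ℝ, ContDiff ℝ ∞ φ ∧
      fn (d n) =ᵐ[volume.restrict Ω] φ ∧ grad (d n) =ᵐ[volume.restrict Ω] ∇ φ := fun n =>
    (mem_smoothSubspace.1 (hd n)).elim fun φ hφ => ⟨φ, hφ.1, hφ.2.2,
      grad_ae_eq_of_mem_smooth ho hφ.1 hφ.2.1 hφ.2.2⟩
  exact ⟨fun n => (h n).choose, fun n => (h n).choose_spec⟩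

theorem lintegral_enorm_sq_le {F : Type*} [NormedAddCommGroup F] {μ : Measure E3} {w : Lp F 2 μ}
    {ψ : E3 → F} (h : w =ᵐ[μ] ψ) {M : ℝ} (hM : ‖w‖ ≤ M) :
    ∫⁻ x, ‖ψ x‖ₑ ^ 2 ∂μ ≤ ENNReal.ofReal (M ^ 2) := by
  have e : ∫⁻ x, ‖ψ x‖ₑ ^ 2 ∂μ = ‖w‖ₑ ^ 2 := by
    rw [enorm_sq_Lp]
    apply lintegral_congr_ae
    filter_upwards [h] with x hx
    rw [hx]
  rw [e, ← ofReal_norm, ← ENNReal.ofReal_pow (norm_nonneg _)]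
  gcongr

theorem tendsto_zero_of_enorm_sq {F : Type*} [NormedAddCommGroup F] {v : ℕ → F}
    (h : Tendsto (fun n => ‖v n‖ₑ ^ 2) atTop (𝓝 0)) : Tendsto v atTop (𝓝 0) := by
  have h1 := (ENNReal.continuous_rpow_const (y := 1 / 2)).tendsto 0 |>.comp h
  rw [ENNReal.zero_rpow_of_pos (by norm_num)] at h1
  rw [tendsto_zero_iff_enorm_tendsto_zero]
  refine h1.congr fun n => ?_
  rw [Function.comp_apply, ← ENNReal.rpow_natCast, ← ENNReal.rpow_mul]
  norm_num

theorem IsSmoothBoundedOpen.tendsto_toL2_smooth {Ω : Set E3} (hΩ : IsSmoothBoundedOpen Ω)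
    {d : ℕ → H1 Ω} (hd : ∀ n, d n ∈ smoothSubspace Ω) (hw : WeaklyNull d) {M : ℝ}
    (hM : ∀ n, ‖d n‖ ≤ M) : Tendsto (fun n => toL2 Ω (d n)) atTop (𝓝 0) := by
  obtain ⟨φ, hφ⟩ := exists_smooth_seq hΩ.isOpen hd
  obtain ⟨C, ε₀, hC, hε₀, hcol⟩ := hΩ.exists_collar
  have hv : ∀ n, ‖toL2 Ω (d n)‖ ≤ M := fun n => (norm_toL2_le (d n)).trans (hM n)
  have hg : ∀ n, ‖gradL2 Ω (d n)‖ ≤ M := fun n => (norm_gradL2_le (d n)).trans (hM n)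
  have hM0 : 0 ≤ M := (norm_nonneg (toL2 Ω (d 0))).trans (hv 0)
  refine tendsto_zero_of_enorm_sq (hΩ.tendsto_enorm_sq (fun n => (hφ n).1) (fun n => (hφ n).2.1) hv
    (C := (2 * C + 1) * M ^ 2) hε₀ (fun n => ?_) (fun ε hε n => ?_) (hw.map (toL2 Ω)))
  · refine (lintegral_enorm_sq_le (hφ n).2.2 (hg n)).trans (ENNReal.ofReal_le_ofReal ?_)
    nlinarith [mul_nonneg hC.le (sq_nonneg M)]
  · have h1 := lintegral_collarDensity_le (v := toL2 Ω (d n)) (hφ n).2.1 (hφ n).2.2 (hv n) (hg n)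
    have h2 : ∀ x, ‖φ n x‖ₑ ^ 2 = ENNReal.ofReal (φ n x ^ 2) := fun x => by
      rw [← ofReal_norm, ← ENNReal.ofReal_pow (norm_nonneg _), Real.norm_eq_abs, sq_abs]
    simp only [h2]
    refine (hcol ε hε (φ n) (hφ n).1).trans ((mul_le_mul_right h1 _).trans ?_)
    have h3 : 0 < C * ε := mul_pos hC hε.1
    rw [← ENNReal.ofReal_mul h3.le]
    apply ENNReal.ofReal_le_ofReal
    have h4 : ‖toL2 Ω (d n)‖ * M ≤ M ^ 2 := by nlinarith [hv n]
    nlinarith [mul_le_mul_of_nonneg_left h4 h3.le, mul_nonneg (sq_nonneg M) hε.1.le]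

/-- Rellich's theorem: weakly convergent sequences in `H¹(Ω)` converge in `L²(Ω)`. -/
theorem IsSmoothBoundedOpen.tendsto_toL2 {Ω : Set E3} (hΩ : IsSmoothBoundedOpen Ω)
    {w : ℕ → H1 Ω} (hw : WeaklyNull w) {M : ℝ} (hM : ∀ n, ‖w n‖ ≤ M) :
    Tendsto (fun n => toL2 Ω (w n)) atTop (𝓝 0) :=
  tendsto_map_of_dense hΩ.dense_smoothSubspace (toL2 Ω)
    (fun _ h1 h2 h3 => h3.elim fun _ hB => hΩ.tendsto_toL2_smooth h1 h2 hB) hw hM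

/-! ### The boundary as a graph -/

/-- The plane orthogonal to `e`. -/
abbrev Plane (e : E3) : Submodule ℝ E3 := (Submodule.span ℝ {e})ᗮ

/-- Cartesian coordinates with origin `x₀` and third axis `e`. -/
def cyl (x₀ e : E3) (p : Plane e × ℝ) : E3 := x₀ + (p.1 : E3) + p.2 • e

/-- The projection onto the plane through `x₀` orthogonal to `e`. -/
def proj (x₀ e : E3) (y : E3) : Plane e := (Plane e).orthogonalProjectionOnto (y - x₀)

theorem inner_plane {e : E3} (v : Plane e) : inner ℝ e (v : E3) = 0 :=
  Submodule.mem_orthogonal_singleton_iff_inner_right.1 v.2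

theorem norm_cyl_sub_sq {x₀ e : E3} (he : ‖e‖ = 1) (p q : Plane e × ℝ) :
    ‖cyl x₀ e p - cyl x₀ e q‖ ^ 2 = ‖p.1 - q.1‖ ^ 2 + (p.2 - q.2) ^ 2 := by
  have h : cyl x₀ e p - cyl x₀ e q = ((p.1 - q.1 : Plane e) : E3) + (p.2 - q.2) • e := by
    simp only [cyl, Submodule.coe_sub]
    module
  rw [h, norm_add_sq_real, inner_smul_right, real_inner_comm, inner_plane, norm_smul, he]
  simp

theorem inner_cyl_sub {x₀ e : E3} (he : ‖e‖ = 1) (p q : Plane e × ℝ) :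
    inner ℝ e (cyl x₀ e p - cyl x₀ e q) = p.2 - q.2 := by
  have h : cyl x₀ e p - cyl x₀ e q = ((p.1 - q.1 : Plane e) : E3) + (p.2 - q.2) • e := by
    simp only [cyl, Submodule.coe_sub]
    module
  rw [h, inner_add_right, inner_plane, inner_smul_right, real_inner_self_eq_norm_sq, he]
  simp

theorem cyl_zero (x₀ e : E3) : cyl x₀ e 0 = x₀ := by simp [cyl]

theorem norm_cyl_sub_le {x₀ e : E3} (he : ‖e‖ = 1) (p q : Plane e × ℝ) :
    ‖cyl x₀ e p - cyl x₀ e q‖ ≤ ‖p.1 - q.1‖ + |p.2 - q.2| := by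
  apply le_of_sq_le_sq _ (by positivity)
  rw [norm_cyl_sub_sq he, ← sq_abs (p.2 - q.2)]
  nlinarith [norm_nonneg (p.1 - q.1), abs_nonneg (p.2 - q.2)]

theorem continuous_cyl (x₀ e : E3) : Continuous (cyl x₀ e) := by
  unfold cyl
  fun_prop

theorem proj_cyl {x₀ e : E3} (p : Plane e × ℝ) : proj x₀ e (cyl x₀ e p) = p.1 := by
  have h : cyl x₀ e p - x₀ = (p.1 : E3) + p.2 • e := by
    simp only [cyl]
    module
  rw [proj, h, map_add, Submodule.orthogonalProjectionOnto_mem_subspace_eq_self]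
  rw [Submodule.orthogonalProjectionOnto_orthogonal_apply_eq_zero, add_zero]
  exact Submodule.smul_mem _ _ (Submodule.mem_span_singleton_self e)

theorem lipschitzWith_proj (x₀ e : E3) : LipschitzWith 1 (proj x₀ e) := by
  refine LipschitzWith.of_dist_le_mul fun y z => ?_
  rw [dist_eq_norm, dist_eq_norm, proj, proj, ← map_sub, sub_sub_sub_cancel_right]
  refine ((Plane e).orthogonalProjectionOnto.le_opNorm _).trans ?_
  gcongr
  exact Submodule.orthogonalProjectionOnto_norm_le _

theorem cyl_surjective {x₀ e : E3} (he : ‖e‖ = 1) (y : E3) :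
    ∃ s : ℝ, y = cyl x₀ e (proj x₀ e y, s) ∧ |s| ≤ ‖y - x₀‖ ∧ ‖proj x₀ e y‖ ≤ ‖y - x₀‖ := by
  have h1 : ∃ s, y = cyl x₀ e (proj x₀ e y, s) := by
    refine ⟨inner ℝ e (y - x₀), ?_⟩
    have h2 := (Submodule.span ℝ {e}).starProjection_add_starProjection_orthogonal (y - x₀)
    rw [Submodule.starProjection_unit_singleton ℝ he] at h2
    rw [cyl, add_assoc, ← sub_eq_iff_eq_add']
    exact h2.symm.trans (add_comm _ _)
  obtain ⟨s, hs⟩ := h1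
  have h3 := norm_cyl_sub_sq (x₀ := x₀) he (proj x₀ e y, s) 0
  rw [← hs, cyl_zero] at h3
  simp only [Prod.fst_zero, Prod.snd_zero, sub_zero] at h3
  refine ⟨s, hs, ?_, ?_⟩
  · apply abs_le_of_sq_le_sq' _ (norm_nonneg _) |> abs_le.2
    nlinarith [sq_nonneg ‖proj x₀ e y‖]
  · apply le_of_sq_le_sq _ (norm_nonneg _)
    nlinarith [sq_nonneg s]

/-- Cylinder coordinates preserve volume, for the Euclidean volume on the plane. -/
theorem measurePreserving_cyl (x₀ : E3) {e : E3} (he : ‖e‖ = 1) :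
    MeasurePreserving (cyl x₀ e) volume volume := by
  have h1 := (Submodule.measurePreserving_measurableEquivProd (Submodule.span ℝ {e}) x₀).symm
  rw [InnerProductSpace.euclideanHausdorffMeasure_eq_volume] at h1
  have h2 : MeasurePreserving (LinearIsometryEquiv.toSpanUnitSingleton (𝕜 := ℝ) e he)
      volume volume := LinearIsometryEquiv.measurePreserving _
  have h3 : MeasurePreserving (Prod.swap : Plane e × ℝ → ℝ × Plane e) volume volume :=
    Measure.measurePreserving_swap
  have h4 := h1.comp ((h2.prod (MeasurePreserving.id (volume : Measure (Plane e)))).comp h3)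
  refine (congrArg (fun F => MeasurePreserving F volume volume) ?_).mp h4
  ext1 p
  simp [cyl]
  abel

/-- In the cylinder of radius and half height `r` about `x₀` with axis `e`, the set `Ω` is the part
above the graph of the function `h`, which has slope at most `κ - 1`, and the points of `Ω` at
distance less than `ε` from the boundary lie less than `κ ε` above the graph. -/
structure IsGraphChart (Ω : Set E3) (κ : ℝ) (x₀ e : E3) (r : ℝ) (h : Plane e → ℝ) : Prop where
  pos : 0 < r
  norm_e : ‖e‖ = 1
  lip : ∀ v w, |h v - h w| ≤ (κ - 1) * ‖v - w‖
  small : ∀ v, ‖v‖ < r → |h v| ≤ r / 2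
  mem_iff : ∀ v s, ‖v‖ < r → |s| < r → (cyl x₀ e (v, s) ∈ Ω ↔ h v < s)
  mem_frontier_iff : ∀ v s, ‖v‖ < r → |s| < r → (cyl x₀ e (v, s) ∈ frontier Ω ↔ s = h v)
  lt_of_mem : ∀ ε v s, ε < r → ‖v‖ < r → |s| < r → cyl x₀ e (v, s) ∈ Ω →
    cyl x₀ e (v, s) ∈ Metric.thickening ε (frontier Ω) → s < h v + κ * ε

/-- The zero set of the height function `τ` of a flat chart is the graph of a function: along the
axis `e`, `τ` changes sign and has slope at least `1 - η`. The slope of the graph is at most `η /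
(1 - η)`, as `τ` varies by at most `η` per unit length in the directions orthogonal to `e`. -/
theorem IsFlatChart.exists_graphChart {Ω : Set E3} (ho : IsOpen Ω) {κ η R : ℝ} {x₀ e : E3}
    {τ : E3 → ℝ} (h : IsFlatChart Ω η x₀ e R τ) (hη : 0 < η) (hη4 : η ≤ 1 / 4)
    (hκ : (1 + η) ≤ κ * (1 - η)) : ∃ (r : ℝ) (f : Plane e → ℝ), IsGraphChart Ω κ x₀ e r f := by
  have hR := h.pos
  have he := h.norm_e
  set r := R / 4 with hr
  have hκ1 : 1 < κ := by nlinarith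
  have hball : ∀ (v : Plane e) (s : ℝ), ‖v‖ < r → |s| ≤ r → cyl x₀ e (v, s) ∈ Metric.ball x₀ R := by
    intro v s hv hs
    rw [Metric.mem_ball, dist_eq_norm]
    have h1 := norm_cyl_sub_le (x₀ := x₀) he (v, s) 0
    rw [cyl_zero] at h1
    simp only [Prod.fst_zero, Prod.snd_zero, sub_zero] at h1
    linarith
  have happ : ∀ (v w : Plane e) (s t : ℝ), ‖v‖ < r → ‖w‖ < r → |s| ≤ r → |t| ≤ r →
      |τ (cyl x₀ e (v, s)) - τ (cyl x₀ e (w, t)) - (s - t)| ≤ η * (‖v - w‖ + |s - t|) := by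
    intro v w s t hv hw hs ht
    have h1 := h.approx _ (hball v s hv hs) _ (hball w t hw ht)
    rw [inner_cyl_sub he] at h1
    exact h1.trans (mul_le_mul_of_nonneg_left (norm_cyl_sub_le he _ _) hη.le)
  have hr0 : ‖(0 : Plane e)‖ < r := by rw [norm_zero]; linarith
  have h00 : τ (cyl x₀ e ((0 : Plane e), (0 : ℝ))) = 0 := by
    rw [show ((0 : Plane e), (0 : ℝ)) = 0 from rfl, cyl_zero, h.zero]
  -- existence of the zero of `τ` above `v` by the intermediate value theorem
  have hex : ∀ v : Plane e, ∃ s : ℝ, ‖v‖ < r → |s| ≤ r ∧ τ (cyl x₀ e (v, s)) = 0 := by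
    intro v
    by_cases hv : ‖v‖ < r
    · have hc : ContinuousOn (fun s : ℝ => τ (cyl x₀ e (v, s))) (Icc (-r) r) := by
        refine h.continuousOn.comp ((continuous_cyl x₀ e).comp (by fun_prop)).continuousOn ?_
        intro s hs
        exact hball v s hv (abs_le.2 hs)
      have h1 := happ v 0 (-r) 0 hv hr0 (by rw [abs_neg, abs_of_pos (by linarith)])
        (by simp; linarith)
      have h2 := happ v 0 r 0 hv hr0 (by rw [abs_of_pos (by linarith)]) (by simp; linarith)
      rw [h00] at h1 h2
      simp only [sub_zero, abs_neg, abs_of_pos (show 0 < r by linarith)] at h1 h2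
      have h3 : η * (‖v‖ + r) ≤ r / 2 := by nlinarith
      obtain ⟨s, hs, hs2⟩ := intermediate_value_Icc (by linarith) hc
        (show (0 : ℝ) ∈ Icc (τ (cyl x₀ e (v, -r))) (τ (cyl x₀ e (v, r))) from
          ⟨by linarith [(abs_le.1 h1).2], by linarith [(abs_le.1 h2).1]⟩)
      exact ⟨s, fun _ => ⟨abs_le.2 hs, hs2⟩⟩
    · exact ⟨0, fun h => absurd h hv⟩
  choose g hg using hex
  have hlip : ∀ v w : Plane e, ‖v‖ < r → ‖w‖ < r → (1 - η) * |g v - g w| ≤ η * ‖v - w‖ := by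
    intro v w hv hw
    have h1 := happ v w (g v) (g w) hv hw (hg v hv).1 (hg w hw).1
    rw [(hg v hv).2, (hg w hw).2, sub_zero, zero_sub, abs_neg] at h1
    linarith
  have hmono : ∀ v : Plane e, ‖v‖ < r → ∀ s, |s| ≤ r → ∀ t, |t| ≤ r → s ≤ t →
      (1 - η) * (t - s) ≤ τ (cyl x₀ e (v, t)) - τ (cyl x₀ e (v, s)) := by
    intro v hv s hs t ht hst
    have h1 := happ v v t s hv hv ht hs
    rw [sub_self, norm_zero, zero_add, abs_of_nonneg (by linarith : 0 ≤ t - s)] at h1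
    linarith [(abs_le.1 h1).1]
  have hpos : ∀ v : Plane e, ‖v‖ < r → ∀ s, |s| < r → (0 < τ (cyl x₀ e (v, s)) ↔ g v < s) := by
    intro v hv s hs
    constructor
    · intro h1
      by_contra! h2
      have h3 := hmono v hv s hs.le (g v) (hg v hv).1 h2
      rw [(hg v hv).2] at h3
      nlinarith
    · intro h1
      have h3 := hmono v hv (g v) (hg v hv).1 s hs.le h1.le
      rw [(hg v hv).2] at h3
      nlinarith
  have hLip : LipschitzOnWith (Real.toNNReal (κ - 1)) g (Metric.ball 0 r) := by
    apply LipschitzOnWith.of_dist_le_mul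
    intro v hv w hw
    rw [Real.coe_toNNReal _ (by linarith), Real.dist_eq, dist_eq_norm]
    have h1 := hlip v w (mem_ball_zero_iff.1 hv) (mem_ball_zero_iff.1 hw)
    have h2 : 0 ≤ ‖v - w‖ := norm_nonneg _
    have h3 : η * ‖v - w‖ ≤ (1 - η) * ((κ - 1) * ‖v - w‖) := by nlinarith
    exact le_of_mul_le_mul_left (h1.trans h3) (by linarith)
  -- the graph function is extended from the disc to a Lipschitz function on the whole plane
  obtain ⟨f, hf1, hf2⟩ := hLip.extend_real
  have hfg : ∀ v : Plane e, ‖v‖ < r → f v = g v := fun v hv => (hf2 (mem_ball_zero_iff.2 hv)).symm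
  have hg0 : g 0 = 0 := by
    have h1 := happ 0 0 (g 0) 0 hr0 hr0 (hg 0 hr0).1 (by simp; linarith)
    rw [(hg 0 hr0).2, h00] at h1
    simp only [sub_zero, zero_sub, abs_neg, norm_zero, zero_add] at h1
    have h2 := abs_nonneg (g 0)
    exact abs_eq_zero.1 (by nlinarith)
  refine ⟨r, f, by linarith, he, ?_, ?_, ?_, ?_, ?_⟩
  · intro v w
    have h1 := hf1.dist_le_mul v w
    rwa [Real.coe_toNNReal _ (by linarith), Real.dist_eq, dist_eq_norm] at h1
  · intro v hv
    have h1 := hlip v 0 hv hr0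
    rw [hg0, sub_zero, sub_zero] at h1
    rw [hfg v hv]
    have h2 := abs_nonneg (g v)
    nlinarith [norm_nonneg v]
  · intro v s hv hs
    rw [h.mem_iff _ (hball v s hv hs.le), hpos v hv s hs, hfg v hv]
  · intro v s hv hs
    rw [h.mem_frontier_iff (by linarith) ho (hball v s hv hs.le), hfg v hv]
    constructor
    · intro h1
      rcases le_total s (g v) with h2 | h2
      · have h3 := hmono v hv s hs.le (g v) (hg v hv).1 h2
        rw [(hg v hv).2, h1] at h3
        nlinarith
      · have h3 := hmono v hv (g v) (hg v hv).1 s hs.le h2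
        rw [(hg v hv).2, h1] at h3
        nlinarith
    · rintro rfl
      exact (hg v hv).2
  -- `τ ≤ (1 + η) ε` at distance `ε` from the boundary, and `τ` has slope at least `1 - η`
  · intro ε v s hε hv hs h1 h2
    obtain ⟨p, hp, hpd⟩ := Metric.mem_thickening_iff.1 h2
    have hy := hball v s hv hs.le
    have hpb : p ∈ Metric.ball x₀ R := by
      rw [Metric.mem_ball]
      have h3 := norm_cyl_sub_le (x₀ := x₀) he (v, s) 0
      rw [cyl_zero, ← dist_eq_norm] at h3
      simp only [Prod.fst_zero, Prod.snd_zero, sub_zero] at h3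
      have h4 := dist_triangle p (cyl x₀ e (v, s)) x₀
      rw [dist_comm p (cyl x₀ e (v, s))] at h4
      linarith
    have h5 := h.sub_le_norm hy hpb
    rw [(h.mem_frontier_iff (by linarith) ho hpb).1 hp, ← dist_eq_norm] at h5
    have h6 := (hpos v hv s hs).1 ((h.mem_iff _ hy).1 h1)
    have h7 := hmono v hv (g v) (hg v hv).1 s hs.le h6.le
    rw [(hg v hv).2] at h7
    rw [hfg v hv]
    have h8 : 0 ≤ dist (cyl x₀ e (v, s)) p := dist_nonneg
    have h9 : (1 - η) * (s - g v) < (1 - η) * (κ * ε) := by nlinarith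
    linarith [lt_of_mul_lt_mul_left h9 (by linarith)]

/-- Graph charts exist with `κ` arbitrarily close to `1`. Thereby the area density of the graph
never has to be computed: it is between `1` and `κ ^ 2`. -/
theorem IsSmoothBoundedOpen.exists_graphChart {Ω : Set E3} (hΩ : IsSmoothBoundedOpen Ω) {x₀ : E3}
    (hx : x₀ ∈ frontier Ω) {κ : ℝ} (hκ : 1 < κ) :
    ∃ (e : E3) (r : ℝ) (h : Plane e → ℝ), IsGraphChart Ω κ x₀ e r h := by
  -- this `η` satisfies `1 + η ≤ κ (1 - η)`
  have h0 : 0 < min (1 / 4) ((κ - 1) / (κ + 1)) :=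
    lt_min (by norm_num) (div_pos (by linarith) (by linarith))
  obtain ⟨e, R, τ, h⟩ := hΩ.exists_flatChart hx h0
  have h1 := (le_div_iff₀ (by linarith : 0 < κ + 1)).1 (min_le_right (1 / 4) ((κ - 1) / (κ + 1)))
  obtain ⟨r, f, hf⟩ := h.exists_graphChart (κ := κ) hΩ.isOpen h0 (min_le_left _ _) (by linarith)
  exact ⟨e, r, f, hf⟩

/-! ### The surface measure in a graph chart -/

theorem euclideanHausdorffMeasure_image_le {X Y : Type*} [MetricSpace X] [MetricSpace Y]
    [MeasurableSpace X] [BorelSpace X] [MeasurableSpace Y] [BorelSpace Y] {K : NNReal} {f : X → Y}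
    (hf : LipschitzWith K f) (d : ℕ) (s : Set X) :
    Measure.euclideanHausdorffMeasure d (f '' s) ≤
      (K : ENNReal) ^ d * Measure.euclideanHausdorffMeasure d s := by
  rw [Measure.euclideanHausdorffMeasure_def, Measure.euclideanHausdorffMeasure_def,
    Measure.smul_apply, Measure.smul_apply, ENNReal.smul_def, ENNReal.smul_def, smul_eq_mul,
    smul_eq_mul, mul_left_comm]
  have h := hf.hausdorffMeasure_image_le (Nat.cast_nonneg d) s
  rw [ENNReal.rpow_natCast] at h
  exact mul_le_mul_right h _

/-- The normalization of `Measure.euclideanHausdorffMeasure` is such that it is the area on planes.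
-/
theorem volume_plane {e : E3} (he : ‖e‖ = 1) :
    (Measure.euclideanHausdorffMeasure 2 : Measure (Plane e)) = volume := by
  have h : Module.finrank ℝ (Plane e) = 2 := by
    have : Fact (Module.finrank ℝ E3 = 2 + 1) := ⟨by simp⟩
    exact Submodule.finrank_orthogonal_span_singleton (n := 2) (by rintro rfl; simp at he)
  rw [← h]
  exact InnerProductSpace.euclideanHausdorffMeasure_eq_volume

namespace IsGraphChart

variable {Ω : Set E3} {κ r : ℝ} {x₀ e : E3} {h : Plane e → ℝ}

/-- `κ - 1` is a Lipschitz constant of a function on a plane that has more than one point. -/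
theorem one_le (H : IsGraphChart Ω κ x₀ e r h) : 1 ≤ κ := by
  by_contra! hκ
  obtain ⟨v, hv⟩ : ∃ v : Plane e, v ≠ 0 := by
    have h2 : Module.finrank ℝ (Plane e) = 2 := by
      have : Fact (Module.finrank ℝ E3 = 2 + 1) := ⟨by simp⟩
      exact Submodule.finrank_orthogonal_span_singleton (n := 2)
        (by rintro rfl; simpa using H.norm_e)
    have : Nontrivial (Plane e) := Module.nontrivial_of_finrank_pos (R := ℝ) (by omega)
    exact exists_ne 0
  have h1 := H.lip v 0
  have h2 : 0 < ‖v - 0‖ := by simpa using hv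
  nlinarith [abs_nonneg (h v - h 0)]

theorem lipschitz_graph (H : IsGraphChart Ω κ x₀ e r h) :
    LipschitzWith (Real.toNNReal κ) fun v => cyl x₀ e (v, h v) :=
  LipschitzWith.of_dist_le_mul fun v w => by
    rw [Real.coe_toNNReal _ (by linarith [H.one_le]), dist_eq_norm, dist_eq_norm]
    have h1 := norm_cyl_sub_le (x₀ := x₀) H.norm_e (v, h v) (w, h w)
    have h2 := H.lip v w
    simp only at h1
    linarith

theorem graph_mem (H : IsGraphChart Ω κ x₀ e r h) {v : Plane e} (hv : ‖v‖ < r) :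
    cyl x₀ e (v, h v) ∈ frontier Ω :=
  (H.mem_frontier_iff v (h v) hv (by linarith [H.small v hv, H.pos])).2 rfl

/-- The area of a part of the boundary is at least that of its projection, since projections are
`1`-Lipschitz. -/
theorem map_le (H : IsGraphChart Ω κ x₀ e r h) :
    (volume.restrict (Metric.ball (0 : Plane e) r)).map (fun v => cyl x₀ e (v, h v)) ≤
      surfaceMeasure Ω := by
  have hG : Measurable fun v => cyl x₀ e (v, h v) := H.lipschitz_graph.continuous.measurable
  refine Measure.le_iff.2 fun E hE => ?_
  rw [Measure.map_apply hG hE, Measure.restrict_apply (hG hE), surfaceMeasure,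
    Measure.restrict_apply hE, ← volume_plane H.norm_e]
  have h1 := euclideanHausdorffMeasure_image_le (lipschitzWith_proj x₀ e) 2 (E ∩ frontier Ω)
  rw [ENNReal.coe_one, one_pow, one_mul] at h1
  refine (measure_mono ?_).trans h1
  rintro v ⟨hv1, hv2⟩
  exact ⟨_, ⟨hv1, H.graph_mem (mem_ball_zero_iff.1 hv2)⟩, proj_cyl _⟩

/-- The area of a part of the boundary is at most `κ ^ 2` times that of its projection, since the
parametrization of the graph is `κ`-Lipschitz. -/
theorem restrict_le (H : IsGraphChart Ω κ x₀ e r h) :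
    (surfaceMeasure Ω).restrict (Metric.ball x₀ r) ≤ ENNReal.ofReal κ ^ 2 •
      (volume.restrict (Metric.ball (0 : Plane e) r)).map (fun v => cyl x₀ e (v, h v)) := by
  have hG : Measurable fun v => cyl x₀ e (v, h v) := H.lipschitz_graph.continuous.measurable
  refine Measure.le_iff.2 fun E hE => ?_
  rw [Measure.smul_apply, Measure.map_apply hG hE, Measure.restrict_apply (hG hE), surfaceMeasure,
    Measure.restrict_apply hE, Measure.restrict_apply (hE.inter Metric.isOpen_ball.measurableSet),
    ← volume_plane H.norm_e, smul_eq_mul]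
  refine (measure_mono ?_).trans (euclideanHausdorffMeasure_image_le H.lipschitz_graph 2 _)
  rintro y ⟨⟨hy1, hy2⟩, hy3⟩
  rw [Metric.mem_ball, dist_eq_norm] at hy2
  obtain ⟨s, hs, hs1, hs2⟩ := cyl_surjective (x₀ := x₀) H.norm_e y
  have hv : ‖proj x₀ e y‖ < r := hs2.trans_lt hy2
  have e1 : s = h (proj x₀ e y) := by
    rw [← H.mem_frontier_iff _ s hv (hs1.trans_lt hy2), ← hs]
    exact hy3
  refine ⟨proj x₀ e y, ⟨?_, mem_ball_zero_iff.2 hv⟩, ?_⟩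
  · rw [mem_preimage, ← e1, ← hs]
    exact hy1
  · simp only [← e1, ← hs]

/-- The surface measure is finite locally, and hence finite, as the boundary is compact. -/
theorem surfaceMeasure_ball_lt_top (H : IsGraphChart Ω κ x₀ e r h) :
    surfaceMeasure Ω (Metric.ball x₀ r) < ⊤ := by
  have h1 := H.restrict_le univ
  rw [Measure.restrict_apply_univ] at h1
  refine h1.trans_lt ?_
  rw [Measure.smul_apply, Measure.map_apply H.lipschitz_graph.continuous.measurable
    MeasurableSet.univ, preimage_univ, Measure.restrict_apply_univ, smul_eq_mul]
  exact ENNReal.mul_lt_top (ENNReal.pow_lt_top ENNReal.ofReal_lt_top) measure_ball_lt_top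

theorem lintegral_graph_le (H : IsGraphChart Ω κ x₀ e r h) {φ : E3 → ENNReal}
    (hφ : Measurable φ) :
    ∫⁻ v in Metric.ball (0 : Plane e) r, φ (cyl x₀ e (v, h v)) ≤ ∫⁻ y, φ y ∂surfaceMeasure Ω := by
  rw [← lintegral_map hφ H.lipschitz_graph.continuous.measurable]
  exact lintegral_mono' H.map_le le_rfl

theorem lintegral_surface_le (H : IsGraphChart Ω κ x₀ e r h) {φ : E3 → ENNReal}
    (hφ : Measurable φ) (h0 : ∀ y ∉ Metric.ball x₀ r, φ y = 0) :
    ∫⁻ y, φ y ∂surfaceMeasure Ω ≤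
      ENNReal.ofReal κ ^ 2 * ∫⁻ v in Metric.ball (0 : Plane e) r, φ (cyl x₀ e (v, h v)) := by
  rw [← lintegral_map hφ H.lipschitz_graph.continuous.measurable, ← smul_eq_mul,
    ← lintegral_smul_measure]
  refine le_trans (le_of_eq ?_) (lintegral_mono' H.restrict_le le_rfl)
  rw [← lintegral_indicator Metric.isOpen_ball.measurableSet]
  refine lintegral_congr fun y => ?_
  by_cases hy : y ∈ Metric.ball x₀ r
  · rw [indicator_of_mem hy]
  · rw [indicator_of_notMem hy, h0 y hy]

end IsGraphChart

theorem IsSmoothBoundedOpen.isFiniteMeasure_surface {Ω : Set E3} (hΩ : IsSmoothBoundedOpen Ω) :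
    IsFiniteMeasure (surfaceMeasure Ω) := by
  have h : surfaceMeasure Ω (frontier Ω) < ⊤ := by
    refine hΩ.isCompact_frontier.measure_lt_top_of_nhdsWithin fun x hx => ?_
    obtain ⟨e, r, f, H⟩ := hΩ.exists_graphChart hx one_lt_two
    exact ⟨Metric.ball x r, mem_nhdsWithin_of_mem_nhds (Metric.ball_mem_nhds x H.pos),
      H.surfaceMeasure_ball_lt_top⟩
  refine ⟨?_⟩
  rw [surfaceMeasure, Measure.restrict_apply_univ]
  rwa [surfaceMeasure, Measure.restrict_apply_self] at h

/-! ### The strip in a graph chart -/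

/-- Integrals over the strip by Fubini in cylinder coordinates. -/
theorem IsSmoothBoundedOpen.lintegral_strip {Ω : Set E3} (hΩ : IsSmoothBoundedOpen Ω) (ε : ℝ)
    (x₀ : E3) {e : E3} (he : ‖e‖ = 1) {φ : E3 → ENNReal} (hφ : Measurable φ) :
    ∫⁻ y, φ y ∂stripMeasure Ω ε = ENNReal.ofReal ε⁻¹ * ∫⁻ v : Plane e, ∫⁻ s : ℝ,
      (Ω ∩ Metric.thickening ε (frontier Ω)).indicator φ (cyl x₀ e (v, s)) := by
  have hA : MeasurableSet (Ω ∩ Metric.thickening ε (frontier Ω)) :=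
    hΩ.isOpen.measurableSet.inter Metric.isOpen_thickening.measurableSet
  have hm := hφ.indicator hA
  rw [stripMeasure, lintegral_smul_measure, hΩ.inter_strip, smul_eq_mul, ← lintegral_indicator hA,
    ← (measurePreserving_cyl x₀ he).lintegral_comp hm, Measure.volume_eq_prod, lintegral_prod]
  exact (hm.comp (continuous_cyl x₀ e).measurable).aemeasurable

namespace IsGraphChart

variable {Ω : Set E3} {κ r : ℝ} {x₀ e : E3} {h : Plane e → ℝ}

/-- On each line parallel to the axis, the strip lies within height `κ ε` above the graph, where
`φ` differs from its value on the graph by at most `θ`. -/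
theorem lintegral_slice_le (H : IsGraphChart Ω κ x₀ e r h) {φ : E3 → ENNReal}
    (h0 : ∀ y ∉ Metric.ball x₀ r, φ y = 0) {ε : ℝ} {θ : ENNReal} (hεr : ε < r)
    (hθ : ∀ y z, dist y z < κ * ε → φ y ≤ φ z + θ) (v : Plane e) :
    ∫⁻ s : ℝ, (Ω ∩ Metric.thickening ε (frontier Ω)).indicator φ (cyl x₀ e (v, s)) ≤
      (Metric.ball 0 r).indicator
        (fun v => ENNReal.ofReal (κ * ε) * (φ (cyl x₀ e (v, h v)) + θ)) v := by
  have hball : ∀ (v : Plane e) (s : ℝ), cyl x₀ e (v, s) ∈ Metric.ball x₀ r → ‖v‖ < r ∧ |s| < r := by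
    intro v s hy
    rw [Metric.mem_ball, dist_eq_norm] at hy
    have h1 := norm_cyl_sub_sq (x₀ := x₀) H.norm_e (v, s) 0
    rw [cyl_zero] at h1
    simp only [Prod.fst_zero, Prod.snd_zero, sub_zero] at h1
    have h2 : ‖cyl x₀ e (v, s) - x₀‖ ^ 2 < r ^ 2 := by
      gcongr
    constructor
    · exact lt_of_pow_lt_pow_left₀ 2 H.pos.le (by nlinarith [sq_nonneg s])
    · exact lt_of_pow_lt_pow_left₀ 2 H.pos.le (by rw [sq_abs]; nlinarith [sq_nonneg ‖v‖])
  by_cases hv : v ∈ Metric.ball 0 r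
  · rw [indicator_of_mem hv]
    have hv' := mem_ball_zero_iff.1 hv
    have e1 : ENNReal.ofReal (κ * ε) * (φ (cyl x₀ e (v, h v)) + θ) =
        ∫⁻ s : ℝ, (Ioo (h v) (h v + κ * ε)).indicator (fun _ => φ (cyl x₀ e (v, h v)) + θ) s := by
      rw [lintegral_indicator measurableSet_Ioo, setLIntegral_const, Real.volume_Ioo,
        add_sub_cancel_left, mul_comm]
    rw [e1]
    refine lintegral_mono fun s => ?_
    by_cases hy : cyl x₀ e (v, s) ∈ Metric.ball x₀ r
    · by_cases hs : cyl x₀ e (v, s) ∈ Ω ∩ Metric.thickening ε (frontier Ω)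
      · have hs2 := (hball v s hy).2
        have hs3 := (H.mem_iff v s hv' hs2).1 hs.1
        have hs4 := H.lt_of_mem ε v s hεr hv' hs2 hs.1 hs.2
        rw [indicator_of_mem hs,
          indicator_of_mem (show s ∈ Ioo (h v) (h v + κ * ε) from ⟨hs3, hs4⟩)]
        refine hθ _ _ ?_
        have h1 := norm_cyl_sub_le (x₀ := x₀) H.norm_e (v, s) (v, h v)
        simp only [sub_self, norm_zero, zero_add, abs_of_pos (sub_pos.2 hs3)] at h1
        rw [dist_eq_norm]
        linarith
      · rw [indicator_of_notMem hs]
        exact zero_le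
    · rw [indicator_apply_eq_zero.2 fun _ => h0 _ hy]
      exact zero_le
  · rw [indicator_of_notMem hv, nonpos_iff_eq_zero, ← lintegral_zero (μ := (volume : Measure ℝ))]
    refine lintegral_congr fun s => indicator_apply_eq_zero.2 fun _ => h0 _ fun hy => hv ?_
    exact mem_ball_zero_iff.2 (hball v s hy).1

/-- On each line parallel to the axis, the strip contains the points within height `ε` above the
graph. -/
theorem le_lintegral_slice (H : IsGraphChart Ω κ x₀ e r h) {φ : E3 → ENNReal} (hφ : Measurable φ)
    {ε : ℝ} {θ : ENNReal} (hε : 0 < ε) (hεr : ε < r / 2)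
    (hθ : ∀ y z, dist y z < κ * ε → φ y ≤ φ z + θ) {v : Plane e} (hv : v ∈ Metric.ball 0 r) :
    ENNReal.ofReal ε * φ (cyl x₀ e (v, h v)) ≤
      (∫⁻ s : ℝ, (Ω ∩ Metric.thickening ε (frontier Ω)).indicator φ (cyl x₀ e (v, s))) +
        ENNReal.ofReal ε * θ := by
  have hv' := mem_ball_zero_iff.1 hv
  have e1 : ENNReal.ofReal ε * φ (cyl x₀ e (v, h v)) =
      ∫⁻ s in Ioo (h v) (h v + ε), φ (cyl x₀ e (v, h v)) := by
    rw [setLIntegral_const, Real.volume_Ioo, add_sub_cancel_left, mul_comm]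
  have e2 : ENNReal.ofReal ε * θ = ∫⁻ s in Ioo (h v) (h v + ε), θ := by
    rw [setLIntegral_const, Real.volume_Ioo, add_sub_cancel_left, mul_comm]
  rw [e1, e2]
  refine le_trans (b := ∫⁻ s in Ioo (h v) (h v + ε), (φ (cyl x₀ e (v, s)) + θ)) ?_ ?_
  · refine setLIntegral_mono' measurableSet_Ioo fun s hs => hθ _ _ ?_
    have h1 := norm_cyl_sub_le (x₀ := x₀) H.norm_e (v, h v) (v, s)
    simp only [sub_self, norm_zero, zero_add, abs_sub_comm (h v) s,
      abs_of_pos (sub_pos.2 hs.1)] at h1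
    rw [dist_eq_norm]
    nlinarith [hs.2, H.one_le]
  · have hm : Measurable fun s : ℝ => φ (cyl x₀ e (v, s)) :=
      hφ.comp ((continuous_cyl x₀ e).measurable.comp (by fun_prop))
    rw [lintegral_add_left hm]
    refine add_le_add ?_ le_rfl
    rw [← lintegral_indicator measurableSet_Ioo]
    refine lintegral_mono fun s => ?_
    by_cases hs : s ∈ Ioo (h v) (h v + ε)
    · have hs1 := H.small v hv'
      have hs2 : |s| < r := by
        rw [abs_lt]
        have := abs_le.1 hs1
        constructor <;> linarith [hs.1, hs.2, H.pos]
      have hmem : cyl x₀ e (v, s) ∈ Ω ∩ Metric.thickening ε (frontier Ω) := by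
        refine ⟨(H.mem_iff v s hv' hs2).2 hs.1,
          Metric.mem_thickening_iff.2 ⟨_, H.graph_mem hv', ?_⟩⟩
        have h1 := norm_cyl_sub_le (x₀ := x₀) H.norm_e (v, s) (v, h v)
        simp only [sub_self, norm_zero, zero_add, abs_of_pos (sub_pos.2 hs.1)] at h1
        rw [dist_eq_norm]
        linarith [hs.2]
      rw [indicator_of_mem hs, indicator_of_mem hmem]
    · rw [indicator_of_notMem hs]
      exact zero_le

end IsGraphChart

/-! ### Convergence of the strip measures to the surface measure -/

namespace IsGraphChart

variable {Ω : Set E3} {κ r : ℝ} {x₀ e : E3} {h : Plane e → ℝ}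

theorem lintegral_strip_le (H : IsGraphChart Ω κ x₀ e r h) (hΩ : IsSmoothBoundedOpen Ω)
    {φ : E3 → ENNReal} (hφ : Measurable φ) (h0 : ∀ y ∉ Metric.ball x₀ r, φ y = 0) {ε : ℝ}
    {θ : ENNReal} (hε : 0 < ε) (hεr : ε < r)
    (hθ : ∀ y z, dist y z < κ * ε → φ y ≤ φ z + θ) :
    ∫⁻ y, φ y ∂stripMeasure Ω ε ≤ ENNReal.ofReal κ *
      ((∫⁻ v in Metric.ball (0 : Plane e) r, φ (cyl x₀ e (v, h v))) +
        θ * volume (Metric.ball (0 : Plane e) r)) := by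
  have hκ := H.one_le
  have hG : Measurable fun v => φ (cyl x₀ e (v, h v)) :=
    hφ.comp H.lipschitz_graph.continuous.measurable
  rw [hΩ.lintegral_strip ε x₀ H.norm_e hφ]
  calc _ ≤ ENNReal.ofReal ε⁻¹ * ∫⁻ v : Plane e, (Metric.ball 0 r).indicator
        (fun v => ENNReal.ofReal (κ * ε) * (φ (cyl x₀ e (v, h v)) + θ)) v := by
        gcongr with v
        exact H.lintegral_slice_le h0 hεr hθ v
    _ = _ := by
        rw [lintegral_indicator Metric.isOpen_ball.measurableSet,
          lintegral_const_mul' _ _ ENNReal.ofReal_ne_top, ← mul_assoc,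
          ← ENNReal.ofReal_mul (by positivity), lintegral_add_left hG, setLIntegral_const]
        congr 2
        field_simp

theorem lintegral_graph_le_strip (H : IsGraphChart Ω κ x₀ e r h) (hΩ : IsSmoothBoundedOpen Ω)
    {φ : E3 → ENNReal} (hφ : Measurable φ) {ε : ℝ} {θ : ENNReal} (hε : 0 < ε) (hεr : ε < r / 2)
    (hθ : ∀ y z, dist y z < κ * ε → φ y ≤ φ z + θ) :
    ∫⁻ v in Metric.ball (0 : Plane e) r, φ (cyl x₀ e (v, h v)) ≤
      (∫⁻ y, φ y ∂stripMeasure Ω ε) + θ * volume (Metric.ball (0 : Plane e) r) := by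
  have hA : MeasurableSet (Ω ∩ Metric.thickening ε (frontier Ω)) :=
    hΩ.isOpen.measurableSet.inter Metric.isOpen_thickening.measurableSet
  have hm : Measurable fun v : Plane e => ∫⁻ s : ℝ,
      (Ω ∩ Metric.thickening ε (frontier Ω)).indicator φ (cyl x₀ e (v, s)) :=
    ((hφ.indicator hA).comp (continuous_cyl x₀ e).measurable).lintegral_prod_right'
  have hc : ENNReal.ofReal ε⁻¹ * ENNReal.ofReal ε = 1 := by
    rw [← ENNReal.ofReal_mul (by positivity), inv_mul_cancel₀ hε.ne', ENNReal.ofReal_one]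
  have h1 : ∫⁻ v in Metric.ball (0 : Plane e) r, ENNReal.ofReal ε * φ (cyl x₀ e (v, h v)) ≤
      ∫⁻ v in Metric.ball (0 : Plane e) r, ((∫⁻ s : ℝ,
        (Ω ∩ Metric.thickening ε (frontier Ω)).indicator φ (cyl x₀ e (v, s))) +
        ENNReal.ofReal ε * θ) :=
    setLIntegral_mono' Metric.isOpen_ball.measurableSet fun v hv =>
      H.le_lintegral_slice hφ hε hεr hθ hv
  rw [lintegral_const_mul' _ _ ENNReal.ofReal_ne_top, lintegral_add_left hm,
    setLIntegral_const] at h1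
  have h2 := mul_le_mul_right h1 (ENNReal.ofReal ε⁻¹)
  rw [← mul_assoc, hc, one_mul, mul_add, ← mul_assoc, ← mul_assoc, hc, one_mul] at h2
  refine h2.trans (add_le_add ?_ le_rfl)
  rw [hΩ.lintegral_strip ε x₀ H.norm_e hφ]
  exact mul_le_mul_right (setLIntegral_le_lintegral _ _) _

end IsGraphChart

/-- Up to the factor `κ`, the integrals of `φ` over the boundary and with respect to the strip
measures bound each other in the limit `ε → 0`. The factor comes from the area density of the
boundary in a graph chart, and can be taken arbitrarily close to `1`. -/
def StripComparable (Ω : Set E3) (κ : ENNReal) (φ : E3 → ENNReal) : Prop :=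
  ∀ θ : ENNReal, 0 < θ → ∀ᶠ ε in 𝓝[>] 0,
    ∫⁻ y, φ y ∂stripMeasure Ω ε ≤ κ * (∫⁻ y, φ y ∂surfaceMeasure Ω) + θ ∧
    ∫⁻ y, φ y ∂surfaceMeasure Ω ≤ κ * (∫⁻ y, φ y ∂stripMeasure Ω ε) + θ

/-- Both sides are compared with the integral over the plane of the values on the graph. Uniform
continuity makes the oscillation of `ψ` across the strip negligible. -/
theorem IsGraphChart.stripComparable {Ω : Set E3} {κ r : ℝ} {x₀ e : E3} {h : Plane e → ℝ}
    (H : IsGraphChart Ω κ x₀ e r h) (hΩ : IsSmoothBoundedOpen Ω) {ψ : E3 → ℝ}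
    (hψ : UniformContinuous ψ) (h0 : ∀ y ∉ Metric.ball x₀ r, ψ y = 0) :
    StripComparable Ω (ENNReal.ofReal κ ^ 2) fun y => ENNReal.ofReal (ψ y) := by
  intro θ hθ
  have hκ := H.one_le
  set K := ENNReal.ofReal κ ^ 2 with hK
  have hκK : ENNReal.ofReal κ ≤ K := by
    rw [hK, pow_two, ← ENNReal.ofReal_mul (by linarith)]
    exact ENNReal.ofReal_le_ofReal (by nlinarith)
  set B := volume (Metric.ball (0 : Plane e) r) with hB
  have hKB : K * B ≠ ⊤ := ENNReal.mul_ne_top (ENNReal.pow_ne_top ENNReal.ofReal_ne_top)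
    measure_ball_lt_top.ne
  obtain ⟨t, ht, htθ⟩ : ∃ t : ℝ, 0 < t ∧ ENNReal.ofReal t * (K * B) ≤ θ := by
    have h1 : Tendsto (fun t : ℝ => ENNReal.ofReal t * (K * B)) (𝓝[>] 0) (𝓝 0) := by
      have h2 : Tendsto (fun t : ℝ => ENNReal.ofReal t) (𝓝[>] 0) (𝓝 0) := by
        simpa using (ENNReal.continuous_ofReal.tendsto 0).mono_left nhdsWithin_le_nhds
      simpa using ENNReal.Tendsto.mul_const h2 (Or.inr hKB)
    obtain ⟨t, h3, h4⟩ := ((h1.eventually (ge_mem_nhds hθ)).and self_mem_nhdsWithin).exists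
    exact ⟨t, h4, h3⟩
  obtain ⟨δ, hδ, hδ2⟩ := Metric.uniformContinuous_iff.1 hψ t ht
  have hm : Measurable fun y => ENNReal.ofReal (ψ y) := hψ.continuous.measurable.ennreal_ofReal
  have hz : ∀ y ∉ Metric.ball x₀ r, ENNReal.ofReal (ψ y) = 0 := fun y hy => by
    rw [h0 y hy, ENNReal.ofReal_zero]
  have hpos := H.pos
  filter_upwards [Ioo_mem_nhdsGT (show 0 < min (δ / κ) (r / 2) from
    lt_min (div_pos hδ (by linarith)) (by linarith))] with ε hε
  have hε1 : κ * ε < δ := by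
    have := (lt_div_iff₀ (by linarith : 0 < κ)).1 (hε.2.trans_le (min_le_left _ _))
    linarith
  have hε2 : ε < r / 2 := hε.2.trans_le (min_le_right _ _)
  have hosc : ∀ y z, dist y z < κ * ε →
      ENNReal.ofReal (ψ y) ≤ ENNReal.ofReal (ψ z) + ENNReal.ofReal t := by
    intro y z hyz
    have h1 := hδ2 (hyz.trans hε1)
    rw [Real.dist_eq] at h1
    refine le_trans (ENNReal.ofReal_le_ofReal ?_) ENNReal.ofReal_add_le
    linarith [(abs_lt.1 h1).2]
  have h1 := H.lintegral_strip_le hΩ hm hz hε.1 (by linarith) hosc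
  have h2 := H.lintegral_graph_le_strip hΩ hm hε.1 hε2 hosc
  have h3 := H.lintegral_graph_le hm
  have h4 := H.lintegral_surface_le hm hz
  constructor
  · refine h1.trans ((mul_le_mul_left hκK _).trans ?_)
    rw [mul_add]
    refine add_le_add (mul_le_mul_right h3 _) (le_trans (le_of_eq ?_) htθ)
    ring
  · refine h4.trans ((mul_le_mul_right h2 _).trans ?_)
    rw [mul_add]
    refine add_le_add le_rfl (le_trans (le_of_eq ?_) htθ)
    ring

theorem StripComparable.of_eventually_zero {Ω : Set E3} {κ : ENNReal} {φ : E3 → ENNReal}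
    (h1 : ∀ᶠ ε in 𝓝[>] 0, ∫⁻ y, φ y ∂stripMeasure Ω ε = 0)
    (h2 : ∫⁻ y, φ y ∂surfaceMeasure Ω = 0) : StripComparable Ω κ φ := by
  intro θ _
  filter_upwards [h1] with ε hε
  rw [hε, h2, mul_zero, zero_add]
  exact ⟨zero_le, zero_le⟩

theorem StripComparable.add {Ω : Set E3} {κ : ENNReal} {φ ψ : E3 → ENNReal} (hφ : Measurable φ)
    (h1 : StripComparable Ω κ φ) (h2 : StripComparable Ω κ ψ) :
    StripComparable Ω κ fun y => φ y + ψ y := by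
  intro θ hθ
  have hθ2 : 0 < θ / 2 := ENNReal.half_pos hθ.ne'
  filter_upwards [h1 _ hθ2, h2 _ hθ2] with ε h3 h4
  rw [lintegral_add_left hφ, lintegral_add_left hφ, mul_add, mul_add]
  constructor
  · refine (add_le_add h3.1 h4.1).trans (le_of_eq ?_)
    rw [add_add_add_comm, ENNReal.add_halves]
  · refine (add_le_add h3.2 h4.2).trans (le_of_eq ?_)
    rw [add_add_add_comm, ENNReal.add_halves]

theorem StripComparable.sum {Ω : Set E3} {κ : ENNReal} {ι : Type*} (t : Finset ι)
    {φ : ι → E3 → ENNReal} (hφ : ∀ i, Measurable (φ i)) (h : ∀ i, StripComparable Ω κ (φ i)) :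
    StripComparable Ω κ fun y => ∑ i ∈ t, φ i y := by
  classical
  induction t using Finset.induction_on with
  | empty => exact .of_eventually_zero (by simp) (by simp)
  | insert a s ha ih =>
    simp only [Finset.sum_insert ha]
    exact (h a).add (hφ a) ih

theorem ae_mem_closure_surface (Ω : Set E3) : ∀ᵐ y ∂surfaceMeasure Ω, y ∈ closure Ω := by
  filter_upwards [ae_restrict_mem (isClosed_frontier (s := Ω)).measurableSet] with y hy
  exact frontier_subset_closure hy

theorem ae_mem_closure_strip {Ω : Set E3} (ho : IsOpen Ω) (ε : ℝ) :
    ∀ᵐ y ∂stripMeasure Ω ε, y ∈ closure Ω := by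
  refine (stripMeasure_absolutelyContinuous Ω ε).ae_le ?_
  filter_upwards [ae_restrict_mem ho.measurableSet] with y hy
  exact subset_closure hy

theorem StripComparable.congr {Ω : Set E3} (ho : IsOpen Ω) {κ : ENNReal} {φ ψ : E3 → ENNReal}
    (h : ∀ y ∈ closure Ω, φ y = ψ y) (h1 : StripComparable Ω κ φ) : StripComparable Ω κ ψ := by
  intro θ hθ
  have e1 : ∫⁻ y, φ y ∂surfaceMeasure Ω = ∫⁻ y, ψ y ∂surfaceMeasure Ω :=
    lintegral_congr_ae ((ae_mem_closure_surface Ω).mono h)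
  have e2 : ∀ ε, ∫⁻ y, φ y ∂stripMeasure Ω ε = ∫⁻ y, ψ y ∂stripMeasure Ω ε := fun ε =>
    lintegral_congr_ae ((ae_mem_closure_strip ho ε).mono h)
  filter_upwards [h1 θ hθ] with ε h2
  rwa [e1, e2] at h2

/-- Functions supported in the interior are not seen by thin strips. -/
theorem IsSmoothBoundedOpen.stripComparable_of_disjoint {Ω : Set E3} (hΩ : IsSmoothBoundedOpen Ω)
    {κ : ENNReal} {φ : E3 → ENNReal} {ρ : ℝ} (hρ : 0 < ρ)
    (h : ∀ y ∈ Metric.thickening ρ (frontier Ω), φ y = 0) : StripComparable Ω κ φ := by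
  refine .of_eventually_zero ?_ ?_
  · filter_upwards [Ioo_mem_nhdsGT hρ] with ε hε
    rw [stripMeasure, lintegral_smul_measure, hΩ.inter_strip, smul_eq_mul,
      setLIntegral_congr_fun (hΩ.isOpen.measurableSet.inter Metric.isOpen_thickening.measurableSet)
      (g := fun _ => 0) fun y hy => h y (Metric.thickening_mono hε.2.le _ hy.2)]
    simp
  · rw [surfaceMeasure, setLIntegral_congr_fun isClosed_frontier.measurableSet
      (g := fun _ => 0) fun y hy => h y (Metric.self_subset_thickening hρ _ hy)]
    simp

/-- A partition of unity reduces the comparison to functions supported in a graph chart or away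
from the boundary. -/
theorem IsSmoothBoundedOpen.stripComparable {Ω : Set E3} (hΩ : IsSmoothBoundedOpen Ω) {κ : ℝ}
    (hκ : 1 < κ) {ψ : E3 → ℝ} (hψ : Continuous ψ) :
    StripComparable Ω (ENNReal.ofReal κ ^ 2) fun y => ENNReal.ofReal (ψ y) := by
  obtain ⟨t, χ, h1, h2⟩ := exists_smooth_partition hΩ.isCompact_closure
    (p := fun U => (∃ ρ, 0 < ρ ∧ ∀ y ∈ Metric.thickening ρ (frontier Ω), y ∉ U) ∨
      ∃ x₀ e r, ∃ h : Plane e → ℝ, IsGraphChart Ω κ x₀ e r h ∧ U ⊆ Metric.ball x₀ r) (by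
    intro x hx
    by_cases hxf : x ∈ frontier Ω
    · obtain ⟨e, r, f, H⟩ := hΩ.exists_graphChart hxf hκ
      exact ⟨Metric.ball x r, Metric.isOpen_ball, Metric.mem_ball_self H.pos,
        Or.inr ⟨x, e, r, f, H, subset_rfl⟩⟩
    · obtain ⟨ρ, hρ, hρ2⟩ := Metric.isOpen_iff.1 isClosed_frontier.isOpen_compl x hxf
      refine ⟨Metric.ball x (ρ / 2), Metric.isOpen_ball, Metric.mem_ball_self (by linarith),
        Or.inl ⟨ρ / 2, by linarith, fun y hy hyx => ?_⟩⟩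
      obtain ⟨p, hp, hpy⟩ := Metric.mem_thickening_iff.1 hy
      refine hρ2 (?_ : p ∈ Metric.ball x ρ) hp
      rw [Metric.mem_ball] at hyx ⊢
      linarith [dist_triangle p y x, dist_comm p y])
  have hc : ∀ i, Continuous fun y => χ i y * ψ y := fun i => (h1 i).1.continuous.mul hψ
  refine StripComparable.congr hΩ.isOpen (φ := fun y => ∑ i ∈ t, ENNReal.ofReal (χ i y * ψ y)) ?_
    (.sum t (fun i => (hc i).measurable.ennreal_ofReal) fun i => ?_)
  · intro y hy
    rcases le_total 0 (ψ y) with h0 | h0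
    · rw [← ENNReal.ofReal_sum_of_nonneg fun i _ => mul_nonneg ((h1 i).2.2.1 y) h0,
        ← Finset.sum_mul, h2 y hy, one_mul]
    · rw [ENNReal.ofReal_of_nonpos h0]
      exact Finset.sum_eq_zero fun i _ => ENNReal.ofReal_of_nonpos
        (mul_nonpos_of_nonneg_of_nonpos ((h1 i).2.2.1 y) h0)
  · obtain ⟨U, hU, hs⟩ := (h1 i).2.2.2
    have hz : ∀ y ∉ U, χ i y * ψ y = 0 := fun y hy => by
      rw [image_eq_zero_of_notMem_tsupport fun h => hy (hs h), zero_mul]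
    rcases hU with ⟨ρ, hρ, hρ2⟩ | ⟨x₀, e, r, h, H, hsub⟩
    · refine hΩ.stripComparable_of_disjoint hρ fun y hy => ?_
      rw [hz y (hρ2 y hy), ENNReal.ofReal_zero]
    · exact H.stripComparable hΩ ((hc i).uniformContinuous_of_tendsto_cocompact
        (h1 i).2.1.mul_right.is_zero_at_infty) fun y hy => hz y fun h => hy (hsub h)

/-- If `b ε` and `a` are comparable for all factors `κ > 1` in the limit, then `b ε` tends to `a`.
-/
theorem tendsto_of_forall_comparable {l : Filter ℝ} {b : ℝ → ℝ} {a : ℝ} (ha : 0 ≤ a)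
    (h : ∀ κ > 1, ∀ θ > 0, ∀ᶠ ε in l, b ε ≤ κ * a + θ ∧ a ≤ κ * b ε + θ) :
    Tendsto b l (𝓝 a) := by
  rw [Metric.tendsto_nhds]
  intro δ hδ
  set t := min 1 (δ / (2 * a + 3)) with ht
  have ht0 : 0 < t := lt_min one_pos (by positivity)
  have ht1 : t ≤ 1 := min_le_left _ _
  have ht2 : t * (2 * a + 3) ≤ δ := (le_div_iff₀ (by positivity)).1 (min_le_right _ _)
  -- with `κ = 1 + t` and `θ = t` the two errors are less than `t (2 a + 3) ≤ δ`
  filter_upwards [h (1 + t) (by linarith) t ht0] with ε hε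
  rw [Real.dist_eq, abs_lt]
  have h3 : t * b ε ≤ t * ((1 + t) * a + t) := mul_le_mul_of_nonneg_left hε.1 ht0.le
  have h4 : t * (t * a) ≤ t * a := by nlinarith [mul_nonneg ht0.le ha]
  have h5 : t * t ≤ t := by nlinarith
  constructor <;> nlinarith

instance isFiniteMeasure_strip {Ω : Set E3} [hb : Fact (Bornology.IsBounded Ω)] (ε : ℝ) :
    IsFiniteMeasure (stripMeasure Ω ε) := by
  refine ⟨?_⟩
  rw [stripMeasure, Measure.smul_apply, Measure.restrict_apply_univ, smul_eq_mul]
  exact ENNReal.mul_lt_top ENNReal.ofReal_lt_top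
    ((measure_mono inter_subset_left).trans_lt hb.out.measure_lt_top)

theorem integrable_of_continuous {Ω : Set E3} (hΩ : IsSmoothBoundedOpen Ω) {μ : Measure E3}
    [IsFiniteMeasure μ] (hμ : ∀ᵐ y ∂μ, y ∈ closure Ω) {ψ : E3 → ℝ} (hψ : Continuous ψ) :
    Integrable ψ μ := by
  obtain ⟨C, hC⟩ := hΩ.isCompact_closure.exists_bound_of_continuousOn hψ.continuousOn
  exact Integrable.of_bound hψ.aestronglyMeasurable C (hμ.mono hC)

theorem toReal_le_of_le {a b κ θ : ENNReal} (h : a ≤ κ * b + θ) (hb : b ≠ ⊤) (hκ : κ ≠ ⊤)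
    (hθ : θ ≠ ⊤) : a.toReal ≤ κ.toReal * b.toReal + θ.toReal := by
  rw [← ENNReal.toReal_mul, ← ENNReal.toReal_add (ENNReal.mul_ne_top hκ hb) hθ]
  exact ENNReal.toReal_mono (ENNReal.add_ne_top.2 ⟨ENNReal.mul_ne_top hκ hb, hθ⟩) h

theorem IsSmoothBoundedOpen.tendsto_lintegral_strip {Ω : Set E3} (hΩ : IsSmoothBoundedOpen Ω)
    {ψ : E3 → ℝ} (hψ : Continuous ψ) :
    Tendsto (fun ε => (∫⁻ y, ENNReal.ofReal (ψ y) ∂stripMeasure Ω ε).toReal) (𝓝[>] 0)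
      (𝓝 (∫⁻ y, ENNReal.ofReal (ψ y) ∂surfaceMeasure Ω).toReal) := by
  have : Fact (Bornology.IsBounded Ω) := ⟨hΩ.isBounded⟩
  have := hΩ.isFiniteMeasure_surface
  have hS := (integrable_of_continuous hΩ (ae_mem_closure_surface Ω) hψ).lintegral_lt_top.ne
  have hs := fun ε =>
    (integrable_of_continuous hΩ (ae_mem_closure_strip hΩ.isOpen ε) hψ).lintegral_lt_top.ne
  refine tendsto_of_forall_comparable ENNReal.toReal_nonneg fun κ hκ θ hθ => ?_
  -- the comparison in a graph chart of constant `√κ` has the factor `κ`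
  have hκ2 : ENNReal.ofReal (√κ) ^ 2 = ENNReal.ofReal κ := by
    rw [← ENNReal.ofReal_pow (Real.sqrt_nonneg κ), Real.sq_sqrt (by linarith)]
  have h1 := hΩ.stripComparable (Real.lt_sqrt_of_sq_lt (by linarith : (1 : ℝ) ^ 2 < κ)) hψ
    (ENNReal.ofReal θ) (ENNReal.ofReal_pos.2 hθ)
  rw [hκ2] at h1
  filter_upwards [h1] with ε hε
  have h2 := toReal_le_of_le hε.1 hS ENNReal.ofReal_ne_top ENNReal.ofReal_ne_top
  have h3 := toReal_le_of_le hε.2 (hs ε) ENNReal.ofReal_ne_top ENNReal.ofReal_ne_top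
  rw [ENNReal.toReal_ofReal (by linarith), ENNReal.toReal_ofReal hθ.le] at h2 h3
  exact ⟨h2, h3⟩

/-- The normalized strip measures converge weakly to the surface measure. -/
theorem IsSmoothBoundedOpen.tendsto_integral_strip {Ω : Set E3} (hΩ : IsSmoothBoundedOpen Ω)
    {ψ : E3 → ℝ} (hψ : Continuous ψ) :
    Tendsto (fun ε => ∫ y, ψ y ∂stripMeasure Ω ε) (𝓝[>] 0) (𝓝 (∫ y, ψ y ∂surfaceMeasure Ω)) := by
  have : Fact (Bornology.IsBounded Ω) := ⟨hΩ.isBounded⟩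
  have := hΩ.isFiniteMeasure_surface
  rw [integral_eq_lintegral_pos_part_sub_lintegral_neg_part
    (integrable_of_continuous hΩ (ae_mem_closure_surface Ω) hψ)]
  refine ((hΩ.tendsto_lintegral_strip hψ).sub (hΩ.tendsto_lintegral_strip hψ.neg)).congr fun ε => ?_
  exact (integral_eq_lintegral_pos_part_sub_lintegral_neg_part
    (integrable_of_continuous hΩ (ae_mem_closure_strip hΩ.isOpen ε) hψ)).symm

/-! ### The trace operator -/

theorem norm_sq_eq_integral {μ : Measure E3} {z : Lp ℝ 2 μ} {φ : E3 → ℝ} (h : z =ᵐ[μ] φ) :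
    ‖z‖ ^ 2 = ∫ y, φ y ^ 2 ∂μ := by
  rw [← real_inner_self_eq_norm_sq, L2.inner_def]
  apply integral_congr_ae
  filter_upwards [h] with y hy
  rw [hy, real_inner_self_eq_norm_sq, Real.norm_eq_abs, sq_abs]

/-- The trace estimate for smooth functions, as the limit of the collar estimate. -/
theorem IsSmoothBoundedOpen.exists_surface_bound {Ω : Set E3} (hΩ : IsSmoothBoundedOpen Ω) :
    ∃ C : ℝ, 0 < C ∧ ∀ (u : H1 Ω) (φ : E3 → ℝ), Continuous φ → fn u =ᵐ[volume.restrict Ω] φ →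
      ∀ z : Lp ℝ 2 (surfaceMeasure Ω), z =ᵐ[surfaceMeasure Ω] φ →
        ‖z‖ ^ 2 ≤ C * (‖toL2 Ω u‖ * ‖u‖) := by
  obtain ⟨C, ε₀, hC, hε₀, h⟩ := hΩ.exists_stripTrace_bound
  refine ⟨C, hC, fun u φ hφ hu z hz => ?_⟩
  rw [norm_sq_eq_integral hz]
  refine le_of_tendsto (hΩ.tendsto_integral_strip (hφ.pow 2)) ?_
  filter_upwards [Ioc_mem_nhdsGT hε₀] with ε hε
  refine le_trans (le_of_eq ?_) (h ε hε u)
  exact (norm_sq_eq_integral ((coeFn_stripTrace ε u).trans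
    ((stripMeasure_absolutelyContinuous Ω ε).ae_le hu))).symm

theorem eqOn_closure_of_ae {Ω : Set E3} (ho : IsOpen Ω) {φ ψ : E3 → ℝ} (hφ : Continuous φ)
    (hψ : Continuous ψ) (h : φ =ᵐ[volume.restrict Ω] ψ) : EqOn φ ψ (closure Ω) :=
  (Measure.eqOn_open_of_ae_eq h ho hφ.continuousOn hψ.continuousOn).closure hφ hψ

theorem IsSmoothBoundedOpen.memLp_surface {Ω : Set E3} (hΩ : IsSmoothBoundedOpen Ω) {φ : E3 → ℝ}
    (hφ : Continuous φ) : MemLp φ 2 (surfaceMeasure Ω) := by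
  have := hΩ.isFiniteMeasure_surface
  obtain ⟨C, hC⟩ := hΩ.isCompact_closure.exists_bound_of_continuousOn hφ.continuousOn
  exact MemLp.of_bound hφ.aestronglyMeasurable C ((ae_mem_closure_surface Ω).mono hC)

/-- The function `u` agrees almost everywhere with a continuous function on the whole space, and
`z` is the restriction of the latter to the boundary. -/
def IsBoundaryValue {Ω : Set E3} (u : H1 Ω) (z : Lp ℝ 2 (surfaceMeasure Ω)) : Prop :=
  ∃ φ : E3 → ℝ, Continuous φ ∧ fn u =ᵐ[volume.restrict Ω] φ ∧ z =ᵐ[surfaceMeasure Ω] φ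

theorem IsBoundaryValue.ae_eq {Ω : Set E3} (ho : IsOpen Ω) {u : H1 Ω}
    {z : Lp ℝ 2 (surfaceMeasure Ω)} (h : IsBoundaryValue u z) {φ : E3 → ℝ} (hφ : Continuous φ)
    (hu : fn u =ᵐ[volume.restrict Ω] φ) : z =ᵐ[surfaceMeasure Ω] φ := by
  obtain ⟨ψ, h1, h2, h3⟩ := h
  have h4 := eqOn_closure_of_ae ho h1 hφ (h2.symm.trans hu)
  filter_upwards [h3, ae_mem_closure_surface Ω] with y hy1 hy2
  rw [hy1, h4 hy2]

/-- The values of a continuous function on `∂Ω` are determined by those in `Ω`, as `∂Ω ⊆ closure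
Ω`. -/
theorem IsBoundaryValue.unique {Ω : Set E3} (ho : IsOpen Ω) {u : H1 Ω}
    {z z' : Lp ℝ 2 (surfaceMeasure Ω)} (h : IsBoundaryValue u z) (h' : IsBoundaryValue u z') :
    z = z' := by
  obtain ⟨ψ, h1, h2, h3⟩ := h'
  exact Lp.ext ((h.ae_eq ho h1 h2).trans h3.symm)

theorem IsBoundaryValue.add {Ω : Set E3} {u v : H1 Ω} {y z : Lp ℝ 2 (surfaceMeasure Ω)}
    (h : IsBoundaryValue u y) (h' : IsBoundaryValue v z) : IsBoundaryValue (u + v) (y + z) := by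
  obtain ⟨φ, h1, h2, h3⟩ := h
  obtain ⟨ψ, h4, h5, h6⟩ := h'
  exact ⟨fun x => φ x + ψ x, h1.add h4, (fn_add u v).trans (h2.add h5),
    (Lp.coeFn_add y z).trans (h3.add h6)⟩

theorem IsBoundaryValue.smul {Ω : Set E3} {u : H1 Ω} {y : Lp ℝ 2 (surfaceMeasure Ω)}
    (h : IsBoundaryValue u y) (c : ℝ) : IsBoundaryValue (c • u) (c • y) := by
  obtain ⟨φ, h1, h2, h3⟩ := h
  exact ⟨fun x => c • φ x, h1.const_smul c, (fn_smul c u).trans (h2.const_smul c),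
    (Lp.coeFn_smul c y).trans (h3.const_smul c)⟩

/-- A bounded linear relation which is single-valued, and solvable on a dense subspace, extends to
a continuous linear map. -/
theorem exists_clm_of_dense {H G : Type*} [NormedAddCommGroup H] [NormedSpace ℝ H]
    [NormedAddCommGroup G] [NormedSpace ℝ G] [CompleteSpace G] {S : Submodule ℝ H}
    (hS : Dense (S : Set H)) {r : H → G → Prop} (hex : ∀ u ∈ S, ∃ z, r u z)
    (huniq : ∀ u z z', r u z → r u z' → z = z')
    (hadd : ∀ u v y z, r u y → r v z → r (u + v) (y + z))
    (hsmul : ∀ (c : ℝ) u y, r u y → r (c • u) (c • y))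
    {C : ℝ} (hC : ∀ u z, r u z → ‖z‖ ≤ C * ‖u‖) : ∃ T : H →L[ℝ] G, ∀ u ∈ S, r u (T u) := by
  choose f hf using fun u : S => hex u u.2
  let F : S →ₗ[ℝ] G :=
    { toFun := f
      map_add' := fun u v => huniq _ _ _ (hf (u + v)) (hadd _ _ _ _ (hf u) (hf v))
      map_smul' := fun c u => huniq _ _ _ (hf (c • u)) (hsmul c _ _ (hf u)) }
  have hd : DenseRange S.subtype := by
    rw [DenseRange, Submodule.coe_subtype, Subtype.range_coe]
    exact hS
  refine ⟨F.extendOfNorm S.subtype, fun u hu => ?_⟩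
  have h := LinearMap.extendOfNorm_eq (f := F) (e := S.subtype) hd
    ⟨C, fun v => hC v _ (hf v)⟩ ⟨u, hu⟩
  rw [Submodule.subtype_apply] at h
  rw [h]
  exact hf ⟨u, hu⟩

/-- The support of a smooth representative can be made compact, since `Ω` is bounded. -/
theorem IsSmoothBoundedOpen.mem_smoothSubspace {Ω : Set E3} (hΩ : IsSmoothBoundedOpen Ω) {u : H1 Ω}
    {φ : E3 → ℝ} (h1 : ContDiff ℝ ∞ φ) (h2 : fn u =ᵐ[volume.restrict Ω] φ) :
    u ∈ smoothSubspace Ω := by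
  obtain ⟨R, hR, hΩR⟩ := hΩ.isBounded.subset_closedBall_lt 0 0
  let β : ContDiffBump (0 : E3) := ⟨R, R + 1, hR, by linarith⟩
  refine ConcentratedEquilibria.mem_smoothSubspace.2
    ⟨fun y => β y * φ y, β.contDiff.mul h1, β.hasCompactSupport.mul_right, ?_⟩
  filter_upwards [h2, ae_restrict_mem hΩ.isOpen.measurableSet] with y hy hyΩ
  rw [hy, β.one_of_mem_closedBall (hΩR hyΩ), one_mul]

/-- The trace operator exists: boundary values of smooth functions are bounded by the `H¹`-norm,
and smooth functions are dense. -/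
theorem IsSmoothBoundedOpen.exists_isTraceOperator {Ω : Set E3} (hΩ : IsSmoothBoundedOpen Ω) :
    ∃ T, IsTraceOperator Ω T := by
  obtain ⟨C, hC, hCb⟩ := hΩ.exists_surface_bound
  have hb : ∀ (u : H1 Ω) (z : Lp ℝ 2 (surfaceMeasure Ω)), IsBoundaryValue u z →
      ‖z‖ ≤ √C * ‖u‖ := by
    rintro u z ⟨φ, h1, h2, h3⟩
    have h4 := hCb u φ h1 h2 z h3
    apply le_of_sq_le_sq _ (by positivity)
    rw [mul_pow, Real.sq_sqrt hC.le]
    have h5 := mul_le_mul_of_nonneg_right (norm_toL2_le u) (norm_nonneg u)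
    nlinarith
  obtain ⟨T, hT⟩ := exists_clm_of_dense (r := IsBoundaryValue) hΩ.dense_smoothSubspace
    (fun u hu => (ConcentratedEquilibria.mem_smoothSubspace.1 hu).elim fun φ hφ =>
      ⟨(hΩ.memLp_surface hφ.1.continuous).toLp, φ, hφ.1.continuous, hφ.2.2,
        (hΩ.memLp_surface hφ.1.continuous).coeFn_toLp⟩)
    (fun u z z' h h' => h.unique hΩ.isOpen h') (fun u v y z h h' => h.add h')
    (fun c u y h => h.smul c) hb
  exact ⟨T, fun u φ h1 h2 => (hT u (hΩ.mem_smoothSubspace h1 h2)).ae_eq hΩ.isOpen h1.continuous h2⟩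

/-- `trace Ω` is a choice that is meaningful only once some trace operator is known to exist. -/
theorem IsSmoothBoundedOpen.isTraceOperator_trace {Ω : Set E3} (hΩ : IsSmoothBoundedOpen Ω) :
    IsTraceOperator Ω (trace Ω) := Classical.epsilon_spec hΩ.exists_isTraceOperator

theorem IsSmoothBoundedOpen.exists_trace_bound {Ω : Set E3} (hΩ : IsSmoothBoundedOpen Ω) :
    ∃ C : ℝ, 0 < C ∧ ∀ u : H1 Ω, ‖trace Ω u‖ ^ 2 ≤ C * (‖toL2 Ω u‖ * ‖u‖) := by
  obtain ⟨C, hC, hCb⟩ := hΩ.exists_surface_bound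
  refine ⟨C, hC, fun u => ?_⟩
  have hf : Continuous fun u : H1 Ω => ‖trace Ω u‖ ^ 2 := (trace Ω).continuous.norm.pow 2
  have hg : Continuous fun u : H1 Ω => C * (‖toL2 Ω u‖ * ‖u‖) :=
    continuous_const.mul ((toL2 Ω).continuous.norm.mul continuous_norm)
  exact hΩ.le_of_smooth hf hg (fun v φ h1 _ h3 _ => hCb v φ h1.continuous h3 _
    (hΩ.isTraceOperator_trace v φ h1 h3)) u

/-! ### Weak convergence in a Hilbert space -/

section Hilbert

variable {H : Type*} [NormedAddCommGroup H] [InnerProductSpace ℝ H]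

theorem weaklyNull_of_tendsto {w : ℕ → H} (h : Tendsto w atTop (𝓝 0)) : WeaklyNull w := by
  intro ℓ
  have := (ℓ.continuous.tendsto 0).comp h
  rwa [map_zero] at this

variable [CompleteSpace H]

theorem weaklyNull_iff_inner {w : ℕ → H} :
    WeaklyNull w ↔ ∀ φ : H, Tendsto (fun n => inner ℝ (w n) φ) atTop (𝓝 0) := by
  constructor
  · intro h φ
    refine (h (innerSL ℝ φ)).congr fun n => ?_
    rw [innerSL_apply_apply, real_inner_comm]
  · intro h ℓ
    refine (h ((InnerProductSpace.toDual ℝ H).symm ℓ)).congr fun n => ?_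
    rw [real_inner_comm, InnerProductSpace.toDual_symm_apply]

theorem WeaklyNull.tendsto_inner {w : ℕ → H} {w₀ : H} (h : WeaklyNull fun n => w n - w₀) (φ : H) :
    Tendsto (fun n => inner ℝ (w n) φ) atTop (𝓝 (inner ℝ w₀ φ)) := by
  have h1 := (weaklyNull_iff_inner.1 h φ).add_const (inner ℝ w₀ φ)
  rw [zero_add] at h1
  refine h1.congr fun n => ?_
  rw [inner_sub_left, sub_add_cancel]

/-- Bounded sequences in a separable Hilbert space have weakly convergent subsequences. -/
theorem exists_weaklyNull_subseq [SecondCountableTopology H] {w : ℕ → H} {M : ℝ}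
    (hM : ∀ n, ‖w n‖ ≤ M) : ∃ (w₀ : H) (m : ℕ → ℕ), StrictMono m ∧
      WeaklyNull fun n => w (m n) - w₀ := by
  have hc := WeakDual.isSeqCompact_closedBall ℝ H 0 M
  obtain ⟨ℓ, -, m, hm, h⟩ := hc (x := fun n => StrongDual.toWeakDual (innerSL ℝ (w n))) (fun n => by
    simpa using hM n)
  refine ⟨(InnerProductSpace.toDual ℝ H).symm (WeakDual.toStrongDual ℓ), m, hm, ?_⟩
  rw [weaklyNull_iff_inner]
  intro φ
  have h1 := ((WeakDual.eval_continuous φ).tendsto ℓ).comp h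
  have h2 := h1.sub_const (ℓ φ)
  rw [sub_self] at h2
  refine h2.congr fun n => ?_
  rw [inner_sub_left, InnerProductSpace.toDual_symm_apply]
  rfl

/-- Weakly convergent sequences are bounded, by the uniform boundedness principle. -/
theorem WeaklyNull.exists_bound {w : ℕ → H} {w₀ : H} (h : WeaklyNull fun n => w n - w₀) :
    ∃ B : ℝ, ∀ n, ‖w n‖ ≤ B := by
  obtain ⟨B, hB⟩ := banach_steinhaus (g := fun n => innerSL ℝ (w n)) fun φ => by
    obtain ⟨C, hC⟩ := (h.tendsto_inner φ).norm.bddAbove_range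
    exact ⟨C, fun n => hC ⟨n, rfl⟩⟩
  refine ⟨B, fun n => ?_⟩
  rw [← innerSL_apply_norm ℝ (w n)]
  exact hB n

/-- A sequence converges in norm, if it may be tested with weakly convergent sequences. -/
theorem tendsto_of_weak_test {x : ℕ → H} {x₀ : H}
    (h : ∀ (φ : ℕ → H) (φ₀ : H), (WeaklyNull fun n => φ n - φ₀) →
      Tendsto (fun n => inner ℝ (x n) (φ n)) atTop (𝓝 (inner ℝ x₀ φ₀))) :
    Tendsto x atTop (𝓝 x₀) := by
  have h1 : ∀ φ : H, Tendsto (fun n => inner ℝ (x n) φ) atTop (𝓝 (inner ℝ x₀ φ)) := fun φ =>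
    h (fun _ => φ) φ (weaklyNull_of_tendsto (by simp))
  have h2 : WeaklyNull fun n => x n - x₀ := by
    rw [weaklyNull_iff_inner]
    intro φ
    have := (h1 φ).sub_const (inner ℝ x₀ φ)
    rw [sub_self] at this
    refine this.congr fun n => ?_
    rw [inner_sub_left]
  -- testing with `x` itself shows that the norms converge, too
  have h3 := h x x₀ h2
  have h4 := (h3.sub ((h1 x₀).const_mul 2)).add_const (inner ℝ x₀ x₀)
  have h5 : Tendsto (fun n => ‖x n - x₀‖ ^ 2) atTop (𝓝 0) := by
    have e : inner ℝ x₀ x₀ - 2 * inner ℝ x₀ x₀ + inner ℝ x₀ x₀ = (0 : ℝ) := by ring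
    rw [e] at h4
    refine h4.congr fun n => ?_
    rw [norm_sub_sq_real, real_inner_self_eq_norm_sq, real_inner_self_eq_norm_sq]
  rw [tendsto_iff_norm_sub_tendsto_zero]
  have h6 := h5.sqrt
  simpa using h6

end Hilbert

/-! ### Perturbation of nondegenerate solutions of `A u = N₀ u` -/

section Perturbation

variable {H : Type*} [NormedAddCommGroup H] [InnerProductSpace ℝ H]

/-- The maps `N i` on `H` are uniformly bounded, converge to `N₀` along weakly convergent sequences,
and are close to the linear map `D u₀` near `u₀`, in the `C¹` sense and uniformly in `i`. -/
structure IsCompactFamily {ι : Type*} (l : Filter ι) (N : ι → H → H) (N₀ : H → H)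
    (D : H → H →L[ℝ] H) : Prop where
  bound : ∃ M : ℝ, ∀ᶠ i in l, ∀ u, ‖N i u‖ ≤ M
  weak : ∀ i : ℕ → ι, Tendsto i atTop l → ∀ (u : ℕ → H) (u₀ : H), (WeaklyNull fun n => u n - u₀) →
    Tendsto (fun n => N (i n) (u n)) atTop (𝓝 (N₀ u₀))
  linearization : ∀ u₀ : H, ∀ c : ℝ, 0 < c → ∀ᶠ p : ι × H × H in l ×ˢ 𝓝 u₀ ×ˢ 𝓝 u₀,
    ‖N p.1 p.2.1 - N p.1 p.2.2 - D u₀ (p.2.1 - p.2.2)‖ ≤ c * ‖p.2.1 - p.2.2‖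

theorem IsCompactFamily.add {ι : Type*} {l : Filter ι} {N N' : ι → H → H} {N₀ N₀' : H → H}
    {D D' : H → H →L[ℝ] H} (h : IsCompactFamily l N N₀ D) (h' : IsCompactFamily l N' N₀' D') :
    IsCompactFamily l (fun i u => N i u + N' i u) (fun u => N₀ u + N₀' u)
      (fun u => D u + D' u) where
  bound := by
    obtain ⟨M, hM⟩ := h.bound
    obtain ⟨M', hM'⟩ := h'.bound
    refine ⟨M + M', ?_⟩
    filter_upwards [hM, hM'] with i h1 h2 u
    exact (norm_add_le _ _).trans (add_le_add (h1 u) (h2 u))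
  weak i hi u u₀ hu := (h.weak i hi u u₀ hu).add (h'.weak i hi u u₀ hu)
  linearization u₀ c hc := by
    filter_upwards [h.linearization u₀ (c / 2) (by linarith),
      h'.linearization u₀ (c / 2) (by linarith)] with p h1 h2
    have e : N p.1 p.2.1 + N' p.1 p.2.1 - (N p.1 p.2.2 + N' p.1 p.2.2) -
        (D u₀ + D' u₀) (p.2.1 - p.2.2) = (N p.1 p.2.1 - N p.1 p.2.2 - D u₀ (p.2.1 - p.2.2)) +
          (N' p.1 p.2.1 - N' p.1 p.2.2 - D' u₀ (p.2.1 - p.2.2)) := by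
      rw [add_apply]
      abel
    rw [e]
    exact (norm_add_le _ _).trans (by linarith)

namespace IsCompactFamily

variable {ι : Type*} {l : Filter ι} {N : ι → H → H} {N₀ : H → H} {D : H → H →L[ℝ] H}
  {A : H →L[ℝ] H}

/-- The linearization as a statement about a ball around `u₀`. -/
theorem exists_radius (h : IsCompactFamily l N N₀ D) (u₀ : H) {c : ℝ} (hc : 0 < c) :
    ∃ δ : ℝ, 0 < δ ∧ ∀ᶠ i in l, ∀ u ∈ Metric.closedBall u₀ δ, ∀ v ∈ Metric.closedBall u₀ δ,
      ‖N i u - N i v - D u₀ (u - v)‖ ≤ c * ‖u - v‖ := by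
  obtain ⟨p, hp, q, hq, hpq⟩ := eventually_prod_iff.1 (h.linearization u₀ c hc)
  obtain ⟨s, hs, hs2⟩ := eventually_prod_self_iff
    (r := fun u v => q (u, v)).1 hq
  obtain ⟨δ, hδ, hδ2⟩ := Metric.nhds_basis_closedBall.mem_iff.1 hs
  exact ⟨δ, hδ, hp.mono fun i hi u hu v hv => hpq hi (hs2 u (hδ2 hu) v (hδ2 hv))⟩

variable [CompleteSpace H]

/-- Near a nondegenerate solution `u₀` of the limit problem, the equation `A u = N i u` has exactly
one solution: there is a solution in arbitrarily small balls about `u₀`, and uniqueness holds in a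
ball of fixed radius `r`. Here `R` is the inverse of `A - D u₀`. -/
theorem eventually_existsUnique [l.IsCountablyGenerated] (h : IsCompactFamily l N N₀ D) {u₀ : H}
    (hu₀ : A u₀ = N₀ u₀) {R : H →L[ℝ] H} (hR1 : ∀ w, R (A w - D u₀ w) = w)
    (hR2 : ∀ w, A (R w) - D u₀ (R w) = w) :
    ∃ r : ℝ, 0 < r ∧ ∀ δ : ℝ, 0 < δ → δ ≤ r → ∀ᶠ i in l,
      (∃ u ∈ Metric.closedBall u₀ δ, A u = N i u) ∧
      ∀ u ∈ Metric.closedBall u₀ r, ∀ v ∈ Metric.closedBall u₀ r, A u = N i u → A v = N i v →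
        u = v := by
  have hρ : 0 < 2 * (‖R‖ + 1) := by positivity
  obtain ⟨r, hr, hlip⟩ := h.exists_radius u₀ (inv_pos.2 hρ)
  refine ⟨r, hr, fun δ hδ hδr => ?_⟩
  have hN : Tendsto (fun i => N i u₀) l (𝓝 (N₀ u₀)) := tendsto_of_seq_tendsto fun i hi =>
    h.weak i hi (fun _ => u₀) u₀ (weaklyNull_of_tendsto (by simp))
  have hN2 : Tendsto (fun i => R (A u₀ - N i u₀)) l (𝓝 0) := by
    have h1 := (R.continuous.tendsto _).comp (hN.const_sub (A u₀))
    rwa [hu₀, sub_self, map_zero, ← hu₀] at h1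
  have hsmall := (hN2.norm).eventually
    (gt_mem_nhds (show ‖(0 : H)‖ < δ / 2 by rw [norm_zero]; linarith))
  filter_upwards [hlip, hsmall] with i hi hi2
  -- the simplified Newton map `Ψ` has the solutions as fixed points
  set Ψ : H → H := fun u => u - R (A u - N i u) with hΨ
  have hcontr : ∀ u ∈ Metric.closedBall u₀ r, ∀ v ∈ Metric.closedBall u₀ r,
      ‖Ψ u - Ψ v‖ ≤ 1 / 2 * ‖u - v‖ := by
    intro u hu v hv
    have e : Ψ u - Ψ v = R (N i u - N i v - D u₀ (u - v)) := by
      have e1 := hR1 (u - v)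
      have e2 : N i u - N i v - D u₀ (u - v) =
          (A (u - v) - D u₀ (u - v)) - ((A u - N i u) - (A v - N i v)) := by
        rw [map_sub A]
        abel
      rw [e2, map_sub R, e1, map_sub R, hΨ]
      simp only
      abel
    rw [e]
    refine (R.le_opNorm _).trans
      ((mul_le_mul_of_nonneg_left (hi u hu v hv) (norm_nonneg _)).trans ?_)
    rw [← mul_assoc]
    refine mul_le_mul_of_nonneg_right ?_ (norm_nonneg _)
    rw [← div_eq_mul_inv, div_le_iff₀ hρ]
    linarith [norm_nonneg R]
  have hfix : ∀ u, Ψ u = u ↔ A u = N i u := by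
    intro u
    rw [hΨ]
    simp only
    rw [sub_eq_self]
    constructor
    · intro h0
      have h1 := hR2 (A u - N i u)
      rw [h0, map_zero, map_zero, sub_zero] at h1
      exact sub_eq_zero.1 h1.symm
    · intro h0
      rw [h0, sub_self, map_zero]
  have hsub : Metric.closedBall u₀ δ ⊆ Metric.closedBall u₀ r :=
    Metric.closedBall_subset_closedBall hδr
  constructor
  · have hmaps : MapsTo Ψ (Metric.closedBall u₀ δ) (Metric.closedBall u₀ δ) := by
      intro u hu
      have h1 := hcontr u (hsub hu) u₀ (Metric.mem_closedBall_self hr.le)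
      have h2 : ‖Ψ u₀ - u₀‖ < δ / 2 := by
        rw [hΨ]
        simp only
        rwa [sub_sub_cancel_left, norm_neg]
      rw [Metric.mem_closedBall, dist_eq_norm] at hu ⊢
      calc ‖Ψ u - u₀‖ = ‖(Ψ u - Ψ u₀) + (Ψ u₀ - u₀)‖ := by rw [sub_add_sub_cancel]
        _ ≤ 1 / 2 * ‖u - u₀‖ + δ / 2 := (norm_add_le _ _).trans (add_le_add h1 h2.le)
        _ ≤ δ := by linarith
    have hctr : ContractingWith (1 / 2) (hmaps.restrict Ψ _ _) := by
      refine ⟨by rw [← NNReal.coe_lt_coe]; norm_num, LipschitzWith.of_dist_le_mul fun u v => ?_⟩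
      rw [Subtype.dist_eq, Subtype.dist_eq, dist_eq_norm, dist_eq_norm]
      refine (hcontr u (hsub u.2) v (hsub v.2)).trans (le_of_eq ?_)
      norm_num
    obtain ⟨u, hu, hu2, -⟩ := hctr.exists_fixedPoint' Metric.isClosed_closedBall.isComplete
      hmaps (Metric.mem_closedBall_self hδ.le) (edist_ne_top _ _)
    exact ⟨u, hu, (hfix u).1 hu2⟩
  · intro u hu v hv h1 h2
    have h3 := hcontr u hu v hv
    rw [(hfix u).2 h1, (hfix v).2 h2] at h3
    have h4 : ‖u - v‖ = 0 := by linarith [norm_nonneg (u - v)]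
    exact sub_eq_zero.1 (norm_eq_zero.1 h4)

variable [SecondCountableTopology H]

/-- Solutions `u n` of `A u = N (i n) u` subconverge to solutions of the limit problem: they are
bounded, hence converge weakly along a subsequence, the right-hand sides converge in norm, and `A`
is bounded from below. -/
theorem exists_subseq_tendsto (h : IsCompactFamily l N N₀ D) {c : ℝ} (hc : 0 < c)
    (hA : ∀ u, c * ‖u‖ ^ 2 ≤ inner ℝ (A u) u) {i : ℕ → ι} (hi : Tendsto i atTop l) {u : ℕ → H}
    (hu : ∀ n, A (u n) = N (i n) (u n)) :
    ∃ (u₀ : H) (m : ℕ → ℕ), StrictMono m ∧ A u₀ = N₀ u₀ ∧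
      Tendsto (fun n => u (m n)) atTop (𝓝 u₀) := by
  obtain ⟨M, hM⟩ := h.bound
  obtain ⟨k, hk⟩ := eventually_atTop.1 (hi.eventually hM)
  have hAl : ∀ v, c * ‖v‖ ≤ ‖A v‖ := by
    intro v
    rcases eq_or_lt_of_le (norm_nonneg v) with h0 | h0
    · rw [← h0, mul_zero]
      exact norm_nonneg _
    · have h1 := (hA v).trans (real_inner_le_norm _ _)
      rw [pow_two, ← mul_assoc] at h1
      exact le_of_mul_le_mul_right h1 h0
  have hb : ∀ n, ‖u (n + k)‖ ≤ M / c := by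
    intro n
    rw [le_div_iff₀' hc]
    refine (hAl _).trans ?_
    rw [hu]
    exact hk _ (by omega) _
  obtain ⟨u₀, m, hm, hw⟩ := exists_weaklyNull_subseq hb
  have hm' : StrictMono fun n => m n + k := fun a b hab => Nat.add_lt_add_right (hm hab) k
  have hconv := h.weak (fun n => i (m n + k)) (hi.comp hm'.tendsto_atTop)
    (fun n => u (m n + k)) u₀ hw
  have hAc : CauchySeq fun n => A (u (m n + k)) := by
    simp only [hu]
    exact hconv.cauchySeq
  have hanti : AntilipschitzWith (Real.toNNReal c⁻¹) A := by
    refine AntilipschitzWith.of_le_mul_dist fun v w => ?_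
    rw [Real.coe_toNNReal _ (inv_pos.2 hc).le, dist_eq_norm, dist_eq_norm, ← map_sub,
      ← div_eq_inv_mul, le_div_iff₀' hc]
    exact hAl _
  obtain ⟨u', hu'⟩ := cauchySeq_tendsto_of_complete
    ((hanti.isUniformInducing A.uniformContinuous).cauchy_map_iff.1 hAc)
  have e : u' = u₀ := by
    refine ext_inner_right ℝ fun φ => ?_
    exact tendsto_nhds_unique (hu'.inner tendsto_const_nhds) (hw.tendsto_inner φ)
  subst e
  refine ⟨u', fun n => m n + k, hm', ?_, hu'⟩
  refine tendsto_nhds_unique ((A.continuous.tendsto u').comp hu') (hconv.congr fun n => ?_)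
  exact (hu _).symm

/-- Infinitely many solutions would accumulate at a solution, which is isolated by nondegeneracy.
-/
theorem finite_solutions [l.NeBot] [l.IsCountablyGenerated]
    (h : IsCompactFamily l (fun _ : ι => N₀) N₀ D) {c : ℝ} (hc : 0 < c)
    (hA : ∀ u, c * ‖u‖ ^ 2 ≤ inner ℝ (A u) u)
    (hinv : ∀ u, A u = N₀ u → ∃ R : H →L[ℝ] H, (∀ w, R (A w - D u w) = w) ∧
      ∀ w, A (R w) - D u (R w) = w) : {u | A u = N₀ u}.Finite := by
  by_contra hinf
  set f := Set.Infinite.natEmbedding _ hinf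
  obtain ⟨i, hi⟩ := exists_seq_tendsto l
  obtain ⟨u₀, m, hm, hu₀, hlim⟩ := h.exists_subseq_tendsto hc hA hi
    (u := fun n => (f n : H)) (fun n => (f n).2)
  obtain ⟨R, hR1, hR2⟩ := hinv u₀ hu₀
  obtain ⟨r, hr, hex⟩ := h.eventually_existsUnique hu₀ hR1 hR2
  obtain ⟨-, -, huniq⟩ := (hex r hr le_rfl).exists
  obtain ⟨k, hk⟩ := eventually_atTop.1 (hlim.eventually (Metric.closedBall_mem_nhds u₀ hr))
  have h1 := huniq _ (hk k le_rfl) _ (hk (k + 1) (by omega)) (f _).2 (f _).2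
  have h2 := hm.injective (f.injective (Subtype.ext h1))
  omega

/-- If every solution of the limit problem is nondegenerate, then there are finitely many of them,
and each of them is the limit of one solution of the approximate problems; these have no other
solutions. -/
theorem exists_solutions [l.NeBot] [l.IsCountablyGenerated] (h : IsCompactFamily l N N₀ D)
    (h₀ : IsCompactFamily l (fun _ : ι => N₀) N₀ D) {c : ℝ} (hc : 0 < c)
    (hA : ∀ u, c * ‖u‖ ^ 2 ≤ inner ℝ (A u) u)
    (hinv : ∀ u, A u = N₀ u → ∃ R : H →L[ℝ] H, (∀ w, R (A w - D u w) = w) ∧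
      ∀ w, A (R w) - D u (R w) = w) :
    ∃ (k : ℕ) (u₀ : Fin k → H), Function.Injective u₀ ∧ range u₀ = {u | A u = N₀ u} ∧
      ∃ u : ι → Fin k → H, (∀ᶠ i in l, Function.Injective (u i) ∧
        range (u i) = {v | A v = N i v}) ∧ ∀ j, Tendsto (fun i => u i j) l (𝓝 (u₀ j)) := by
  classical
  have hfin := h₀.finite_solutions hc hA hinv
  have : Finite {u | A u = N₀ u} := hfin
  obtain ⟨k, ⟨e⟩⟩ := Finite.exists_equiv_fin {u | A u = N₀ u}
  set u₀ : Fin k → H := fun j => (e.symm j : H) with hu₀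
  have hsol : ∀ j, A (u₀ j) = N₀ (u₀ j) := fun j => (e.symm j).2
  have hinj : Function.Injective u₀ := Subtype.val_injective.comp e.symm.injective
  have hrange : range u₀ = {u | A u = N₀ u} := by
    rw [hu₀, range_comp', e.symm.surjective.range_eq, image_univ, Subtype.range_coe]
  refine ⟨k, u₀, hinj, hrange, ?_⟩
  have hloc : ∀ j, ∃ r : ℝ, 0 < r ∧ ∀ δ : ℝ, 0 < δ → δ ≤ r → ∀ᶠ i in l,
      (∃ u ∈ Metric.closedBall (u₀ j) δ, A u = N i u) ∧
      ∀ u ∈ Metric.closedBall (u₀ j) r, ∀ v ∈ Metric.closedBall (u₀ j) r, A u = N i u →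
        A v = N i v → u = v := fun j =>
    (hinv _ (hsol j)).elim fun R hR => h.eventually_existsUnique (hsol j) hR.1 hR.2
  choose r hr hex using hloc
  -- a radius for which the balls about the solutions are disjoint
  obtain ⟨δ, hδ0, hδ⟩ : ∃ δ : ℝ, 0 < δ ∧
      ∀ j, δ ≤ r j ∧ ∀ j', j ≠ j' → 2 * δ < dist (u₀ j) (u₀ j') := by
    have h1 : ∀ᶠ δ : ℝ in 𝓝[>] 0, ∀ j, δ ≤ r j ∧ ∀ j', j ≠ j' → 2 * δ < dist (u₀ j) (u₀ j') := by
      rw [eventually_all]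
      intro j
      refine Filter.Eventually.and ?_ (eventually_all.2 fun j' => ?_)
      · filter_upwards [Ioo_mem_nhdsGT (hr j)] with δ hδ using hδ.2.le
      · by_cases hj : j = j'
        · exact Eventually.of_forall fun δ h => absurd hj h
        · have hd : 0 < dist (u₀ j) (u₀ j') / 2 := half_pos (dist_pos.2 (hinj.ne hj))
          filter_upwards [Ioo_mem_nhdsGT hd] with δ hδ _
          linarith [hδ.2]
    obtain ⟨δ, h2, h3⟩ := (h1.and self_mem_nhdsWithin).exists
    exact ⟨δ, h3, h2⟩
  -- solutions away from all the `u₀ j` would subconverge to a further solution of the limit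
  -- problem
  have hcover : ∀ᶠ i in l, ∀ v, A v = N i v → ∃ j, v ∈ Metric.closedBall (u₀ j) δ := by
    by_contra hcon
    rw [not_eventually] at hcon
    obtain ⟨i, hi, hi2⟩ := exists_seq_forall_of_frequently hcon
    push Not at hi2
    choose v hv hv2 using hi2
    obtain ⟨w, m, hm, hw, hlim⟩ := h.exists_subseq_tendsto hc hA hi hv
    obtain ⟨j, rfl⟩ : w ∈ range u₀ := by
      rw [hrange]
      exact hw
    obtain ⟨n, hn⟩ := (hlim.eventually (Metric.closedBall_mem_nhds _ hδ0)).exists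
    exact hv2 (m n) j hn
  have hall : ∀ᶠ i in l, ∀ j, (∃ u ∈ Metric.closedBall (u₀ j) δ, A u = N i u) ∧
      ∀ u ∈ Metric.closedBall (u₀ j) (r j), ∀ v ∈ Metric.closedBall (u₀ j) (r j), A u = N i u →
        A v = N i v → u = v := eventually_all.2 fun j => hex j δ hδ0 (hδ j).1
  set u : ι → Fin k → H := fun i j =>
    if hu : ∃ u ∈ Metric.closedBall (u₀ j) δ, A u = N i u then hu.choose else 0 with hudef
  have huspec : ∀ i j, (∃ u ∈ Metric.closedBall (u₀ j) δ, A u = N i u) →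
      u i j ∈ Metric.closedBall (u₀ j) δ ∧ A (u i j) = N i (u i j) := by
    intro i j hu
    have e1 : u i j = hu.choose := by
      rw [hudef]
      exact dif_pos hu
    rw [e1]
    exact hu.choose_spec
  refine ⟨u, ?_, fun j => ?_⟩
  · filter_upwards [hcover, hall] with i hc1 hc2
    constructor
    · intro j j' hjj
      by_contra hne
      have h1 := Metric.mem_closedBall.1 (huspec i j (hc2 j).1).1
      have h2 := Metric.mem_closedBall.1 (huspec i j' (hc2 j').1).1
      rw [← hjj] at h2
      linarith [(hδ j).2 j' hne, dist_triangle_left (u₀ j) (u₀ j') (u i j)]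
    · ext v
      constructor
      · rintro ⟨j, rfl⟩
        exact (huspec i j (hc2 j).1).2
      · intro hv
        obtain ⟨j, hj⟩ := hc1 v hv
        have hsub := Metric.closedBall_subset_closedBall (x := u₀ j) (hδ j).1
        exact ⟨j, (hc2 j).2 _ (hsub (huspec i j (hc2 j).1).1) v (hsub hj)
          (huspec i j (hc2 j).1).2 hv⟩
  · rw [Metric.tendsto_nhds]
    intro ε hε
    have hδ' : 0 < min δ (ε / 2) := lt_min hδ0 (by linarith)
    filter_upwards [hall, hex j _ hδ' ((min_le_left _ _).trans (hδ j).1)] with i h1 h2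
    obtain ⟨⟨v, hv, hv2⟩, -⟩ := h2
    have hsub := Metric.closedBall_subset_closedBall (x := u₀ j) (hδ j).1
    have hsub' := Metric.closedBall_subset_closedBall (x := u₀ j)
      ((min_le_left δ (ε / 2)).trans (hδ j).1)
    have e1 := (h1 j).2 _ (hsub (huspec i j (h1 j).1).1) v (hsub' hv) (huspec i j (h1 j).1).2 hv2
    rw [e1]
    exact (Metric.mem_closedBall.1 hv).trans_lt ((min_le_right _ _).trans_lt (by linarith))

end IsCompactFamily

end Perturbation

/-! ### Multiplication and superposition operators in `L²` -/

section LpOperators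

variable {α : Type*} [MeasurableSpace α] {μ : Measure α} {K : ℝ}

section Multiplication

variable {F : Type*} [NormedAddCommGroup F] [NormedSpace ℝ F] {q : α → ℝ}

theorem memLp_bounded_smul (hm : AEStronglyMeasurable q μ) (hq : ∀ᵐ x ∂μ, |q x| ≤ K)
    (v : Lp F 2 μ) : MemLp (fun x => q x • v x) 2 μ := by
  refine (Lp.memLp v).of_le_mul (c := K) (hm.smul (Lp.aestronglyMeasurable v)) ?_
  filter_upwards [hq] with x hx
  rw [norm_smul]
  exact mul_le_mul_of_nonneg_right hx (norm_nonneg _)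

/-- Multiplication with the bounded function `q` in `L²`. -/
def mulLp (hm : AEStronglyMeasurable q μ) (hq : ∀ᵐ x ∂μ, |q x| ≤ K) : Lp F 2 μ →L[ℝ] Lp F 2 μ :=
  LinearMap.mkContinuous
    { toFun := fun v => (memLp_bounded_smul hm hq v).toLp
      map_add' := fun v w => by
        rw [← MemLp.toLp_add]
        refine MemLp.toLp_congr _ _ ?_
        filter_upwards [Lp.coeFn_add v w] with x hx
        rw [hx, Pi.add_apply, Pi.add_apply, smul_add]
      map_smul' := fun r v => by
        rw [RingHom.id_apply, ← MemLp.toLp_const_smul]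
        refine MemLp.toLp_congr _ _ ?_
        filter_upwards [Lp.coeFn_smul r v] with x hx
        rw [hx, Pi.smul_apply, Pi.smul_apply, smul_comm] }
    K fun v => by
      refine Lp.norm_le_mul_norm_of_ae_le_mul ?_
      filter_upwards [(memLp_bounded_smul hm hq v).coeFn_toLp, hq] with x h1 h2
      rw [LinearMap.coe_mk, AddHom.coe_mk, h1, norm_smul]
      exact mul_le_mul_of_nonneg_right h2 (norm_nonneg _)

theorem coeFn_mulLp (hm : AEStronglyMeasurable q μ) (hq : ∀ᵐ x ∂μ, |q x| ≤ K) (v : Lp F 2 μ) :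
    mulLp hm hq v =ᵐ[μ] fun x => q x • v x := (memLp_bounded_smul hm hq v).coeFn_toLp

theorem norm_mulLp_le (hm : AEStronglyMeasurable q μ) (hq : ∀ᵐ x ∂μ, |q x| ≤ K) (v : Lp F 2 μ) :
    ‖mulLp hm hq v‖ ≤ K * ‖v‖ := by
  refine Lp.norm_le_mul_norm_of_ae_le_mul ?_
  filter_upwards [coeFn_mulLp hm hq v, hq] with x h1 h2
  rw [h1, norm_smul]
  exact mul_le_mul_of_nonneg_right h2 (norm_nonneg _)

end Multiplication

/-- `h` is bounded and Lipschitz continuous, both with constant `K`. -/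
structure IsBoundedLipschitz (K : ℝ) (h : ℝ → ℝ) : Prop where
  bound : ∀ s, |h s| ≤ K
  lip : ∀ s t, |h s - h t| ≤ K * |s - t|

variable {h : ℝ → ℝ}

theorem IsBoundedLipschitz.nonneg (hh : IsBoundedLipschitz K h) : 0 ≤ K :=
  (abs_nonneg _).trans (hh.bound 0)

theorem IsBoundedLipschitz.continuous (hh : IsBoundedLipschitz K h) : Continuous h := by
  have : LipschitzWith (Real.toNNReal K) h := LipschitzWith.of_dist_le_mul fun s t => by
    rw [Real.coe_toNNReal _ hh.nonneg, Real.dist_eq, Real.dist_eq]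
    exact hh.lip s t
  exact this.continuous

theorem IsBoundedLipschitz.aestronglyMeasurable (hh : IsBoundedLipschitz K h) (v : Lp ℝ 2 μ) :
    AEStronglyMeasurable (fun x => h (v x)) μ :=
  hh.continuous.comp_aestronglyMeasurable (Lp.aestronglyMeasurable v)

/-- Multiplication with the function `h ∘ v` in `L²`. -/
def mulComp (hh : IsBoundedLipschitz K h) (v : Lp ℝ 2 μ) : Lp ℝ 2 μ →L[ℝ] Lp ℝ 2 μ :=
  mulLp (hh.aestronglyMeasurable v) (ae_of_all _ fun x => hh.bound (v x))

theorem coeFn_mulComp (hh : IsBoundedLipschitz K h) (v w : Lp ℝ 2 μ) :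
    mulComp hh v w =ᵐ[μ] fun x => h (v x) * w x := coeFn_mulLp _ _ w

theorem norm_mulComp_le (hh : IsBoundedLipschitz K h) (v w : Lp ℝ 2 μ) :
    ‖mulComp hh v w‖ ≤ K * ‖w‖ := norm_mulLp_le _ _ w

/-- The multiplication operator depends continuously on `v` only when applied to bounded functions.
-/
theorem norm_mulComp_sub_le (hh : IsBoundedLipschitz K h) (v v' w : Lp ℝ 2 μ) {B : ℝ}
    (hw : ∀ᵐ x ∂μ, |w x| ≤ B) : ‖mulComp hh v w - mulComp hh v' w‖ ≤ K * B * ‖v - v'‖ := by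
  refine Lp.norm_le_mul_norm_of_ae_le_mul ?_
  filter_upwards [Lp.coeFn_sub (mulComp hh v w) (mulComp hh v' w), coeFn_mulComp hh v w,
    coeFn_mulComp hh v' w, Lp.coeFn_sub v v', hw] with x h1 h2 h3 h4 h5
  rw [h1, h4, Pi.sub_apply, Pi.sub_apply, h2, h3, ← sub_mul, Real.norm_eq_abs, Real.norm_eq_abs,
    abs_mul]
  calc |h (v x) - h (v' x)| * |w x| ≤ (K * |v x - v' x|) * B :=
        mul_le_mul (hh.lip _ _) h5 (abs_nonneg _) (mul_nonneg hh.nonneg (abs_nonneg _))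
    _ = K * B * |v x - v' x| := by ring

theorem inner_mulComp (hh : IsBoundedLipschitz K h) (v w z : Lp ℝ 2 μ) :
    inner ℝ (mulComp hh v w) z = ∫ x, h (v x) * w x * z x ∂μ := by
  rw [L2.inner_def]
  apply integral_congr_ae
  filter_upwards [coeFn_mulComp hh v w] with x hx
  rw [hx, RCLike.inner_apply, conj_trivial, mul_comm]

variable [IsFiniteMeasure μ]

theorem IsBoundedLipschitz.memLp (hh : IsBoundedLipschitz K h) (v : Lp ℝ 2 μ) :
    MemLp (fun x => h (v x)) 2 μ :=
  MemLp.of_bound (hh.aestronglyMeasurable v) K (ae_of_all _ fun x => hh.bound (v x))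

/-- The superposition `h ∘ v` in `L²`. -/
def compLp (hh : IsBoundedLipschitz K h) (v : Lp ℝ 2 μ) : Lp ℝ 2 μ := (hh.memLp v).toLp

theorem coeFn_compLp (hh : IsBoundedLipschitz K h) (v : Lp ℝ 2 μ) :
    compLp hh v =ᵐ[μ] fun x => h (v x) := (hh.memLp v).coeFn_toLp

theorem norm_compLp_le (hh : IsBoundedLipschitz K h) (v : Lp ℝ 2 μ) {m : ℝ}
    (hm : μ.real univ ≤ m) : ‖compLp hh v‖ ≤ √m * K := by
  have h1 : ‖compLp hh v‖ ^ 2 ≤ m * K ^ 2 := by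
    rw [← real_inner_self_eq_norm_sq, L2.inner_def]
    calc ∫ x, inner ℝ (compLp hh v x) (compLp hh v x) ∂μ ≤ ∫ _, K ^ 2 ∂μ := by
          refine integral_mono_ae (L2.integrable_inner _ _) (integrable_const _) ?_
          filter_upwards [coeFn_compLp hh v] with x hx
          rw [real_inner_self_eq_norm_sq, hx]
          exact pow_le_pow_left₀ (norm_nonneg _) (hh.bound _) 2
      _ ≤ m * K ^ 2 := by
          rw [integral_const, smul_eq_mul]
          exact mul_le_mul_of_nonneg_right hm (sq_nonneg _)
  have hm0 : 0 ≤ m := measureReal_nonneg.trans hm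
  apply le_of_sq_le_sq _ (mul_nonneg (Real.sqrt_nonneg _) hh.nonneg)
  rwa [mul_pow, Real.sq_sqrt hm0]

theorem norm_compLp_sub_le (hh : IsBoundedLipschitz K h) (v w : Lp ℝ 2 μ) :
    ‖compLp hh v - compLp hh w‖ ≤ K * ‖v - w‖ := by
  refine Lp.norm_le_mul_norm_of_ae_le_mul ?_
  filter_upwards [Lp.coeFn_sub (compLp hh v) (compLp hh w), coeFn_compLp hh v, coeFn_compLp hh w,
    Lp.coeFn_sub v w] with x h1 h2 h3 h4
  rw [h1, h4, Pi.sub_apply, Pi.sub_apply, h2, h3]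
  exact hh.lip _ _

theorem inner_compLp (hh : IsBoundedLipschitz K h) (v z : Lp ℝ 2 μ) :
    inner ℝ (compLp hh v) z = ∫ x, h (v x) * z x ∂μ := by
  rw [L2.inner_def]
  apply integral_congr_ae
  filter_upwards [coeFn_compLp hh v] with x hx
  rw [hx, RCLike.inner_apply, conj_trivial, mul_comm]

/-- `g` is of class `C¹` and both `g` and `g'` are bounded and Lipschitz continuous. -/
structure IsRegular (K : ℝ) (g : ℝ → ℝ) : Prop where
  differentiable : Differentiable ℝ g
  self : IsBoundedLipschitz K g
  deriv : IsBoundedLipschitz K (deriv g)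

/-- The mean value inequality for `s ↦ g s - g' p s` on the interval between `a` and `b`. -/
theorem IsRegular.taylor_le {g : ℝ → ℝ} (hg : IsRegular K g) (a b p : ℝ) :
    |g a - g b - _root_.deriv g p * (a - b)| ≤ K * (|a - p| + |b - p|) * |a - b| := by
  have hd : ∀ s, HasDerivAt (fun s => g s - _root_.deriv g p * s)
      (_root_.deriv g s - _root_.deriv g p * 1) s := fun s =>
    (hg.differentiable s).hasDerivAt.fun_sub ((hasDerivAt_id' s).const_mul (_root_.deriv g p))
  have h1 := Convex.norm_image_sub_le_of_norm_hasDerivWithin_le (s := uIcc b a) (x := b) (y := a)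
    (C := K * (|a - p| + |b - p|)) (fun s _ => (hd s).hasDerivWithinAt) (fun s hs => by
      rw [mul_one]
      refine (hg.deriv.lip s p).trans (mul_le_mul_of_nonneg_left ?_ hg.deriv.nonneg)
      have h2 := neg_abs_le (a - p)
      have h3 := neg_abs_le (b - p)
      have h4 := le_abs_self (a - p)
      have h5 := le_abs_self (b - p)
      rw [abs_le]
      rcases mem_uIcc.1 hs with h | h <;> constructor <;>
        linarith [abs_nonneg (a - p), abs_nonneg (b - p), h.1, h.2])
    (convex_uIcc b a) left_mem_uIcc right_mem_uIcc
  rw [Real.norm_eq_abs, Real.norm_eq_abs] at h1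
  refine le_trans (le_of_eq ?_) h1
  congr 1
  ring

/-- A bound of the same remainder for points far from `p`. -/
theorem IsRegular.taylor_le' {g : ℝ → ℝ} (hg : IsRegular K g) (a b p : ℝ) :
    |g a - g b - _root_.deriv g p * (a - b)| ≤ 2 * K * |a - b| := by
  have h1 := hg.self.lip a b
  have h2 : |_root_.deriv g p * (a - b)| ≤ K * |a - b| := by
    rw [abs_mul]
    exact mul_le_mul_of_nonneg_right (hg.deriv.bound p) (abs_nonneg _)
  calc _ ≤ |g a - g b| + |_root_.deriv g p * (a - b)| := by
          simpa only [Real.norm_eq_abs] using norm_sub_le (g a - g b) (_root_.deriv g p * (a - b))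
    _ ≤ 2 * K * |a - b| := by linarith

/-- The remainder of the linearization of `v ↦ g ∘ v` in `L²`. In terms of the difference
`v - w = t • (y + z)` it is small where `z` is bounded, provided `v` and `w` are close to `p`; the
part of `y` costs only its norm. -/
theorem IsRegular.norm_remainder_le {g : ℝ → ℝ} (hg : IsRegular K g) (v w p y z : Lp ℝ 2 μ)
    {t B : ℝ} (ht : 0 ≤ t) (hB0 : 0 ≤ B) (hB : ∀ᵐ x ∂μ, |z x| ≤ B) (hvw : v - w = t • (y + z)) :
    ‖compLp hg.self v - compLp hg.self w - mulComp hg.deriv p (v - w)‖ ≤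
      t * (2 * K * ‖y‖ + K * B * (‖v - p‖ + ‖w - p‖)) := by
  have hK := hg.self.nonneg
  set Y : Lp ℝ 2 μ := t • ((2 * K) • |y| + (K * B) • (|v - p| + |w - p|)) with hY
  have h1 : ‖Y‖ ≤ t * (2 * K * ‖y‖ + K * B * (‖v - p‖ + ‖w - p‖)) := by
    rw [hY, norm_smul, Real.norm_eq_abs, abs_of_nonneg ht]
    refine mul_le_mul_of_nonneg_left ((norm_add_le _ _).trans ?_) ht
    rw [norm_smul, norm_smul, norm_abs_eq_norm, Real.norm_eq_abs, Real.norm_eq_abs,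
      abs_of_nonneg (by linarith : 0 ≤ 2 * K), abs_of_nonneg (mul_nonneg hK hB0)]
    refine add_le_add le_rfl
      (mul_le_mul_of_nonneg_left ((norm_add_le _ _).trans ?_) (by positivity))
    rw [norm_abs_eq_norm, norm_abs_eq_norm]
  refine le_trans (Lp.norm_le_norm_of_ae_le ?_) h1
  have e1 : (v - w : Lp ℝ 2 μ) =ᵐ[μ] fun x => t * (y x + z x) := by
    rw [hvw]
    filter_upwards [Lp.coeFn_smul t (y + z), Lp.coeFn_add y z] with x h2 h3
    rw [h2, Pi.smul_apply, h3, Pi.add_apply, smul_eq_mul]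
  have e2 : Y =ᵐ[μ] fun x => t * (2 * K * |y x| + K * B * (|v x - p x| + |w x - p x|)) := by
    filter_upwards [Lp.coeFn_smul t ((2 * K) • |y| + (K * B) • (|v - p| + |w - p|)),
      Lp.coeFn_add ((2 * K) • |y|) ((K * B) • (|v - p| + |w - p|)), Lp.coeFn_smul (2 * K) |y|,
      Lp.coeFn_smul (K * B) (|v - p| + |w - p|), Lp.coeFn_add |v - p| |w - p|, Lp.coeFn_abs y,
      Lp.coeFn_abs (v - p), Lp.coeFn_abs (w - p), Lp.coeFn_sub v p, Lp.coeFn_sub w p] with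
      x h2 h3 h4 h5 h6 h7 h8 h9 h10 h11
    rw [hY, h2, Pi.smul_apply, h3, Pi.add_apply, h4, h5, Pi.smul_apply, Pi.smul_apply, h6,
      Pi.add_apply, h7, h8, h9, h10, h11, Pi.sub_apply, Pi.sub_apply]
    rfl
  filter_upwards [Lp.coeFn_sub (compLp hg.self v - compLp hg.self w) (mulComp hg.deriv p (v - w)),
    Lp.coeFn_sub (compLp hg.self v) (compLp hg.self w), coeFn_compLp hg.self v,
    coeFn_compLp hg.self w, coeFn_mulComp hg.deriv p (v - w), Lp.coeFn_sub v w, e1, e2, hB] with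
    x h2 h3 h4 h5 h6 h7 h8 h9 h10
  rw [h2, Pi.sub_apply, h3, Pi.sub_apply, h4, h5, h6, h9, h7, Pi.sub_apply, Real.norm_eq_abs]
  refine le_trans ?_ (le_abs_self _)
  have h11 : |v x - w x| ≤ t * |y x| + t * |z x| := by
    rw [← Pi.sub_apply, ← h7, h8, abs_mul, abs_of_nonneg ht, ← mul_add]
    exact mul_le_mul_of_nonneg_left (abs_add_le _ _) ht
  set r := |g (v x) - g (w x) - _root_.deriv g (p x) * (v x - w x)| with hr
  set d := K * (|v x - p x| + |w x - p x|) with hd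
  have hd0 : 0 ≤ d := by positivity
  -- `r` has a bound that is small near `p` and one that is uniform; the latter is used for `y`,
  -- the former for the bounded function `z`
  have b1 : r ≤ d * |v x - w x| := hg.taylor_le _ _ _
  have b2 : r ≤ 2 * K * |v x - w x| := hg.taylor_le' _ _ _
  have b3 : r ≤ min d (2 * K) * (t * |y x| + t * |z x|) := by
    refine le_trans ?_ (mul_le_mul_of_nonneg_left h11 (le_min hd0 (by linarith)))
    rcases min_choice d (2 * K) with h | h <;> rw [h] <;> assumption
  calc r ≤ min d (2 * K) * (t * |y x|) + min d (2 * K) * (t * |z x|) := by rw [← mul_add]; exact b3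
    _ ≤ 2 * K * (t * |y x|) + d * (t * B) :=
        add_le_add (mul_le_mul_of_nonneg_right (min_le_right _ _) (by positivity))
          (mul_le_mul (min_le_left _ _) (mul_le_mul_of_nonneg_left h10 ht) (by positivity) hd0)
    _ = t * (2 * K * |y x| + K * B * (|v x - p x| + |w x - p x|)) := by rw [hd]; ring

end LpOperators

/-! ### Superposition operators along converging families of traces -/

section TraceFamilies

variable {H : Type*} [NormedAddCommGroup H] [InnerProductSpace ℝ H]
  {X : Type*} [TopologicalSpace X] [MeasurableSpace X]

/-- The operators `T i : H → L²(μ i)` are uniformly bounded and compact, also along `l`, and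
converge to `T₀ : H → L²(μ₀)` in the following sense: the measures converge weakly, and each `u`
in some dense set is mapped by all the operators to one and the same bounded continuous function. -/
structure IsTraceFamily {ι : Type*} (l : Filter ι) (μ : ι → Measure X)
    (T : ∀ i, H →L[ℝ] Lp ℝ 2 (μ i)) (μ₀ : Measure X) (T₀ : H →L[ℝ] Lp ℝ 2 μ₀) : Prop where
  bound : ∃ C : ℝ, 0 ≤ C ∧ ‖T₀‖ ≤ C ∧ ∀ᶠ i in l, ‖T i‖ ≤ C
  compact : ∀ i : ℕ → ι, Tendsto i atTop l → ∀ w : ℕ → H, WeaklyNull w →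
    Tendsto (fun n => ‖T (i n) (w n)‖) atTop (𝓝 0)
  compact₀ : ∀ w : ℕ → H, WeaklyNull w → Tendsto (fun n => T₀ (w n)) atTop (𝓝 0)
  dense : ∃ S : Set H, Dense S ∧ ∀ u ∈ S, ∃ ψ : X → ℝ, Continuous ψ ∧
    (∃ B : ℝ, 0 ≤ B ∧ ∀ x, |ψ x| ≤ B) ∧ (∀ i, T i u =ᵐ[μ i] ψ) ∧ T₀ u =ᵐ[μ₀] ψ
  conv : ∀ ψ : X → ℝ, Continuous ψ → Tendsto (fun i => ∫ x, ψ x ∂μ i) l (𝓝 (∫ x, ψ x ∂μ₀))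

/-- Convergence of uniformly Lipschitz functions on a dense set implies convergence everywhere. -/
theorem tendsto_of_dense_of_lipschitz {H : Type*} [SeminormedAddCommGroup H] {ι : Type*}
    {l : Filter ι} {F : ι → H → ℝ} {F₀ : H → ℝ} {S : Set H} (hS : Dense S) {L : ℝ} (hL : ∀ᶠ i in l, ∀ u v, |F i u - F i v| ≤ L * ‖u - v‖)
    (hL₀ : ∀ u v, |F₀ u - F₀ v| ≤ L * ‖u - v‖)
    (h : ∀ u ∈ S, Tendsto (fun i => F i u) l (𝓝 (F₀ u))) (u : H) :
    Tendsto (fun i => F i u) l (𝓝 (F₀ u)) := by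
  rw [Metric.tendsto_nhds]
  intro δ hδ
  have hL1 : 0 < |L| + 1 := by positivity
  obtain ⟨v, hv, hvS⟩ := hS.exists_dist_lt u (ε := δ / (3 * (|L| + 1))) (by positivity)
  have h1 : L * ‖u - v‖ ≤ δ / 3 := by
    rw [dist_eq_norm] at hvS
    calc L * ‖u - v‖ ≤ (|L| + 1) * ‖u - v‖ :=
          mul_le_mul_of_nonneg_right ((le_abs_self L).trans (by linarith)) (norm_nonneg _)
      _ ≤ (|L| + 1) * (δ / (3 * (|L| + 1))) := mul_le_mul_of_nonneg_left hvS.le hL1.le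
      _ = δ / 3 := by field_simp
  filter_upwards [hL, Metric.tendsto_nhds.1 (h v hv) (δ / 3) (by linarith)] with i h2 h3
  rw [Real.dist_eq] at h3 ⊢
  have h4 := abs_le.1 ((h2 u v).trans h1)
  have h5 := abs_le.1 ((hL₀ u v).trans h1)
  have h6 := abs_lt.1 h3
  exact abs_lt.2 ⟨by linarith [h4.1, h5.2, h6.1], by linarith [h4.2, h5.1, h6.2]⟩

theorem abs_inner_sub_le {G : Type*} [NormedAddCommGroup G] [InnerProductSpace ℝ G]
    (a b c : G) : |inner ℝ a c - inner ℝ b c| ≤ ‖a - b‖ * ‖c‖ := by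
  rw [← inner_sub_left]
  exact abs_real_inner_le_norm _ _

theorem abs_inner_sub_le' {G : Type*} [NormedAddCommGroup G] [InnerProductSpace ℝ G]
    (a b c : G) : |inner ℝ c a - inner ℝ c b| ≤ ‖c‖ * ‖a - b‖ := by
  rw [← inner_sub_right]
  exact abs_real_inner_le_norm _ _

theorem norm_map_sub_le {G : Type*} [NormedAddCommGroup G] [NormedSpace ℝ G] {T : H →L[ℝ] G} {C : ℝ}
    (hC : ‖T‖ ≤ C) (u v : H) : ‖T u - T v‖ ≤ C * ‖u - v‖ := by
  rw [← map_sub]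
  exact T.le_of_opNorm_le hC _

namespace IsTraceFamily

variable {ι : Type*} {l : Filter ι} {μ : ι → Measure X} {T : ∀ i, H →L[ℝ] Lp ℝ 2 (μ i)}
  {μ₀ : Measure X} {T₀ : H →L[ℝ] Lp ℝ 2 μ₀} {K : ℝ} {h : ℝ → ℝ}

/-- The family that is constantly equal to the limit operator. -/
theorem const (hT : IsTraceFamily l μ T μ₀ T₀) {κ : Type*} (l' : Filter κ) :
    IsTraceFamily l' (fun _ => μ₀) (fun _ => T₀) μ₀ T₀ where
  bound := hT.bound.elim fun C hC => ⟨C, hC.1, hC.2.1, Eventually.of_forall fun _ => hC.2.1⟩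
  compact _ _ w hw := by simpa using (hT.compact₀ w hw).norm
  compact₀ := hT.compact₀
  dense := by
    obtain ⟨S, hS, h⟩ := hT.dense
    refine ⟨S, hS, fun u hu => ?_⟩
    obtain ⟨ψ, h1, h2, -, h3⟩ := h u hu
    exact ⟨ψ, h1, h2, fun _ => h3, h3⟩
  conv _ _ := tendsto_const_nhds

theorem comp (hT : IsTraceFamily l μ T μ₀ T₀) {κ : Type*} {l' : Filter κ} {i : κ → ι}
    (hi : Tendsto i l' l) :
    IsTraceFamily l' (fun k => μ (i k)) (fun k => T (i k)) μ₀ T₀ where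
  bound := hT.bound.elim fun C hC => ⟨C, hC.1, hC.2.1, hi.eventually hC.2.2⟩
  compact j hj w hw := hT.compact (fun n => i (j n)) (hi.comp hj) w hw
  compact₀ := hT.compact₀
  dense := by
    obtain ⟨S, hS, h⟩ := hT.dense
    refine ⟨S, hS, fun u hu => ?_⟩
    obtain ⟨ψ, h1, h2, h3, h4⟩ := h u hu
    exact ⟨ψ, h1, h2, fun k => h3 (i k), h4⟩
  conv ψ hψ := (hT.conv ψ hψ).comp hi

/-- By density, it is enough to consider `φ`, `w` and `u` with continuous images, for which this is
the weak convergence of the measures. The reduction for `u` comes last, since the Lipschitz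
estimate in `u` requires the image of `w` to be bounded. -/
theorem tendsto_inner_mulComp (hT : IsTraceFamily l μ T μ₀ T₀) (hh : IsBoundedLipschitz K h)
    (u w φ : H) : Tendsto (fun i => inner ℝ (mulComp hh (T i u) (T i w)) (T i φ)) l
      (𝓝 (inner ℝ (mulComp hh (T₀ u) (T₀ w)) (T₀ φ))) := by
  have hK := hh.nonneg
  obtain ⟨C, hC, hC₀, hCi⟩ := hT.bound
  obtain ⟨S, hS, hd⟩ := hT.dense
  have lip {ν : Measure X} {R : H →L[ℝ] Lp ℝ 2 ν} (hR : ‖R‖ ≤ C) (u w φ φ' : H) :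
      |inner ℝ (mulComp hh (R u) (R w)) (R φ) - inner ℝ (mulComp hh (R u) (R w)) (R φ')| ≤
        K * (C * ‖w‖) * C * ‖φ - φ'‖ := by
    refine (abs_inner_sub_le' _ _ _).trans ?_
    rw [mul_assoc _ C]
    refine mul_le_mul ((norm_mulComp_le hh _ _).trans ?_) (norm_map_sub_le hR _ _)
      (norm_nonneg _) (by positivity)
    exact mul_le_mul_of_nonneg_left (R.le_of_opNorm_le hR w) hK
  have lip' {ν : Measure X} {R : H →L[ℝ] Lp ℝ 2 ν} (hR : ‖R‖ ≤ C) (u φ w w' : H) :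
      |inner ℝ (mulComp hh (R u) (R w)) (R φ) - inner ℝ (mulComp hh (R u) (R w')) (R φ)| ≤
        K * C * (C * ‖φ‖) * ‖w - w'‖ := by
    refine (abs_inner_sub_le _ _ _).trans ?_
    rw [mul_right_comm]
    refine mul_le_mul ?_ (R.le_of_opNorm_le hR φ) (norm_nonneg _) (by positivity)
    rw [← map_sub, mul_assoc]
    exact (norm_mulComp_le hh _ _).trans (mul_le_mul_of_nonneg_left (norm_map_sub_le hR _ _) hK)
  have lip'' {ν : Measure X} {R : H →L[ℝ] Lp ℝ 2 ν} (hR : ‖R‖ ≤ C) {B : ℝ} (hB0 : 0 ≤ B) (w φ : H)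
      (hB : ∀ᵐ x ∂ν, |R w x| ≤ B) (u u' : H) :
      |inner ℝ (mulComp hh (R u) (R w)) (R φ) - inner ℝ (mulComp hh (R u') (R w)) (R φ)| ≤
        K * B * C * (C * ‖φ‖) * ‖u - u'‖ := by
    refine (abs_inner_sub_le _ _ _).trans ?_
    rw [mul_right_comm]
    refine mul_le_mul ?_ (R.le_of_opNorm_le hR φ) (norm_nonneg _) (by positivity)
    rw [mul_assoc]
    exact (norm_mulComp_sub_le hh _ _ _ hB).trans
      (mul_le_mul_of_nonneg_left (norm_map_sub_le hR _ _) (by positivity))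
  refine tendsto_of_dense_of_lipschitz hS
    (F := fun i φ => inner ℝ (mulComp hh (T i u) (T i w)) (T i φ))
    (F₀ := fun φ => inner ℝ (mulComp hh (T₀ u) (T₀ w)) (T₀ φ))
    (hCi.mono fun i hi => lip hi u w) (lip hC₀ u w) (fun φ hφ => ?_) φ
  refine tendsto_of_dense_of_lipschitz hS
    (F := fun i w => inner ℝ (mulComp hh (T i u) (T i w)) (T i φ))
    (F₀ := fun w => inner ℝ (mulComp hh (T₀ u) (T₀ w)) (T₀ φ))
    (hCi.mono fun i hi => lip' hi u φ) (lip' hC₀ u φ) (fun w hw => ?_) w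
  obtain ⟨ψ, hψ, ⟨B, hB0, hB⟩, hψi, hψ₀⟩ := hd w hw
  refine tendsto_of_dense_of_lipschitz hS
    (F := fun i u => inner ℝ (mulComp hh (T i u) (T i w)) (T i φ))
    (F₀ := fun u => inner ℝ (mulComp hh (T₀ u) (T₀ w)) (T₀ φ))
    (hCi.mono fun i hi => lip'' hi hB0 w φ ((hψi i).mono fun x hx => by rw [hx]; exact hB x))
    (lip'' hC₀ hB0 w φ (hψ₀.mono fun x hx => by rw [hx]; exact hB x)) (fun u hu => ?_) u
  obtain ⟨ψ', hψ', -, hψi', hψ₀'⟩ := hd u hu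
  obtain ⟨ψ'', hψ'', -, hψi'', hψ₀''⟩ := hd φ hφ
  have h1 := hT.conv (fun x => h (ψ' x) * ψ x * ψ'' x)
    (((hh.continuous.comp hψ').mul hψ).mul hψ'')
  have e {ν : Measure X} {R : H →L[ℝ] Lp ℝ 2 ν} (h1 : R u =ᵐ[ν] ψ') (h2 : R w =ᵐ[ν] ψ)
      (h3 : R φ =ᵐ[ν] ψ'') :
      ∫ x, h (ψ' x) * ψ x * ψ'' x ∂ν = inner ℝ (mulComp hh (R u) (R w)) (R φ) := by
    rw [inner_mulComp]
    apply integral_congr_ae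
    filter_upwards [h1, h2, h3] with x e1 e2 e3
    rw [e1, e2, e3]
  rw [e hψ₀' hψ₀ hψ₀''] at h1
  exact h1.congr fun i => e (hψi' i) (hψi i) (hψi'' i)

/-- Weak convergence of the measures bounds their masses, by testing with the constant `1`. -/
theorem exists_mass_bound (hT : IsTraceFamily l μ T μ₀ T₀) :
    ∃ m : ℝ, μ₀.real univ ≤ m ∧ ∀ᶠ i in l, (μ i).real univ ≤ m := by
  refine ⟨μ₀.real univ + 1, by linarith, ?_⟩
  have h1 := hT.conv (fun _ => 1) continuous_const
  simp only [integral_const, smul_eq_mul, mul_one] at h1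
  exact h1.eventually_le_const (by linarith)

variable [∀ i, IsFiniteMeasure (μ i)] [IsFiniteMeasure μ₀]

/-- By density in `φ` and `u`, this reduces to the weak convergence of the measures. -/
theorem tendsto_inner_compLp (hT : IsTraceFamily l μ T μ₀ T₀) (hh : IsBoundedLipschitz K h)
    (u φ : H) : Tendsto (fun i => inner ℝ (compLp hh (T i u)) (T i φ)) l
      (𝓝 (inner ℝ (compLp hh (T₀ u)) (T₀ φ))) := by
  have hK := hh.nonneg
  obtain ⟨C, hC, hC₀, hCi⟩ := hT.bound
  obtain ⟨S, hS, hd⟩ := hT.dense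
  obtain ⟨m, hm⟩ := hT.exists_mass_bound
  have lip {ν : Measure X} [IsFiniteMeasure ν] {R : H →L[ℝ] Lp ℝ 2 ν} (hR : ‖R‖ ≤ C)
      (hν : ν.real univ ≤ m) (u φ φ' : H) :
      |inner ℝ (compLp hh (R u)) (R φ) - inner ℝ (compLp hh (R u)) (R φ')| ≤
        √m * K * C * ‖φ - φ'‖ := by
    refine (abs_inner_sub_le' _ _ _).trans ?_
    rw [mul_assoc _ C]
    exact mul_le_mul (norm_compLp_le hh _ hν) (norm_map_sub_le hR _ _)
      (norm_nonneg _) (by positivity)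
  have lip' {ν : Measure X} [IsFiniteMeasure ν] {R : H →L[ℝ] Lp ℝ 2 ν} (hR : ‖R‖ ≤ C)
      (φ u u' : H) :
      |inner ℝ (compLp hh (R u)) (R φ) - inner ℝ (compLp hh (R u')) (R φ)| ≤
        K * C * (C * ‖φ‖) * ‖u - u'‖ := by
    refine (abs_inner_sub_le _ _ _).trans ?_
    rw [mul_right_comm]
    refine mul_le_mul ?_ (R.le_of_opNorm_le hR φ) (norm_nonneg _) (by positivity)
    rw [mul_assoc]
    exact (norm_compLp_sub_le hh _ _).trans (mul_le_mul_of_nonneg_left (norm_map_sub_le hR _ _) hK)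
  refine tendsto_of_dense_of_lipschitz hS
    (F := fun i φ => inner ℝ (compLp hh (T i u)) (T i φ))
    (F₀ := fun φ => inner ℝ (compLp hh (T₀ u)) (T₀ φ))
    ((hCi.and hm.2).mono fun i hi => lip hi.1 hi.2 u) (lip hC₀ hm.1 u) (fun φ hφ => ?_) φ
  refine tendsto_of_dense_of_lipschitz hS
    (F := fun i u => inner ℝ (compLp hh (T i u)) (T i φ))
    (F₀ := fun u => inner ℝ (compLp hh (T₀ u)) (T₀ φ))
    (hCi.mono fun i hi => lip' hi φ) (lip' hC₀ φ) (fun u hu => ?_) u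
  obtain ⟨ψ', hψ', -, hψi', hψ₀'⟩ := hd u hu
  obtain ⟨ψ'', hψ'', -, hψi'', hψ₀''⟩ := hd φ hφ
  have h1 := hT.conv (fun x => h (ψ' x) * ψ'' x) ((hh.continuous.comp hψ').mul hψ'')
  have e {ν : Measure X} [IsFiniteMeasure ν] {R : H →L[ℝ] Lp ℝ 2 ν} (h1 : R u =ᵐ[ν] ψ')
      (h3 : R φ =ᵐ[ν] ψ'') :
      ∫ x, h (ψ' x) * ψ'' x ∂ν = inner ℝ (compLp hh (R u)) (R φ) := by
    rw [inner_compLp]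
    apply integral_congr_ae
    filter_upwards [h1, h3] with x e1 e3
    rw [e1, e3]
  rw [e hψ₀' hψ₀''] at h1
  exact h1.congr fun i => e (hψi' i) (hψi'' i)

end IsTraceFamily

end TraceFamilies

section TraceFamilies

variable {H : Type*} [NormedAddCommGroup H] [InnerProductSpace ℝ H]
  {X : Type*} [TopologicalSpace X] [MeasurableSpace X]

/-- Inner products in varying Hilbert spaces have the same limit after perturbations that tend to
zero in norm. -/
theorem tendsto_inner_of_tendsto_norm_sub {G : ℕ → Type*} [∀ n, NormedAddCommGroup (G n)]
    [∀ n, InnerProductSpace ℝ (G n)] {a a' b b' : ∀ n, G n} {B : ℝ} {L : ℝ}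
    (ha : Tendsto (fun n => ‖a n - a' n‖) atTop (𝓝 0))
    (hb : Tendsto (fun n => ‖b n - b' n‖) atTop (𝓝 0))
    (hB : ∀ᶠ n in atTop, ‖b n‖ ≤ B) (hB' : ∀ᶠ n in atTop, ‖a' n‖ ≤ B)
    (h : Tendsto (fun n => inner ℝ (a' n) (b' n)) atTop (𝓝 L)) :
    Tendsto (fun n => inner ℝ (a n) (b n)) atTop (𝓝 L) := by
  have h1 : Tendsto (fun n => inner ℝ (a n) (b n) - inner ℝ (a' n) (b' n)) atTop (𝓝 0) := by
    have h2 := (ha.mul_const B).add (hb.const_mul B)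
    rw [zero_mul, mul_zero, add_zero] at h2
    refine squeeze_zero_norm' ?_ h2
    filter_upwards [hB, hB'] with n e1 e2
    rw [Real.norm_eq_abs]
    refine (abs_sub_le _ (inner ℝ (a' n) (b n)) _).trans (add_le_add ?_ ?_)
    · exact (abs_inner_sub_le _ _ _).trans (mul_le_mul_of_nonneg_left e1 (norm_nonneg _))
    · exact (abs_inner_sub_le' _ _ _).trans (mul_le_mul_of_nonneg_right e2 (norm_nonneg _))
  simpa using h1.add h

namespace IsTraceFamily

variable {μ₀ : Measure X} {T₀ : H →L[ℝ] Lp ℝ 2 μ₀} {K : ℝ} {g : ℝ → ℝ}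

section Sequence

variable {μ : ℕ → Measure X} {T : ∀ i, H →L[ℝ] Lp ℝ 2 (μ i)}

/-- Compactness of the operators turns weak convergence into convergence in norm of the images. -/
theorem tendsto_norm_sub (hT : IsTraceFamily atTop μ T μ₀ T₀) {w : ℕ → H} {w₀ : H}
    (hw : WeaklyNull fun n => w n - w₀) :
    Tendsto (fun n => ‖T n (w n) - T n w₀‖) atTop (𝓝 0) := by
  refine (hT.compact id tendsto_id _ hw).congr fun n => ?_
  rw [map_sub]
  rfl

variable [CompleteSpace H]

/-- Convergence of the linearized reaction terms along weakly convergent `w`. It holds in norm,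
since they may be tested with weakly convergent `φ`, whose traces converge in norm. -/
theorem tendsto_adjoint_mulComp (hT : IsTraceFamily atTop μ T μ₀ T₀)
    (hg : IsBoundedLipschitz K g) (u : H) {w : ℕ → H} {w₀ : H}
    (hw : WeaklyNull fun n => w n - w₀) :
    Tendsto (fun n => (T n).adjoint (mulComp hg (T n u) (T n (w n)))) atTop
      (𝓝 (T₀.adjoint (mulComp hg (T₀ u) (T₀ w₀)))) := by
  have hK := hg.nonneg
  obtain ⟨C, hC, hC₀, hCi⟩ := hT.bound
  refine tendsto_of_weak_test fun φ φ₀ hφ => ?_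
  simp only [ContinuousLinearMap.adjoint_inner_left]
  obtain ⟨B, hB⟩ := hφ.exists_bound
  refine tendsto_inner_of_tendsto_norm_sub (B := max (C * B) (K * (C * ‖w₀‖)))
    (a' := fun n => mulComp hg (T n u) (T n w₀)) (b' := fun n => T n φ₀) ?_
    (hT.tendsto_norm_sub hφ) ?_ ?_ (hT.tendsto_inner_mulComp hg u w₀ φ₀)
  · have h1 := (hT.tendsto_norm_sub hw).const_mul K
    rw [mul_zero] at h1
    refine squeeze_zero (fun n => norm_nonneg _) (fun n => ?_) h1
    rw [← map_sub]
    exact norm_mulComp_le hg _ _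
  · exact hCi.mono fun n hn => ((T n).le_of_opNorm_le_of_le hn (hB n)).trans (le_max_left _ _)
  · exact hCi.mono fun n hn => ((norm_mulComp_le hg _ _).trans
      (mul_le_mul_of_nonneg_left ((T n).le_of_opNorm_le hn _) hK)).trans (le_max_right _ _)

variable [∀ i, IsFiniteMeasure (μ i)] [IsFiniteMeasure μ₀]

/-- Convergence of the reaction terms along weakly convergent sequences, in norm. -/
theorem tendsto_adjoint_compLp (hT : IsTraceFamily atTop μ T μ₀ T₀)
    (hg : IsBoundedLipschitz K g) {w : ℕ → H} {w₀ : H} (hw : WeaklyNull fun n => w n - w₀) :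
    Tendsto (fun n => (T n).adjoint (compLp hg (T n (w n)))) atTop
      (𝓝 (T₀.adjoint (compLp hg (T₀ w₀)))) := by
  obtain ⟨C, hC, hC₀, hCi⟩ := hT.bound
  obtain ⟨m, hm, hmi⟩ := hT.exists_mass_bound
  refine tendsto_of_weak_test fun φ φ₀ hφ => ?_
  simp only [ContinuousLinearMap.adjoint_inner_left]
  obtain ⟨B, hB⟩ := hφ.exists_bound
  refine tendsto_inner_of_tendsto_norm_sub (B := max (C * B) (√m * K))
    (a' := fun n => compLp hg (T n w₀)) (b' := fun n => T n φ₀) ?_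
    (hT.tendsto_norm_sub hφ) ?_ ?_ (hT.tendsto_inner_compLp hg w₀ φ₀)
  · have h1 := (hT.tendsto_norm_sub hw).const_mul K
    rw [mul_zero] at h1
    exact squeeze_zero (fun n => norm_nonneg _) (fun n => norm_compLp_sub_le hg _ _) h1
  · exact hCi.mono fun n hn => ((T n).le_of_opNorm_le_of_le hn (hB n)).trans (le_max_left _ _)
  · exact hmi.mono fun n hn => (norm_compLp_le hg _ hn).trans (le_max_right _ _)

end Sequence

variable [CompleteSpace H]

/-- The derivative `T₀† ∘ (g' ∘ T₀ u) ∘ T₀` of `u ↦ T₀† (g ∘ T₀ u)`. -/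
def derivative (T₀ : H →L[ℝ] Lp ℝ 2 μ₀) (hg : IsBoundedLipschitz K g) (u : H) : H →L[ℝ] H :=
  T₀.adjoint ∘L mulComp hg (T₀ u) ∘L T₀

/-- The normalized remainder of the linearization at `u₀` tends to zero along sequences: the
differences `u n - v n`, divided by their norms `t n`, converge weakly to `w₀`, and the part of the
remainder that comes from `w₀` is estimated after approximating `w₀` by some `w'` with bounded
images. -/
theorem tendsto_remainder {μ : ℕ → Measure X} {T : ∀ i, H →L[ℝ] Lp ℝ 2 (μ i)}
    [∀ i, IsFiniteMeasure (μ i)] (hT : IsTraceFamily atTop μ T μ₀ T₀) (hg : IsRegular K g)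
    {u v w : ℕ → H} {t : ℕ → ℝ} {u₀ w₀ : H} (hu : Tendsto u atTop (𝓝 u₀))
    (hv : Tendsto v atTop (𝓝 u₀)) (hw : WeaklyNull fun n => w n - w₀) (ht : ∀ n, 0 < t n)
    (huv : ∀ n, u n - v n = t n • w n) {c : ℝ} (hc : 0 < c) :
    ∀ᶠ n in atTop, ‖(T n).adjoint (compLp hg.self (T n (u n))) -
      (T n).adjoint (compLp hg.self (T n (v n))) - derivative T₀ hg.deriv u₀ (u n - v n)‖ ≤
        c * t n := by
  have hK := hg.self.nonneg
  obtain ⟨C, hC, hC₀, hCi⟩ := hT.bound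
  obtain ⟨S, hS, hd⟩ := hT.dense
  have e1 : Tendsto (fun n => (T n).adjoint (mulComp hg.deriv (T n u₀) (T n (w n))) -
      derivative T₀ hg.deriv u₀ (w n)) atTop (𝓝 0) := by
    have h1 := hT.tendsto_adjoint_mulComp hg.deriv u₀ hw
    have h2 := (hT.const atTop).tendsto_adjoint_mulComp hg.deriv u₀ hw
    have h3 := h1.sub h2
    rw [sub_self] at h3
    exact h3
  -- the distance of the approximation `w'` from `w₀`, chosen so that `2 K C² d ≤ c / 4`
  set d := c / (8 * (K * C * C + 1)) with hd_def
  have hd0 : 0 < d := by positivity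
  obtain ⟨w', hw', hww'⟩ := hS.exists_dist_lt w₀ hd0
  rw [dist_eq_norm] at hww'
  obtain ⟨ψ, -, ⟨B, hB0, hB⟩, hψ, -⟩ := hd w' hw'
  have hsmall : C * (2 * K * (C * d)) ≤ c / 4 := by
    have h1 : K * C * C * d ≤ (K * C * C + 1) * d :=
      mul_le_mul_of_nonneg_right (by linarith) hd0.le
    have h2 : (K * C * C + 1) * d = c / 8 := by rw [hd_def]; field_simp
    calc C * (2 * K * (C * d)) = 2 * (K * C * C * d) := by ring
      _ ≤ c / 4 := by linarith
  have e2 : Tendsto (fun n => C * (2 * K * (‖T n (w n) - T n w₀‖ + C * d) +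
      K * B * (C * ‖u n - u₀‖ + C * ‖v n - u₀‖))) atTop (𝓝 (C * (2 * K * (C * d)))) := by
    have h1 := hT.tendsto_norm_sub hw
    have h2 := tendsto_iff_norm_sub_tendsto_zero.1 hu
    have h3 := tendsto_iff_norm_sub_tendsto_zero.1 hv
    have h4 := ((((h1.add_const (C * d)).const_mul (2 * K)).add
      (((h2.const_mul C).add (h3.const_mul C)).const_mul (K * B))).const_mul C)
    simpa only [zero_add, mul_zero, add_zero] using h4
  filter_upwards [hCi, e2.eventually_le_const (by linarith : C * (2 * K * (C * d)) < c / 2),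
    (tendsto_zero_iff_norm_tendsto_zero.1 e1).eventually_le_const (by linarith : 0 < c / 2)] with
    n h1 h2 h3
  have hadj : ‖(T n).adjoint‖ ≤ C := by rwa [LinearIsometryEquiv.norm_map]
  have hTuv : T n (u n) - T n (v n) = t n • (T n (w n - w') + T n w') := by
    rw [← map_sub, huv, map_smul, ← map_add, sub_add_cancel]
  have h4 := hg.norm_remainder_le (T n (u n)) (T n (v n)) (T n u₀) (T n (w n - w')) (T n w')
    (ht n).le hB0 ((hψ n).mono fun x hx => by rw [hx]; exact hB x) hTuv
  have h5 : ‖T n (w n - w')‖ ≤ ‖T n (w n) - T n w₀‖ + C * d := by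
    have h6 : T n (w n - w') = (T n (w n) - T n w₀) + T n (w₀ - w') := by
      rw [map_sub, map_sub, sub_add_sub_cancel]
    rw [h6]
    exact (norm_add_le _ _).trans (add_le_add le_rfl ((T n).le_of_opNorm_le_of_le h1 hww'.le))
  have h7 : compLp hg.self (T n (u n)) - compLp hg.self (T n (v n)) =
      (compLp hg.self (T n (u n)) - compLp hg.self (T n (v n)) -
        mulComp hg.deriv (T n u₀) (T n (u n) - T n (v n))) +
        t n • mulComp hg.deriv (T n u₀) (T n (w n)) := by
    rw [← map_sub, huv, map_smul, map_smul, sub_add_cancel]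
  have h8 : (T n).adjoint (compLp hg.self (T n (u n))) -
      (T n).adjoint (compLp hg.self (T n (v n))) - derivative T₀ hg.deriv u₀ (u n - v n) =
      (T n).adjoint (compLp hg.self (T n (u n)) - compLp hg.self (T n (v n)) -
        mulComp hg.deriv (T n u₀) (T n (u n) - T n (v n))) +
      t n • ((T n).adjoint (mulComp hg.deriv (T n u₀) (T n (w n))) -
        derivative T₀ hg.deriv u₀ (w n)) := by
    rw [← map_sub, h7, map_add, huv, map_smul, map_smul, smul_sub, ← h7, ← add_sub_assoc]
  rw [h8]
  refine (norm_add_le _ _).trans ?_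
  have h9 : ‖(T n).adjoint (compLp hg.self (T n (u n)) - compLp hg.self (T n (v n)) -
      mulComp hg.deriv (T n u₀) (T n (u n) - T n (v n)))‖ ≤ t n * (c / 2) := by
    refine ((T n).adjoint.le_of_opNorm_le_of_le hadj h4).trans ?_
    calc _ = t n * (C * (2 * K * ‖T n (w n - w')‖ +
          K * B * (‖T n (u n) - T n u₀‖ + ‖T n (v n) - T n u₀‖))) := by ring
      _ ≤ t n * (C * (2 * K * (‖T n (w n) - T n w₀‖ + C * d) +
          K * B * (C * ‖u n - u₀‖ + C * ‖v n - u₀‖))) := by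
        have := norm_map_sub_le h1 (u n) u₀
        have := norm_map_sub_le h1 (v n) u₀
        have := ht n
        gcongr
      _ ≤ t n * (c / 2) := mul_le_mul_of_nonneg_left h2 (ht n).le
  rw [norm_smul, Real.norm_eq_abs, abs_of_pos (ht n)]
  have h10 := mul_le_mul_of_nonneg_left h3 (ht n).le
  linarith

variable {ι : Type*} {l : Filter ι} {μ : ι → Measure X} {T : ∀ i, H →L[ℝ] Lp ℝ 2 (μ i)}
  [∀ i, IsFiniteMeasure (μ i)] [IsFiniteMeasure μ₀]

/-- A converging family of traces turns a regular function `g` into a compact family of nonlinear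
maps. The linearization is proved by contradiction: a sequence of pairs violating it has, after
normalization, weakly convergent differences, and `tendsto_remainder` applies. -/
theorem isCompactFamily [SecondCountableTopology H] [l.IsCountablyGenerated]
    (hT : IsTraceFamily l μ T μ₀ T₀) (hg : IsRegular K g) :
    IsCompactFamily l (fun i u => (T i).adjoint (compLp hg.self (T i u)))
      (fun u => T₀.adjoint (compLp hg.self (T₀ u))) (derivative T₀ hg.deriv) where
  bound := by
    obtain ⟨C, hC, hC₀, hCi⟩ := hT.bound
    obtain ⟨m, hm, hmi⟩ := hT.exists_mass_bound
    refine ⟨C * (√m * K), ?_⟩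
    filter_upwards [hCi, hmi] with i h1 h2 u
    exact (T i).adjoint.le_of_opNorm_le_of_le (by rwa [LinearIsometryEquiv.norm_map])
      (norm_compLp_le _ _ h2)
  weak i hi u u₀ hu := (hT.comp hi).tendsto_adjoint_compLp hg.self hu
  linearization u₀ c hc := by
    by_contra hcon
    obtain ⟨p, hp, hp2⟩ := exists_seq_forall_of_frequently (not_eventually.1 hcon)
    have hi : Tendsto (fun n => (p n).1) atTop l := tendsto_fst.comp hp
    have hu : Tendsto (fun n => (p n).2.1) atTop (𝓝 u₀) := tendsto_fst.comp (tendsto_snd.comp hp)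
    have hv : Tendsto (fun n => (p n).2.2) atTop (𝓝 u₀) := tendsto_snd.comp (tendsto_snd.comp hp)
    have ht : ∀ n, 0 < ‖(p n).2.1 - (p n).2.2‖ := fun n => by
      rw [norm_pos_iff, sub_ne_zero]
      intro e
      apply hp2 n
      rw [e, sub_self, sub_self, map_zero, sub_zero, norm_zero, mul_zero]
    set w : ℕ → H := fun n => ‖(p n).2.1 - (p n).2.2‖⁻¹ • ((p n).2.1 - (p n).2.2) with hw_def
    obtain ⟨w₀, m, hm, hw⟩ := exists_weaklyNull_subseq (w := w) (M := 1) fun n => by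
      rw [hw_def, norm_smul, norm_inv, norm_norm, inv_mul_cancel₀ (ht n).ne']
    obtain ⟨n, hn⟩ := ((hT.comp (hi.comp hm.tendsto_atTop)).tendsto_remainder hg
      (hu.comp hm.tendsto_atTop) (hv.comp hm.tendsto_atTop) hw (fun n => ht (m n)) (fun n => by
        rw [hw_def, smul_inv_smul₀ (ht (m n)).ne']
        rfl) hc).exists
    exact hp2 (m n) hn

end IsTraceFamily

end TraceFamilies

/-! ### The data of the elliptic problems -/

theorem isBoundedLipschitz_of_deriv {h : ℝ → ℝ} {K : ℝ} (hd : Differentiable ℝ h)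
    (hb : ∀ s, |h s| ≤ K) (hb' : ∀ s, |deriv h s| ≤ K) : IsBoundedLipschitz K h where
  bound := hb
  lip s t := by
    simpa only [Real.norm_eq_abs] using convex_univ.norm_image_sub_le_of_norm_deriv_le
      (fun x _ => hd x) (fun x _ => hb' x) (mem_univ t) (mem_univ s)

theorem IsAdmissibleNonlinearity.exists_isRegular {j : ℝ → ℝ} (hj : IsAdmissibleNonlinearity j) :
    ∃ K, IsRegular K j := by
  obtain ⟨K, -, hK⟩ := hj.bounded
  have h1 : ContDiff ℝ 1 (deriv j) := ((contDiff_succ_iff_deriv (n := 1)).1 hj.contDiff).2.2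
  have h2 : ∀ s, 0 ≤ |j s| ∧ 0 ≤ |deriv j s| ∧ 0 ≤ |deriv (deriv j) s| := fun s =>
    ⟨abs_nonneg _, abs_nonneg _, abs_nonneg _⟩
  exact ⟨K, hj.contDiff.differentiable (by norm_num),
    isBoundedLipschitz_of_deriv (hj.contDiff.differentiable (by norm_num))
      (fun s => by linarith [hK s, h2 s]) (fun s => by linarith [hK s, h2 s]),
    isBoundedLipschitz_of_deriv (h1.differentiable (by norm_num))
      (fun s => by linarith [hK s, h2 s]) (fun s => by linarith [hK s, h2 s])⟩

theorem IsAdmissibleCoefficient.aestronglyMeasurable {Ω : Set E3} {a : E3 → ℝ}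
    (ha : IsAdmissibleCoefficient Ω a) (ho : IsOpen Ω) :
    AEStronglyMeasurable a (volume.restrict Ω) :=
  (ha.contDiffOn.continuousOn.mono subset_closure).aestronglyMeasurable ho.measurableSet

theorem IsAdmissibleCoefficient.ae_bounds {Ω : Set E3} {a : E3 → ℝ}
    (ha : IsAdmissibleCoefficient Ω a) (ho : IsOpen Ω) :
    ∃ a₀ a₁ : ℝ, 0 < a₀ ∧ (∀ᵐ x ∂volume.restrict Ω, a₀ ≤ a x) ∧
      ∀ᵐ x ∂volume.restrict Ω, |a x| ≤ a₁ := by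
  obtain ⟨a₀, a₁, h0, -, h⟩ := ha.bounds
  have h1 : ∀ᵐ x ∂volume.restrict Ω, x ∈ Ω := ae_restrict_mem ho.measurableSet
  refine ⟨a₀, a₁, h0, h1.mono fun x hx => (h x (subset_closure hx)).1, h1.mono fun x hx => ?_⟩
  have := h x (subset_closure hx)
  exact abs_le.2 ⟨by linarith, this.2⟩

theorem inner_mulLp {α : Type*} [MeasurableSpace α] {μ : Measure α} {F : Type*}
    [NormedAddCommGroup F] [InnerProductSpace ℝ F] {q : α → ℝ} {K : ℝ}
    (hm : AEStronglyMeasurable q μ) (hq : ∀ᵐ x ∂μ, |q x| ≤ K) (v w : Lp F 2 μ) :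
    inner ℝ (mulLp hm hq v) w = ∫ x, q x * inner ℝ (v x) (w x) ∂μ := by
  rw [L2.inner_def]
  apply integral_congr_ae
  filter_upwards [coeFn_mulLp hm hq v] with x hx
  rw [hx, real_inner_smul_left]

theorem le_inner_mulLp {α : Type*} [MeasurableSpace α] {μ : Measure α} {F : Type*}
    [NormedAddCommGroup F] [InnerProductSpace ℝ F] {q : α → ℝ} {K c : ℝ}
    (hm : AEStronglyMeasurable q μ) (hq : ∀ᵐ x ∂μ, |q x| ≤ K) (hc : ∀ᵐ x ∂μ, c ≤ q x)
    (v : Lp F 2 μ) : c * ‖v‖ ^ 2 ≤ inner ℝ (mulLp hm hq v) v := by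
  rw [← real_inner_self_eq_norm_sq, L2.inner_def, L2.inner_def, ← integral_const_mul]
  refine integral_mono_ae ((L2.integrable_inner v v).const_mul c) (L2.integrable_inner _ v) ?_
  filter_upwards [coeFn_mulLp hm hq v, hc] with x h1 h2
  rw [h1, real_inner_smul_left]
  exact mul_le_mul_of_nonneg_right h2 real_inner_self_nonneg

/-! ### The weak problems in an abstract form -/

section WeakProblems

variable {H : Type*} [NormedAddCommGroup H] [InnerProductSpace ℝ H]
  {X F : Type*} [MeasurableSpace X] [NormedAddCommGroup F] [InnerProductSpace ℝ F] {ν μ : Measure X}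

/-- The form `∫ q Pu · Pφ + ∫ Su Sφ`. -/
def ellipticForm (q : X → ℝ) (S : H →L[ℝ] Lp ℝ 2 ν) (P : H →L[ℝ] Lp F 2 ν) (u φ : H) : ℝ :=
  (∫ x, q x * inner ℝ (P u x) (P φ x) ∂ν) + ∫ x, S u x * S φ x ∂ν

/-- The form `∫ f(Su) Sφ dν + ∫ g(Tu) Tφ dμ`. -/
def reactionForm (f g : ℝ → ℝ) (S : H →L[ℝ] Lp ℝ 2 ν) (T : H →L[ℝ] Lp ℝ 2 μ) (u φ : H) : ℝ :=
  (∫ x, f (S u x) * S φ x ∂ν) + ∫ x, g (T u x) * T φ x ∂μ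

/-- The derivative `∫ f'(Su) Sw Sφ dν + ∫ g'(Tu) Tw Tφ dμ` of the reaction form. -/
def reactionDerivForm (f g : ℝ → ℝ) (S : H →L[ℝ] Lp ℝ 2 ν) (T : H →L[ℝ] Lp ℝ 2 μ) (u w φ : H) : ℝ :=
  (∫ x, deriv f (S u x) * S w x * S φ x ∂ν) + ∫ x, deriv g (T u x) * T w x * T φ x ∂μ

variable [CompleteSpace H]

/-- If `A w - D w = ℓ` is uniquely solvable in the weak sense, then `A - D` has a bounded inverse,
by the open mapping theorem. -/
theorem exists_inverse_of_weak_solution {A D : H →L[ℝ] H} {R : StrongDual ℝ H → H}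
    (h : ∀ (ℓ : StrongDual ℝ H) (w : H),
      (∀ φ : H, inner ℝ (A w) φ - inner ℝ (D w) φ = ℓ φ) ↔ w = R ℓ) :
    ∃ R' : H →L[ℝ] H, (∀ w, R' (A w - D w) = w) ∧ ∀ w, A (R' w) - D (R' w) = w := by
  have h1 : ∀ x w : H, (A - D) w = x ↔ w = R (innerSL ℝ x) := fun x w => by
    rw [← h, sub_apply]
    simp only [innerSL_apply_apply, ← inner_sub_left]
    exact ⟨fun e φ => by rw [e], fun e => ext_inner_right ℝ e⟩
  have h2 : Function.Injective (A - D) := fun v w e =>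
    ((h1 _ v).1 e).trans ((h1 _ w).1 rfl).symm
  have h3 : Function.Surjective (A - D) := fun x => ⟨_, (h1 x _).2 rfl⟩
  let B := ContinuousLinearEquiv.ofBijective (A - D) (LinearMap.ker_eq_bot.2 h2)
    (LinearMap.range_eq_top.2 h3)
  exact ⟨B.symm, B.symm_apply_apply, B.apply_symm_apply⟩

/-- The operator `P† q P + S† S` of the elliptic form. -/
def ellipticOperator [CompleteSpace F] {q : X → ℝ} {K : ℝ} (hm : AEStronglyMeasurable q ν)
    (hq : ∀ᵐ x ∂ν, |q x| ≤ K) (S : H →L[ℝ] Lp ℝ 2 ν) (P : H →L[ℝ] Lp F 2 ν) : H →L[ℝ] H :=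
  P.adjoint ∘L mulLp hm hq ∘L P + S.adjoint ∘L S

theorem inner_ellipticOperator [CompleteSpace F] {q : X → ℝ} {K : ℝ}
    (hm : AEStronglyMeasurable q ν) (hq : ∀ᵐ x ∂ν, |q x| ≤ K) (S : H →L[ℝ] Lp ℝ 2 ν)
    (P : H →L[ℝ] Lp F 2 ν) (u φ : H) :
    inner ℝ (ellipticOperator hm hq S P u) φ = ellipticForm q S P u φ := by
  rw [ellipticOperator, add_apply, inner_add_left, ContinuousLinearMap.comp_apply,
    ContinuousLinearMap.comp_apply, ContinuousLinearMap.comp_apply,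
    ContinuousLinearMap.adjoint_inner_left, ContinuousLinearMap.adjoint_inner_left, inner_mulLp,
    L2.inner_def, ellipticForm]
  refine congrArg₂ (· + ·) rfl (integral_congr_ae (ae_of_all _ fun x => ?_))
  exact mul_comm _ _

/-- Coercivity of the elliptic operator. -/
theorem le_inner_ellipticOperator [CompleteSpace F] {q : X → ℝ} {K c : ℝ}
    (hm : AEStronglyMeasurable q ν) (hq : ∀ᵐ x ∂ν, |q x| ≤ K) (hc : ∀ᵐ x ∂ν, c ≤ q x)
    {S : H →L[ℝ] Lp ℝ 2 ν} {P : H →L[ℝ] Lp F 2 ν} (hn : ∀ u, ‖u‖ ^ 2 = ‖S u‖ ^ 2 + ‖P u‖ ^ 2)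
    (u : H) : min c 1 * ‖u‖ ^ 2 ≤ inner ℝ (ellipticOperator hm hq S P u) u := by
  rw [ellipticOperator, add_apply, inner_add_left, ContinuousLinearMap.comp_apply,
    ContinuousLinearMap.comp_apply, ContinuousLinearMap.comp_apply,
    ContinuousLinearMap.adjoint_inner_left, ContinuousLinearMap.adjoint_inner_left,
    real_inner_self_eq_norm_sq, hn]
  have h1 := le_inner_mulLp hm hq hc (P u)
  have h2 := mul_le_mul_of_nonneg_right (min_le_left c 1) (sq_nonneg ‖P u‖)
  have h3 := mul_le_mul_of_nonneg_right (min_le_right c 1) (sq_nonneg ‖S u‖)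
  linarith

theorem inner_reaction [IsFiniteMeasure ν] [IsFiniteMeasure μ] {f g : ℝ → ℝ} {K K' : ℝ}
    (hf : IsBoundedLipschitz K f) (hg : IsBoundedLipschitz K' g) (S : H →L[ℝ] Lp ℝ 2 ν)
    (T : H →L[ℝ] Lp ℝ 2 μ) (u φ : H) :
    inner ℝ (S.adjoint (compLp hf (S u)) + T.adjoint (compLp hg (T u))) φ =
      reactionForm f g S T u φ := by
  rw [inner_add_left, ContinuousLinearMap.adjoint_inner_left,
    ContinuousLinearMap.adjoint_inner_left, inner_compLp, inner_compLp, reactionForm]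

theorem inner_reactionDeriv {f g : ℝ → ℝ} {K K' : ℝ}
    (hf : IsBoundedLipschitz K (deriv f)) (hg : IsBoundedLipschitz K' (deriv g))
    (S : H →L[ℝ] Lp ℝ 2 ν) (T : H →L[ℝ] Lp ℝ 2 μ) (u w φ : H) :
    inner ℝ ((IsTraceFamily.derivative S hf u + IsTraceFamily.derivative T hg u) w) φ =
      reactionDerivForm f g S T u w φ := by
  rw [add_apply, inner_add_left, IsTraceFamily.derivative, IsTraceFamily.derivative,
    ContinuousLinearMap.comp_apply, ContinuousLinearMap.comp_apply, ContinuousLinearMap.comp_apply,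
    ContinuousLinearMap.comp_apply, ContinuousLinearMap.adjoint_inner_left,
    ContinuousLinearMap.adjoint_inner_left, inner_mulComp, inner_mulComp, reactionDerivForm]

/-- The theorem on the equilibria, for reaction terms on a converging family of traces. -/
theorem exists_weak_solutions [SecondCountableTopology H] [CompleteSpace F] [TopologicalSpace X]
    [IsFiniteMeasure ν] {ι : Type*} {l : Filter ι} [l.NeBot] [l.IsCountablyGenerated]
    {μ : ι → Measure X} [∀ i, IsFiniteMeasure (μ i)] {μ₀ : Measure X} [IsFiniteMeasure μ₀]
    {S : H →L[ℝ] Lp ℝ 2 ν} {P : H →L[ℝ] Lp F 2 ν} {T : ∀ i, H →L[ℝ] Lp ℝ 2 (μ i)}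
    {T₀ : H →L[ℝ] Lp ℝ 2 μ₀} {q : X → ℝ} {f g : ℝ → ℝ} {K K' c a₁ : ℝ}
    (hn : ∀ u, ‖u‖ ^ 2 = ‖S u‖ ^ 2 + ‖P u‖ ^ 2)
    (hS : IsTraceFamily l (fun _ => ν) (fun _ => S) ν S) (hT : IsTraceFamily l μ T μ₀ T₀)
    (hm : AEStronglyMeasurable q ν) (hq : ∀ᵐ x ∂ν, |q x| ≤ a₁) (hc : 0 < c)
    (hcq : ∀ᵐ x ∂ν, c ≤ q x) (hf : IsRegular K f) (hg : IsRegular K' g)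
    (hinv : ∀ u, (∀ φ, ellipticForm q S P u φ - reactionForm f g S T₀ u φ = 0) →
      ∃ R : StrongDual ℝ H → H, ∀ (ℓ : StrongDual ℝ H) (w : H),
        (∀ φ, ellipticForm q S P w φ - reactionDerivForm f g S T₀ u w φ = ℓ φ) ↔ w = R ℓ) :
    ∃ (k : ℕ) (u₀ : Fin k → H), Function.Injective u₀ ∧
      range u₀ = {u | ∀ φ, ellipticForm q S P u φ - reactionForm f g S T₀ u φ = 0} ∧
      ∃ u : ι → Fin k → H, (∀ᶠ i in l, Function.Injective (u i) ∧
        range (u i) = {v | ∀ φ, ellipticForm q S P v φ - reactionForm f g S (T i) v φ = 0}) ∧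
        ∀ j, Tendsto (fun i => u i j) l (𝓝 (u₀ j)) := by
  have hset {κ : Measure X} [IsFiniteMeasure κ] (R : H →L[ℝ] Lp ℝ 2 κ) (u : H) :
      ellipticOperator hm hq S P u =
        S.adjoint (compLp hf.self (S u)) + R.adjoint (compLp hg.self (R u)) ↔
      ∀ φ, ellipticForm q S P u φ - reactionForm f g S R u φ = 0 := by
    constructor
    · intro h φ
      rw [← inner_ellipticOperator hm hq, h, inner_reaction, sub_self]
    · intro h
      refine ext_inner_right ℝ fun φ => ?_
      rw [inner_ellipticOperator, inner_reaction]
      exact sub_eq_zero.1 (h φ)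
  have key := ((hS.isCompactFamily hf).add (hT.isCompactFamily hg)).exists_solutions
    ((hS.isCompactFamily hf).add ((hT.const l).isCompactFamily hg))
    (lt_min hc one_pos) (le_inner_ellipticOperator hm hq hcq hn) (fun u hu => by
      obtain ⟨R, hR⟩ := hinv u ((hset T₀ u).1 hu)
      refine exists_inverse_of_weak_solution (R := R) fun ℓ w => ?_
      rw [← hR ℓ w]
      refine forall_congr' fun φ => ?_
      rw [inner_ellipticOperator, inner_reactionDeriv])
  simpa only [hset] using key

end WeakProblems

/-! ### Traces on the strips -/

/-- The interpolation inequality `x² ≤ C y z` transfers convergence to zero from `y` to `x`, when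
`z` is bounded. -/
theorem tendsto_zero_of_interpolation {x y z : ℕ → ℝ} {C M : ℝ}
    (hxy : ∀ᶠ n in atTop, x n ^ 2 ≤ C * (y n * z n)) (hC : 0 ≤ C) (hx : ∀ n, 0 ≤ x n)
    (hy0 : ∀ n, 0 ≤ y n) (hy : Tendsto y atTop (𝓝 0)) (hz : ∀ n, z n ≤ M) :
    Tendsto x atTop (𝓝 0) := by
  have h1 : Tendsto (fun n => x n ^ 2) atTop (𝓝 0) := by
    have h2 := (hy.mul_const M).const_mul C
    rw [zero_mul, mul_zero] at h2
    refine squeeze_zero' (Eventually.of_forall fun n => sq_nonneg _) (hxy.mono fun n hn => ?_) h2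
    exact hn.trans (mul_le_mul_of_nonneg_left (mul_le_mul_of_nonneg_left (hz n) (hy0 n)) hC)
  have h3 := h1.sqrt
  rw [Real.sqrt_zero] at h3
  exact h3.congr fun n => Real.sqrt_sq (hx n)

theorem opNorm_le_sqrt_of_interpolation {H G G' : Type*} [NormedAddCommGroup H] [NormedSpace ℝ H]
    [NormedAddCommGroup G] [NormedSpace ℝ G] [NormedAddCommGroup G'] [NormedSpace ℝ G']
    {T : H →L[ℝ] G} {S : H →L[ℝ] G'} {C : ℝ} (hC : 0 ≤ C) (hS : ∀ u, ‖S u‖ ≤ ‖u‖)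
    (h : ∀ u, ‖T u‖ ^ 2 ≤ C * (‖S u‖ * ‖u‖)) : ‖T‖ ≤ √C := by
  refine T.opNorm_le_bound (Real.sqrt_nonneg _) fun u => ?_
  apply le_of_sq_le_sq _ (mul_nonneg (Real.sqrt_nonneg _) (norm_nonneg _))
  rw [mul_pow, Real.sq_sqrt hC, sq ‖u‖]
  exact (h u).trans (mul_le_mul_of_nonneg_left
    (mul_le_mul_of_nonneg_right (hS u) (norm_nonneg _)) hC)

theorem WeaklyNull.exists_norm_le {H : Type*} [NormedAddCommGroup H] [InnerProductSpace ℝ H]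
    [CompleteSpace H] {w : ℕ → H} (hw : WeaklyNull w) : ∃ B, ∀ n, ‖w n‖ ≤ B :=
  WeaklyNull.exists_bound (w₀ := (0 : H)) (by simpa using hw)

/-- The interpolation inequality `‖Tu‖² ≤ C ‖Su‖ ‖u‖` with a compact operator `S` provides the
bounds and the compactness of a family of traces. -/
theorem isTraceFamily_of_interpolation {H G X : Type*} [NormedAddCommGroup H]
    [InnerProductSpace ℝ H] [CompleteSpace H] [NormedAddCommGroup G] [InnerProductSpace ℝ G]
    [TopologicalSpace X] [MeasurableSpace X] {ι : Type*} {l : Filter ι} {μ : ι → Measure X}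
    {T : ∀ i, H →L[ℝ] Lp ℝ 2 (μ i)} {μ₀ : Measure X} {T₀ : H →L[ℝ] Lp ℝ 2 μ₀} {S : H →L[ℝ] G}
    (hS : ∀ u, ‖S u‖ ≤ ‖u‖)
    (hS' : ∀ w : ℕ → H, WeaklyNull w → Tendsto (fun n => S (w n)) atTop (𝓝 0))
    {C C₀ : ℝ} (hC : 0 ≤ C) (h : ∀ᶠ i in l, ∀ u, ‖T i u‖ ^ 2 ≤ C * (‖S u‖ * ‖u‖))
    (hC₀ : 0 ≤ C₀) (h₀ : ∀ u, ‖T₀ u‖ ^ 2 ≤ C₀ * (‖S u‖ * ‖u‖))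
    {A : Set H} (hA : Dense A) (hA' : ∀ u ∈ A, ∃ ψ : X → ℝ, Continuous ψ ∧
      (∃ B : ℝ, 0 ≤ B ∧ ∀ x, |ψ x| ≤ B) ∧ (∀ i, T i u =ᵐ[μ i] ψ) ∧ T₀ u =ᵐ[μ₀] ψ)
    (hμ : ∀ ψ : X → ℝ, Continuous ψ → Tendsto (fun i => ∫ x, ψ x ∂μ i) l (𝓝 (∫ x, ψ x ∂μ₀))) :
    IsTraceFamily l μ T μ₀ T₀ where
  bound := ⟨max √C √C₀, (Real.sqrt_nonneg _).trans (le_max_left _ _),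
    le_max_of_le_right (opNorm_le_sqrt_of_interpolation hC₀ hS h₀),
    h.mono fun _ hi => le_max_of_le_left (opNorm_le_sqrt_of_interpolation hC hS hi)⟩
  compact i hi w hw := by
    obtain ⟨B, hB⟩ := hw.exists_norm_le
    exact tendsto_zero_of_interpolation ((hi.eventually h).mono fun n hn => hn (w n)) hC
      (fun _ => norm_nonneg _) (fun _ => norm_nonneg _)
      (tendsto_zero_iff_norm_tendsto_zero.1 (hS' w hw)) hB
  compact₀ w hw := by
    obtain ⟨B, hB⟩ := hw.exists_norm_le
    exact tendsto_zero_iff_norm_tendsto_zero.2 (tendsto_zero_of_interpolation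
      (Eventually.of_forall fun n => h₀ (w n)) hC₀ (fun _ => norm_nonneg _)
      (fun _ => norm_nonneg _) (tendsto_zero_iff_norm_tendsto_zero.1 (hS' w hw)) hB)
  dense := ⟨A, hA, hA'⟩
  conv := hμ

variable {Ω : Set E3}

/-- A weakly null sequence in `H¹(Ω)` tends to zero in `L²(Ω)`. -/
theorem IsSmoothBoundedOpen.tendsto_toL2_of_weaklyNull (hΩ : IsSmoothBoundedOpen Ω) (w : ℕ → H1 Ω)
    (hw : WeaklyNull w) : Tendsto (fun n => toL2 Ω (w n)) atTop (𝓝 0) :=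
  hw.exists_norm_le.elim fun _ hB => hΩ.tendsto_toL2 hw hB

theorem exists_bounded_representative {u : H1 Ω} (hu : u ∈ smoothSubspace Ω) :
    ∃ φ : E3 → ℝ, ContDiff ℝ ∞ φ ∧ (∃ B : ℝ, 0 ≤ B ∧ ∀ x, |φ x| ≤ B) ∧
      fn u =ᵐ[volume.restrict Ω] φ := by
  refine (mem_smoothSubspace.1 hu).elim fun φ hφ => ⟨φ, hφ.1, ?_, hφ.2.2⟩
  obtain ⟨B, hB⟩ := hφ.2.1.exists_bound_of_continuous hφ.1.continuous
  exact ⟨B, (norm_nonneg _).trans (hB 0), hB⟩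

/-- The embedding into `L²(Ω)` is a constant family of traces, by Rellich's theorem; it carries the
reaction term `f`. -/
theorem IsSmoothBoundedOpen.isTraceFamily_toL2 (hΩ : IsSmoothBoundedOpen Ω) {ι : Type*}
    (l : Filter ι) : IsTraceFamily l (fun _ => volume.restrict Ω) (fun _ => toL2 Ω)
      (volume.restrict Ω) (toL2 Ω) := by
  have h : ∀ u : H1 Ω, ‖toL2 Ω u‖ ^ 2 ≤ 1 * (‖toL2 Ω u‖ * ‖u‖) := fun u => by
    rw [one_mul, sq]
    exact mul_le_mul_of_nonneg_left (norm_toL2_le u) (norm_nonneg _)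
  exact isTraceFamily_of_interpolation (S := toL2 Ω) (T₀ := toL2 Ω) norm_toL2_le
    hΩ.tendsto_toL2_of_weaklyNull zero_le_one (Eventually.of_forall fun _ => h) zero_le_one h
    hΩ.dense_smoothSubspace (fun _ hu =>
    (exists_bounded_representative hu).elim fun φ hφ =>
      ⟨φ, hφ.1.continuous, hφ.2.1, fun _ => hφ.2.2, hφ.2.2⟩) (fun _ _ => tendsto_const_nhds)

/-- The restrictions to the strips converge to the trace on the boundary, so that the concentrated
reaction terms converge to the reaction term `g` on the boundary. -/
theorem IsSmoothBoundedOpen.isTraceFamily_stripTrace (hΩ : IsSmoothBoundedOpen Ω) :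
    IsTraceFamily (𝓝[>] (0 : ℝ)) (stripMeasure Ω) (stripTrace Ω) (surfaceMeasure Ω) (trace Ω) := by
  obtain ⟨C, ε₀, hC, hε₀, h⟩ := hΩ.exists_stripTrace_bound
  obtain ⟨C₀, hC₀, h₀⟩ := hΩ.exists_trace_bound
  have h' : ∀ᶠ ε in 𝓝[>] (0 : ℝ), ∀ u : H1 Ω, ‖stripTrace Ω ε u‖ ^ 2 ≤ C * (‖toL2 Ω u‖ * ‖u‖) := by
    filter_upwards [Ioc_mem_nhdsGT hε₀] with ε hε
    exact h ε hε
  have hd : ∀ u ∈ smoothSubspace Ω, ∃ ψ : E3 → ℝ, Continuous ψ ∧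
      (∃ B : ℝ, 0 ≤ B ∧ ∀ x, |ψ x| ≤ B) ∧ (∀ ε, stripTrace Ω ε u =ᵐ[stripMeasure Ω ε] ψ) ∧
      trace Ω u =ᵐ[surfaceMeasure Ω] ψ := fun u hu => by
    refine (exists_bounded_representative hu).elim fun φ hφ =>
      ⟨φ, hφ.1.continuous, hφ.2.1, fun ε => ?_, hΩ.isTraceOperator_trace u φ hφ.1 hφ.2.2⟩
    exact (coeFn_stripTrace ε u).trans ((stripMeasure_absolutelyContinuous Ω ε).ae_le hφ.2.2)
  exact isTraceFamily_of_interpolation (S := toL2 Ω) (T := stripTrace Ω) (T₀ := trace Ω)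
    norm_toL2_le hΩ.tendsto_toL2_of_weaklyNull hC.le h' hC₀.le h₀ hΩ.dense_smoothSubspace
    hd (fun _ hψ => hΩ.tendsto_integral_strip hψ)

theorem integral_stripMeasure (φ : E3 → ℝ) {ε : ℝ} (hε : 0 < ε) :
    ∫ x, φ x ∂stripMeasure Ω ε = ε⁻¹ * ∫ x in Ω ∩ strip Ω ε, φ x := by
  rw [stripMeasure, integral_smul_measure, ENNReal.toReal_ofReal (inv_nonneg.2 hε.le), smul_eq_mul]

/-- The pairing with the concentrated reaction term is the reaction form of the restriction to the
strip. -/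
theorem pairF_eq (f g : ℝ → ℝ) {ε : ℝ} (hε : 0 < ε) (u φ : H1 Ω) :
    pairF f g ε u φ = reactionForm f g (toL2 Ω) (stripTrace Ω ε) u φ := by
  have h : ∫ x, g (fn u x) * fn φ x ∂stripMeasure Ω ε =
      ∫ x, g (stripTrace Ω ε u x) * stripTrace Ω ε φ x ∂stripMeasure Ω ε := by
    apply integral_congr_ae
    filter_upwards [coeFn_stripTrace ε u, coeFn_stripTrace ε φ] with x h1 h2
    exact (congrArg₂ (fun s t => g s * t) h1 h2).symm
  exact congrArg₂ (· + ·) rfl ((integral_stripMeasure _ hε).symm.trans h)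

/-- At `0` the resolvent operator of the linearization solves the linearized problem. -/
theorem exists_solution_operator {a : E3 → ℝ} {f g : ℝ → ℝ} {u : H1 Ω}
    (h : (0 : ℝ) ∉ linearizationSpectrum a f g u) :
    ∃ R : StrongDual ℝ (H1 Ω) → H1 Ω, ∀ (ℓ : StrongDual ℝ (H1 Ω)) (w : H1 Ω),
      (∀ φ, ellipticForm a (toL2 Ω) (gradL2 Ω) w φ -
        reactionDerivForm f g (toL2 Ω) (trace Ω) u w φ = ℓ φ) ↔ w = R ℓ := by
  refine (not_not.1 h).elim fun R hR => ⟨R, fun ℓ w => Iff.trans ?_ (hR ℓ w)⟩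
  refine forall_congr' fun φ => ?_
  rw [zero_mul, sub_zero]
  rfl

theorem mem_limitSolutions {a : E3 → ℝ} {f g : ℝ → ℝ} {u : H1 Ω} : u ∈ limitSolutions Ω a f g ↔
    ∀ φ, ellipticForm a (toL2 Ω) (gradL2 Ω) u φ - reactionForm f g (toL2 Ω) (trace Ω) u φ = 0 :=
  Iff.rfl

theorem mem_concentratedSolutions {a : E3 → ℝ} {f g : ℝ → ℝ} {ε : ℝ} (hε : 0 < ε) {u : H1 Ω} :
    u ∈ concentratedSolutions Ω a f g ε ↔ ∀ φ, ellipticForm a (toL2 Ω) (gradL2 Ω) u φ -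
      reactionForm f g (toL2 Ω) (stripTrace Ω ε) u φ = 0 := by
  refine forall_congr' fun φ => ?_
  rw [pairF_eq f g hε]
  rfl

theorem exists_radius_of_eventually {Z : Type*} [TopologicalSpace Z] {E₀ : Set Z} {E : ℝ → Set Z}
    (h : ∃ (k : ℕ) (u₀ : Fin k → Z), Function.Injective u₀ ∧ range u₀ = E₀ ∧
      ∃ u : ℝ → Fin k → Z, (∀ᶠ ε in 𝓝[>] 0, Function.Injective (u ε) ∧ range (u ε) = E ε) ∧
        ∀ i, Tendsto (fun ε => u ε i) (𝓝[>] 0) (𝓝 (u₀ i))) :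
    ∃ (k : ℕ) (u₀ : Fin k → Z), Function.Injective u₀ ∧ range u₀ = E₀ ∧
      ∃ (ε₀ : ℝ) (u : ℝ → Fin k → Z), 0 < ε₀ ∧
        (∀ ε ∈ Ioc 0 ε₀, Function.Injective (u ε) ∧ range (u ε) = E ε) ∧
        ∀ i, Tendsto (fun ε => u ε i) (𝓝[>] 0) (𝓝 (u₀ i)) := by
  obtain ⟨k, u₀, h1, h2, u, h3, h4⟩ := h
  obtain ⟨ε₀, hε₀, h5⟩ := mem_nhdsGT_iff_exists_Ioc_subset.1 h3
  exact ⟨k, u₀, h1, h2, ε₀, u, hε₀, fun ε hε => h5 hε, h4⟩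

theorem IsSmoothBoundedOpen.isFiniteMeasure_restrict (hΩ : IsSmoothBoundedOpen Ω) :
    IsFiniteMeasure (volume.restrict Ω) := ⟨by
  rw [Measure.restrict_apply_univ]
  exact hΩ.isBounded.measure_lt_top⟩

/-- The theorem with the final radius `ε₀` in the form of a statement about all small `ε`. -/
theorem IsSmoothBoundedOpen.exists_equilibria (hΩ : IsSmoothBoundedOpen Ω) {a : E3 → ℝ}
    {f g : ℝ → ℝ} {K K' a₀ a₁ : ℝ} (hm : AEStronglyMeasurable a (volume.restrict Ω)) (ha₀ : 0 < a₀)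
    (h₀ : ∀ᵐ x ∂volume.restrict Ω, a₀ ≤ a x) (h₁ : ∀ᵐ x ∂volume.restrict Ω, |a x| ≤ a₁)
    (hf : IsRegular K f) (hg : IsRegular K' g)
    (hinv : ∀ u ∈ limitSolutions Ω a f g, (0 : ℝ) ∉ linearizationSpectrum a f g u) :
    ∃ (k : ℕ) (u₀ : Fin k → H1 Ω), Function.Injective u₀ ∧ range u₀ = limitSolutions Ω a f g ∧
      ∃ u : ℝ → Fin k → H1 Ω, (∀ᶠ ε in 𝓝[>] 0, Function.Injective (u ε) ∧
        range (u ε) = concentratedSolutions Ω a f g ε) ∧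
        ∀ i, Tendsto (fun ε => u ε i) (𝓝[>] 0) (𝓝 (u₀ i)) := by
  have := Fact.mk hΩ.isBounded
  have := hΩ.isFiniteMeasure_surface
  have := hΩ.isFiniteMeasure_restrict
  have key := exists_weak_solutions (H := H1 Ω) (S := toL2 Ω) (P := gradL2 Ω) (T := stripTrace Ω)
    (T₀ := trace Ω) (l := 𝓝[>] (0 : ℝ)) norm_sq_eq (hΩ.isTraceFamily_toL2 _)
    hΩ.isTraceFamily_stripTrace hm h₁ ha₀ h₀ hf hg
  refine (key fun u hu => exists_solution_operator (hinv u (mem_limitSolutions.2 hu))).imp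
    fun k => Exists.imp fun u₀ h => ⟨h.1, h.2.1, h.2.2.imp fun u h' => ⟨?_, h'.2⟩⟩
  filter_upwards [h'.1, self_mem_nhdsWithin] with ε h3 hε
  exact ⟨h3.1, h3.2.trans (Set.ext fun v => (mem_concentratedSolutions hε).symm)⟩

end ConcentratedEquilibria

end

theorem theorem5p7 (Ω : Set ConcentratedEquilibria.E3)
    (hΩ : ConcentratedEquilibria.IsSmoothBoundedOpen Ω)
    (a : ConcentratedEquilibria.E3 → ℝ)
    (ha : ConcentratedEquilibria.IsAdmissibleCoefficient Ω a)
    (f g : ℝ → ℝ)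
    (hf : ConcentratedEquilibria.IsAdmissibleNonlinearity f)
    (hg : ConcentratedEquilibria.IsAdmissibleNonlinearity g)
    (hinv : ∀ u ∈ ConcentratedEquilibria.limitSolutions Ω a f g,
      (0 : ℝ) ∉ ConcentratedEquilibria.linearizationSpectrum a f g u) :
    ∃ (k : ℕ) (u₀ : Fin k → ConcentratedEquilibria.H1 Ω),
      Function.Injective u₀ ∧
      Set.range u₀ = ConcentratedEquilibria.limitSolutions Ω a f g ∧
      ∃ (ε₀ : ℝ) (u : ℝ → Fin k → ConcentratedEquilibria.H1 Ω), 0 < ε₀ ∧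
        (∀ ε ∈ Set.Ioc 0 ε₀,
          Function.Injective (u ε) ∧
          Set.range (u ε) = ConcentratedEquilibria.concentratedSolutions Ω a f g ε) ∧
        ∀ i : Fin k, Filter.Tendsto (fun ε => u ε i) (𝓝[>] 0) (𝓝 (u₀ i)) :=
  ConcentratedEquilibria.exists_radius_of_eventually <|
    hf.exists_isRegular.elim fun _ hf => hg.exists_isRegular.elim fun _ hg =>
    (ha.ae_bounds hΩ.isOpen).elim fun _ h => h.elim fun _ h =>
    hΩ.exists_equilibria (ha.aestronglyMeasurable hΩ.isOpen) h.1 h.2.1 h.2.2 hf hg hinv
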